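/- Let $M$ be a closed smooth 3-manifold with an oriented contact structure $\xi$, let $J:\xi\to\xi$ be a smooth endomorphism with $J^2=-1$, and let $\hat\theta$ be a contact form for $\xi$ such that $(J,\hat\theta)$ is a positive pseudohermitian structure, i.e. $d\hat\theta(v,Jv)>0$ for $0\ne v\in\xi$. *Definitions.* For such a contact form $\theta$, an admissible frame on an open set $U$ consists of the characteristic vector field $T$ ($\theta(T)=1$, $d\theta(T,\cdot)=0$), a complex vector field $Z_1$ with $JZ_1=iZ_1$, $Z_{\bar1}=\overline{Z_1}$, and a smooth complex 1-form $\theta^1$, $\theta^{\bar1}=\overline{\theta^1}$, such that $\{\theta,\theta^1,\theta^{\bar1}\}$ is dual to $\{T,Z_1,Z_{\bar1}\}$ and $d\theta=i\theta^1\wedge\theta^{\bar1}$. The connection form $\omega_1{}^1$ and the torsion $A_{\bar1\bar1}$ are determined by $$d\theta^1=\theta^1\wedge\omega_1{}^1+A_{\bar1\bar1}\,\theta\wedge\theta^{\bar1},\qquad \omega_1{}^1+\overline{\omega_1{}^1}=0,$$ and $A_{11}=\overline{A_{\bar1\bar1}}$. The Tanaka-Webster curvature is the real function $W$ with $d\omega_1{}^1\equiv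 W\,\theta^1\wedge\theta^{\bar1}$ modulo $\theta$. For a function $f$ put $f_{,1}=Z_1f$, $f_{,\bar1}=Z_{\bar1}f$, $f_{,11}=Z_1Z_1f-\omega_1{}^1(Z_1)Z_1f$, $f_{,1\bar1}=Z_{\bar1}Z_1f-\omega_1{}^1(Z_{\bar1})Z_1f$, $f_{,\bar11}=Z_1Z_{\bar1}f-\overline{\omega_1{}^1}(Z_1)Z_{\bar1}f$ (where $\overline{\omega_1{}^1}$ is the conjugate form, extended complex linearly), and $\Delta_bf=f_{,1\bar1}+f_{,\bar11}$. The functions $W$ and $\Delta_bf$ do not depend on the admissible frame. *Lemma 2.1.* Let $\mathcal I\subset\mathbb R$ be an interval with more than one point, let $\lambda:\mathcal I\times M\to\mathbb R$ be smooth, and suppose that the contact forms $\theta_{(t)}=e^{2\lambda_{(t)}}\hat\theta$ satisfy the Yamabe flow $$\partial_t\theta_{(t)}=-2W_{(t)}\theta_{(t)}\qquad(t\in\mathcal I),$$ where $W=W_{(t)}$ is the Tanaka-Webster curvature of $(J,\theta_{(t)})$ and time derivatives at end points of $\mathcal I$ are one-sided. Then for all $t\in\mathcal I$, at every point of $M$,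 $$\dot W=4\Delta_bW+2W^2.$$ Moreover, let $(\hat T,\hat Z_1,\hat\theta^1)$ be an admissible frame of $\hat\theta$ on an open set $U\subset M$, and let $\theta_{(t)}$ be given on $U$ the induced coframe $$\theta^1_{(t)}=e^{\lambda_{(t)}}\bigl(\hat\theta^1+2i(\hat Z_{\bar1}\lambda_{(t)})\hat\theta\bigr)$$ and the frame dual to $\{\theta_{(t)},\theta^1_{(t)},\theta^{\bar1}_{(t)}\}$. Then for all $t\in\mathcal I$, at every point of $U$, $$\dot{(A_{11})}=2WA_{11}-2iW_{,11}.$$ Here $\Delta_b$, $A_{11}$ and the covariant derivatives are those of $\theta_{(t)}$ and of this coframe. -/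

import Mathlib

open Set
open scoped Manifold ContDiff

noncomputable section

namespace CRYamabe

variable {M : Type*} [TopologicalSpace M] [ChartedSpace (EuclideanSpace ℝ (Fin 3)) M]

/-! ### One-forms on a smooth 3-manifold -/

/-- A 1-form on `M` with values in `F` (`F = ℝ`: real 1-forms, `F = ℂ`: complex 1-forms). -/
abbrev OneForm (M : Type*) [TopologicalSpace M] [ChartedSpace (EuclideanSpace ℝ (Fin 3)) M]
    (F : Type*) [NormedAddCommGroup F] [NormedSpace ℝ F] : Type _ :=
  (x : M) → TangentSpace (𝓡 3) x →L[ℝ] F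

/-- The expression of a 1-form in the chart centred at `x₀`: its pull-back under the inverse
of the chart. -/
def OneForm.inChart {F : Type*} [NormedAddCommGroup F] [NormedSpace ℝ F]
    (α : OneForm M F) (x₀ : M) (y : EuclideanSpace ℝ (Fin 3)) :
    EuclideanSpace ℝ (Fin 3) →L[ℝ] F :=
  (α ((extChartAt (𝓡 3) x₀).symm y)).comp
    (mfderiv 𝓘(ℝ, EuclideanSpace ℝ (Fin 3)) (𝓡 3) (extChartAt (𝓡 3) x₀).symm y)

/-- A 1-form is smooth on `U` if its expressions in all charts are. -/
def OneForm.SmoothOn {F : Type*} [NormedAddCommGroup F] [NormedSpace ℝ F]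
    (α : OneForm M F) (U : Set M) : Prop :=
  ∀ x₀ : M, ContDiffOn ℝ ∞ (α.inChart x₀)
    ((extChartAt (𝓡 3) x₀).target ∩ (extChartAt (𝓡 3) x₀).symm ⁻¹' U)

/-- The exterior derivative of a 1-form at `x`, computed in the chart at `x`, in the convention
`dα(X, Y) = X α(Y) - Y α(X) - α([X, Y])`. -/
def OneForm.d {F : Type*} [NormedAddCommGroup F] [NormedSpace ℝ F]
    (α : OneForm M F) (x : M) (v w : TangentSpace (𝓡 3) x) : F :=
  let φ := mfderiv (𝓡 3) 𝓘(ℝ, EuclideanSpace ℝ (Fin 3)) (extChartAt (𝓡 3) x) x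
  fderiv ℝ (α.inChart x) (extChartAt (𝓡 3) x x) (φ v) (φ w)
    - fderiv ℝ (α.inChart x) (extChartAt (𝓡 3) x x) (φ w) (φ v)

/-- The complex conjugate of a complex 1-form, at a point. -/
def conjForm {x : M} (α : TangentSpace (𝓡 3) x →L[ℝ] ℂ) : TangentSpace (𝓡 3) x →L[ℝ] ℂ :=
  (Complex.conjCLE : ℂ →L[ℝ] ℂ).comp α

/-- A real covector regarded as a complex one. -/
def complexForm {x : M} (α : TangentSpace (𝓡 3) x →L[ℝ] ℝ) : TangentSpace (𝓡 3) x →L[ℝ] ℂ :=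
  Complex.ofRealCLM.comp α

/-- The wedge product of two complex covectors, in the convention
`(α ∧ β)(v, w) = α(v) β(w) - α(w) β(v)`, which goes with that of `OneForm.d`. -/
def wedge {x : M} (α β : TangentSpace (𝓡 3) x →L[ℝ] ℂ) (v w : TangentSpace (𝓡 3) x) : ℂ :=
  α v * β w - α w * β v

/-! ### Complex tangent vectors -/

/-- A complex tangent vector `X + iY` in `T_x M ⊗ ℂ`, given as the pair `(X, Y)`. -/
abbrev ComplexTangent (x : M) : Type := TangentSpace (𝓡 3) x × TangentSpace (𝓡 3) x

/-- The conjugate `X - iY` of `X + iY`. -/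
def conjVec {x : M} (z : ComplexTangent x) : ComplexTangent x := (z.1, -z.2)

/-- The complex linear extension of a covector, evaluated at `X + iY`. -/
def evalC {x : M} (α : TangentSpace (𝓡 3) x →L[ℝ] ℂ) (z : ComplexTangent x) : ℂ :=
  α z.1 + Complex.I * α z.2

/-- The complex bilinear extension of a bilinear form, evaluated at two complex vectors. -/
def evalC₂ {x : M} (β : TangentSpace (𝓡 3) x → TangentSpace (𝓡 3) x → ℂ)
    (z w : ComplexTangent x) : ℂ :=
  β z.1 w.1 - β z.2 w.2 + Complex.I * (β z.1 w.2 + β z.2 w.1)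

/-- The derivative `Z f` of a complex function along a complex vector field. -/
def along (Z : (x : M) → ComplexTangent x) (f : M → ℂ) (x : M) : ℂ :=
  evalC (mfderiv (𝓡 3) 𝓘(ℝ, ℂ) f x : TangentSpace (𝓡 3) x →L[ℝ] ℂ) (Z x)

/-! ### CR structures and pseudohermitian structures -/

/-- A plane field `ξ` with a smooth endomorphism `J : ξ → ξ`, `J² = -1`. (That `ξ` is a smooth
contact structure is expressed by the contact forms below.) -/
structure CRStructure (M : Type*) [TopologicalSpace M]
    [ChartedSpace (EuclideanSpace ℝ (Fin 3)) M] [IsManifold (𝓡 3) ∞ M] where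
  ξ : (x : M) → Submodule ℝ (TangentSpace (𝓡 3) x)
  J : (x : M) → ξ x →ₗ[ℝ] ξ x
  J_sq : ∀ (x : M) (v : ξ x), J x (J x v) = -v
  J_smooth : ∀ (U : Set M) (V : (x : M) → ξ x), IsOpen U →
    ContMDiffOn (𝓡 3) (𝓡 3).tangent ∞
      (fun x => (⟨x, (V x : TangentSpace (𝓡 3) x)⟩ : TangentBundle (𝓡 3) M)) U →
    ContMDiffOn (𝓡 3) (𝓡 3).tangent ∞
      (fun x => (⟨x, (J x (V x) : TangentSpace (𝓡 3) x)⟩ : TangentBundle (𝓡 3) M)) U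

variable [IsManifold (𝓡 3) ∞ M]

/-- `θ` is a contact form for `ξ`: it is smooth, its kernel is `ξ`, and `θ ∧ dθ` vanishes
nowhere. -/
structure IsContactForm (C : CRStructure M) (θ : OneForm M ℝ) : Prop where
  smooth : θ.SmoothOn univ
  mem_ker : ∀ (x : M) (v : TangentSpace (𝓡 3) x), v ∈ C.ξ x ↔ θ x v = 0
  contact : ∀ x : M, ∃ u v w : TangentSpace (𝓡 3) x,
    θ x u * θ.d x v w + θ x v * θ.d x w u + θ x w * θ.d x u v ≠ 0

/-- `(J, θ)` is a positive pseudohermitian structure: `θ` is a contact form for `ξ` and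
`dθ(v, Jv) > 0` for `0 ≠ v ∈ ξ`, that is, `h₁₁̄ > 0` for every nonzero `Z₁`. -/
structure IsPositivePseudohermitian (C : CRStructure M) (θ : OneForm M ℝ) : Prop
    extends IsContactForm C θ where
  pos : ∀ (x : M) (v : C.ξ x), v ≠ 0 → 0 < θ.d x (v : TangentSpace (𝓡 3) x) (C.J x v)

/-- The data of a local frame `(T, Z₁, Z₁̄)` and of a form `θ¹`; the fields matter only on
the open set on which the frame is used. -/
structure LocalFrame (M : Type*) [TopologicalSpace M]
    [ChartedSpace (EuclideanSpace ℝ (Fin 3)) M] where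
  T : (x : M) → TangentSpace (𝓡 3) x
  Z : (x : M) → ComplexTangent x
  θ1 : OneForm M ℂ

/-- The vector field `Z₁̄`. -/
def LocalFrame.Zbar (F : LocalFrame M) (x : M) : ComplexTangent x := conjVec (F.Z x)

/-- On `U`, the coframe `(θ, θ¹, θ¹̄)` is dual to `(T, Z₁, Z₁̄)`. (The remaining relations are
the conjugates of those listed.) -/
structure LocalFrame.IsDualOn (F : LocalFrame M) (θ : OneForm M ℝ) (U : Set M) : Prop where
  θ_T : ∀ x ∈ U, θ x (F.T x) = 1
  θ_Z : ∀ x ∈ U, evalC (complexForm (θ x)) (F.Z x) = 0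
  θ1_T : ∀ x ∈ U, F.θ1 x (F.T x) = 0
  θ1_Z : ∀ x ∈ U, evalC (F.θ1 x) (F.Z x) = 1
  θ1_Zbar : ∀ x ∈ U, evalC (F.θ1 x) (F.Zbar x) = 0

/-- `F` is an admissible frame of `(J, θ)` on `U`: `T` is the characteristic vector field of `θ`,
`J Z₁ = i Z₁`, the coframe is smooth and dual to the frame, and `dθ = i θ¹ ∧ θ¹̄`. -/
structure LocalFrame.IsAdmissibleOn (F : LocalFrame M) (C : CRStructure M) (θ : OneForm M ℝ)
    (U : Set M) : Prop extends F.IsDualOn θ U where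
  θ1_smooth : F.θ1.SmoothOn U
  char : ∀ x ∈ U, ∀ v : TangentSpace (𝓡 3) x, θ.d x (F.T x) v = 0
  eigen : ∀ x ∈ U, ∃ X Y : C.ξ x, F.Z x = (↑X, ↑Y) ∧ C.J x X = -Y ∧ C.J x Y = X
  levi : ∀ x ∈ U, ∀ v w : TangentSpace (𝓡 3) x,
    (θ.d x v w : ℂ) = Complex.I * wedge (F.θ1 x) (conjForm (F.θ1 x)) v w

/-! ### Connection, torsion and curvature -/

/-- The structure equation at `x` for a value `η` of the connection form and a value `a` of the
torsion: `dθ¹ = θ¹ ∧ η + a θ ∧ θ¹̄` and `η + η̄ = 0`. -/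
def LocalFrame.StructureEq (F : LocalFrame M) (θ : OneForm M ℝ) (x : M)
    (η : TangentSpace (𝓡 3) x →L[ℝ] ℂ) (a : ℂ) : Prop :=
  (∀ v w : TangentSpace (𝓡 3) x, F.θ1.d x v w =
    wedge (F.θ1 x) η v w + a * wedge (complexForm (θ x)) (conjForm (F.θ1 x)) v w) ∧
  η + conjForm η = 0

/-- The connection form `ω₁¹`: the 1-form determined by the structure equation. -/
def LocalFrame.ω (F : LocalFrame M) (θ : OneForm M ℝ) : OneForm M ℂ := fun x =>
  Classical.epsilon fun η => ∃ a : ℂ, F.StructureEq θ x η a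

/-- The torsion coefficient `A¹₁̄ = A₁̄₁̄` in the structure equation. -/
def LocalFrame.Abar (F : LocalFrame M) (θ : OneForm M ℝ) (x : M) : ℂ :=
  Classical.epsilon fun a => F.StructureEq θ x (F.ω θ x) a

/-- The torsion `A₁₁`, the conjugate of `A₁̄₁̄`. -/
def LocalFrame.A11 (F : LocalFrame M) (θ : OneForm M ℝ) (x : M) : ℂ :=
  (starRingEnd ℂ) (F.Abar θ x)

/-- The coefficient of `θ¹ ∧ θ¹̄` in `dω₁¹`, that is `dω₁¹(Z₁, Z₁̄)`. -/
def LocalFrame.curv (F : LocalFrame M) (θ : OneForm M ℝ) (x : M) : ℂ :=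
  evalC₂ ((F.ω θ).d x) (F.Z x) (F.Zbar x)

/-- The second covariant derivative `f_{,11} = Z₁Z₁f - ω₁¹(Z₁)Z₁f`. -/
def LocalFrame.hess11 (F : LocalFrame M) (θ : OneForm M ℝ) (f : M → ℂ) (x : M) : ℂ :=
  along F.Z (along F.Z f) x - evalC (F.ω θ x) (F.Z x) * along F.Z f x

/-- The second covariant derivative `f_{,11̄} = Z₁̄Z₁f - ω₁¹(Z₁̄)Z₁f`. -/
def LocalFrame.hess11bar (F : LocalFrame M) (θ : OneForm M ℝ) (f : M → ℂ) (x : M) : ℂ :=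
  along F.Zbar (along F.Z f) x - evalC (F.ω θ x) (F.Zbar x) * along F.Z f x

/-- The second covariant derivative `f_{,1̄1} = Z₁Z₁̄f - ω₁̄¹̄(Z₁)Z₁̄f`, where `ω₁̄¹̄` is the
conjugate of `ω₁¹`. -/
def LocalFrame.hess1bar1 (F : LocalFrame M) (θ : OneForm M ℝ) (f : M → ℂ) (x : M) : ℂ :=
  along F.Z (along F.Zbar f) x - evalC (conjForm (F.ω θ x)) (F.Z x) * along F.Zbar f x

/-- The Tanaka-Webster curvature `W` of `(J, θ)`: the real function with
`dω₁¹ = W θ¹ ∧ θ¹̄` modulo `θ`, computed in an admissible frame near the point (the value does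
not depend on the frame). -/
def websterCurvature (C : CRStructure M) (θ : OneForm M ℝ) (x : M) : ℝ :=
  Classical.epsilon fun r : ℝ => ∃ (U : Set M) (F : LocalFrame M),
    IsOpen U ∧ x ∈ U ∧ F.IsAdmissibleOn C θ U ∧ (r : ℂ) = F.curv θ x

/-- The sublaplacian `Δ_b f = f_{,11̄} + f_{,1̄1}` of a real function, computed in an admissible
frame near the point (the value does not depend on the frame). -/
def subLaplacian (C : CRStructure M) (θ : OneForm M ℝ) (f : M → ℝ) (x : M) : ℝ :=
  Classical.epsilon fun r : ℝ => ∃ (U : Set M) (F : LocalFrame M),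
    IsOpen U ∧ x ∈ U ∧ F.IsAdmissibleOn C θ U ∧
      (r : ℂ) = F.hess11bar θ (fun y => (f y : ℂ)) x + F.hess1bar1 θ (fun y => (f y : ℂ)) x

/-! ### Conformal change and the Yamabe flow -/

/-- The contact form `e^{2u} θ`. -/
def conformal (u : M → ℝ) (θ : OneForm M ℝ) : OneForm M ℝ := fun x => Real.exp (2 * u x) • θ x

/-- The form `e^u (θ¹ + 2i u_{,1̄} θ)` which completes `e^{2u} θ` to a coframe. -/
def inducedθ1 (u : M → ℝ) (θ : OneForm M ℝ) (F : LocalFrame M) : OneForm M ℂ := fun x =>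
  (Real.exp (u x) : ℂ) •
    (F.θ1 x + (2 * Complex.I * along F.Zbar (fun y => (u y : ℂ)) x) • complexForm (θ x))

/-- `F'` is on `U` the frame of `e^{2u} θ` induced by the frame `F` of `θ`: its `θ¹` is the
form `inducedθ1`, and the vector fields are dual to the coframe. -/
structure IsInducedFrame (u : M → ℝ) (θ : OneForm M ℝ) (U : Set M) (F F' : LocalFrame M) :
    Prop where
  dual : F'.IsDualOn (conformal u θ) U
  θ1_eq : ∀ x ∈ U, F'.θ1 x = inducedθ1 u θ F x

/-- The Yamabe flow `∂ₜ θₜ = -2 Wₜ θₜ` on the time interval `I`, where `Wₜ` is the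
Tanaka-Webster curvature of `(J, θₜ)`. The derivative at an end point of `I` is one-sided. -/
def IsYamabeFlow (C : CRStructure M) (I : Set ℝ) (θ : ℝ → OneForm M ℝ) : Prop :=
  ∀ t ∈ I, ∀ (x : M) (v : TangentSpace (𝓡 3) x),
    HasDerivWithinAt (fun s => θ s x v) (-2 * websterCurvature C (θ t) x * θ t x v) I t

end CRYamabe

end

open CRYamabe

/-!
Let `θ_s = e^{2λ_s} θ̂` satisfy the flow `∂ₛ θ_s = -2 W_s θ_s`. Evaluating on a vector `v` with
`θ̂(v) ≠ 0` and taking logarithms gives `λ̇ = -W`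
(`IsYamabeFlow.hasDerivWithinAt_conformalFactor`); in particular `W` is smooth on `M`. Fix a time `t`
and put `u_s = λ_s - λ_t`. Then `θ_s = e^{2u_s} θ_t`, `u_t = 0`, `u̇_t = -W_t`, and the frames induced
from a frame of `θ̂` at the times `t` and `s` are related in the same way through `u_s`
(`IsInducedFrame.sub`). The evolution equations are therefore the first variations of the
transformation laws under a conformal change `θ̃ = e^{2u} θ`,

* `W̃ = e^{-2u} (W - 4 Δ_b u - 8 |u_{,1}|²)` (`IsInducedFrame.curv_eq`),
* `Ã₁₁ = e^{-2u} (A₁₁ + 2i u_{,11} - 4i (u_{,1})²)` (`IsInducedFrame.A11_eq`).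

At time `t` the terms quadratic in `u` have vanishing derivative, so that `Ẇ = 2W·W + 4 Δ_b W` and
`(A₁₁)˙ = 2W A₁₁ - 2i W_{,11}`.

Both transformation laws follow from an explicit solution of the structure equation for the new
coframe (`IsInducedFrame.structureEq`). The solution of the structure equation is unique
(`StructureEq.unique`), because evaluating it on the frame yields all components of the connection
form and the torsion; it exists because `d(dθ) = 0` forces `dθ¹(T, Z₁)` to be imaginary
(`IsAdmissibleOn.dTZ_imaginary`). The curvature of the new connection form is computed with
`d(u_{,1} θ¹ - u_{,1̄} θ¹̄) ≡ -Δ_b u θ¹ ∧ θ¹̄` modulo `θ` (`IsAdmissibleOn.dZZbar_gradForm`). This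
identity also shows that `Δ_b` does not depend on the frame, since the form
`u_{,1} θ¹ - u_{,1̄} θ¹̄` does not. For `W` one uses that two admissible frames differ by a function
with values in the unit circle (`IsAdmissibleOn.θ1_transition`), which changes the connection form
by a closed form.

Time derivatives commute with derivatives along vector fields because second derivatives within
`I × U` are symmetric, also at the end points of `I` (`hasDerivWithinAt_fderiv_slice`). Admissible
frames exist near every point (`IsPositivePseudohermitian.exists_frame`), so that the values chosen
in the definitions of `W` and `Δ_b` are the ones computed in frames.
-/

noncomputable section

namespace CRYamabe

local notation "𝔼" => EuclideanSpace ℝ (Fin 3)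

section Charts

variable {M : Type*} [TopologicalSpace M] [ChartedSpace (EuclideanSpace ℝ (Fin 3)) M]
  {F G : Type*} [NormedAddCommGroup F] [NormedSpace ℝ F] [NormedAddCommGroup G] [NormedSpace ℝ G]

/-! ### Charts -/

/-- The image of `U` in the chart centred at `x₀`. -/
def chartSet (x₀ : M) (U : Set M) : Set 𝔼 :=
  (extChartAt (𝓡 3) x₀).target ∩ (extChartAt (𝓡 3) x₀).symm ⁻¹' U

/-- The derivative at `x` of the chart centred at `x₀`, with values in the model space. -/
def chartD (x₀ x : M) : TangentSpace (𝓡 3) x →L[ℝ] 𝔼 :=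
  mfderiv (𝓡 3) 𝓘(ℝ, 𝔼) (extChartAt (𝓡 3) x₀) x

/-- The derivative at `y` of the inverse of the chart centred at `x₀`. -/
def chartDSymm (x₀ : M) (y : 𝔼) : 𝔼 →L[ℝ] TangentSpace (𝓡 3) ((extChartAt (𝓡 3) x₀).symm y) :=
  mfderiv 𝓘(ℝ, 𝔼) (𝓡 3) (extChartAt (𝓡 3) x₀).symm y

/-- A function is smooth on `U` if its expressions in all charts are. -/
def FnSmoothOn (f : M → F) (U : Set M) : Prop :=
  ∀ x₀ : M, ContDiffOn ℝ ∞ (fun y => f ((extChartAt (𝓡 3) x₀).symm y)) (chartSet x₀ U)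

/-- A vector field is smooth on `U` if its expressions in all charts are. -/
def VecSmoothOn (X : (x : M) → TangentSpace (𝓡 3) x) (U : Set M) : Prop :=
  ∀ x₀ : M, ContDiffOn ℝ ∞
    (fun y => chartD x₀ ((extChartAt (𝓡 3) x₀).symm y) (X ((extChartAt (𝓡 3) x₀).symm y)))
    (chartSet x₀ U)

/-- The differential of a function, as a 1-form. -/
def dForm (f : M → F) : OneForm M F := fun x => mfderiv (𝓡 3) 𝓘(ℝ, F) f x

lemma isOpen_chartSet (x₀ : M) {U : Set M} (hU : IsOpen U) : IsOpen (chartSet x₀ U) :=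
  (continuousOn_extChartAt_symm x₀).isOpen_inter_preimage (isOpen_extChartAt_target x₀) hU

lemma mem_chartSet {x₀ x : M} {U : Set M} (hx : x ∈ U) (h : x ∈ (extChartAt (𝓡 3) x₀).source) :
    extChartAt (𝓡 3) x₀ x ∈ chartSet x₀ U :=
  ⟨(extChartAt (𝓡 3) x₀).map_source h, by
    rw [mem_preimage, (extChartAt (𝓡 3) x₀).left_inv h]; exact hx⟩

lemma chartSet_mono (x₀ : M) {U V : Set M} (h : U ⊆ V) : chartSet x₀ U ⊆ chartSet x₀ V :=
  fun _ hy => ⟨hy.1, h hy.2⟩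

lemma FnSmoothOn.mono {f : M → F} {U V : Set M} (hf : FnSmoothOn f V) (h : U ⊆ V) :
    FnSmoothOn f U := fun x₀ => (hf x₀).mono (chartSet_mono x₀ h)

lemma VecSmoothOn.mono {X : (x : M) → TangentSpace (𝓡 3) x} {U V : Set M}
    (hf : VecSmoothOn X V) (h : U ⊆ V) : VecSmoothOn X U :=
  fun x₀ => (hf x₀).mono (chartSet_mono x₀ h)

lemma OneForm.SmoothOn.mono {α : OneForm M F} {U V : Set M} (hf : α.SmoothOn V) (h : U ⊆ V) :
    α.SmoothOn U := fun x₀ => (hf x₀).mono (chartSet_mono x₀ h)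

lemma OneForm.inChart_apply' (α : OneForm M F) (x₀ : M) (y u : 𝔼) :
    α.inChart x₀ y u = α ((extChartAt (𝓡 3) x₀).symm y) (chartDSymm x₀ y u) := rfl

lemma OneForm.SmoothOn.contDiffAt {α : OneForm M F} {U : Set M} (hα : α.SmoothOn U)
    (hU : IsOpen U) {x x₀ : M} (hx : x ∈ U) (hx₀ : x ∈ (extChartAt (𝓡 3) x₀).source) :
    ContDiffAt ℝ ∞ (α.inChart x₀) (extChartAt (𝓡 3) x₀ x) :=
  (hα x₀).contDiffAt ((isOpen_chartSet x₀ hU).mem_nhds (mem_chartSet hx hx₀))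

lemma FnSmoothOn.contDiffAt {f : M → F} {U : Set M} (hf : FnSmoothOn f U)
    (hU : IsOpen U) {x x₀ : M} (hx : x ∈ U) (hx₀ : x ∈ (extChartAt (𝓡 3) x₀).source) :
    ContDiffAt ℝ ∞ (fun y => f ((extChartAt (𝓡 3) x₀).symm y)) (extChartAt (𝓡 3) x₀ x) :=
  (hf x₀).contDiffAt ((isOpen_chartSet x₀ hU).mem_nhds (mem_chartSet hx hx₀))

lemma two_le_smooth : minSmoothness ℝ 2 ≤ (∞ : WithTop ℕ∞) := by
  rw [minSmoothness_of_isRCLikeNormedField]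
  exact WithTop.coe_le_coe.2 (le_top : (2 : ℕ∞) ≤ ⊤)

variable [IsManifold (𝓡 3) ∞ M]

lemma isManifold_one : IsManifold (𝓡 3) 1 M := IsManifold.of_le (n := ∞) (by simp)

lemma chartD_comp_chartDSymm {x₀ : M} {y : 𝔼} (hy : y ∈ (extChartAt (𝓡 3) x₀).target) (u : 𝔼) :
    chartD x₀ ((extChartAt (𝓡 3) x₀).symm y) (chartDSymm x₀ y u) = u := by
  have : IsManifold (𝓡 3) 1 M := isManifold_one
  have h := mfderiv_extChartAt_comp_mfderivWithin_extChartAt_symm (I := 𝓡 3) hy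
  simp only [modelWithCornersSelf_coe, range_id, mfderivWithin_univ] at h
  exact DFunLike.congr_fun h u

lemma chartDSymm_comp_chartD {x₀ : M} {y : 𝔼} (hy : y ∈ (extChartAt (𝓡 3) x₀).target)
    (v : TangentSpace (𝓡 3) ((extChartAt (𝓡 3) x₀).symm y)) :
    chartDSymm x₀ y (chartD x₀ ((extChartAt (𝓡 3) x₀).symm y) v) = v := by
  have : IsManifold (𝓡 3) 1 M := isManifold_one
  have h := mfderivWithin_extChartAt_symm_comp_mfderiv_extChartAt (I := 𝓡 3) hy
  simp only [modelWithCornersSelf_coe, range_id, mfderivWithin_univ] at h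
  exact DFunLike.congr_fun h v

lemma chartD_injective {x₀ x : M} (hx : x ∈ (extChartAt (𝓡 3) x₀).source) :
    Function.Injective (chartD x₀ x) := by
  have hy := (extChartAt (𝓡 3) x₀).map_source hx
  rw [← (extChartAt (𝓡 3) x₀).left_inv hx]
  exact Function.LeftInverse.injective (chartDSymm_comp_chartD hy)

lemma OneForm.inChart_chartD (α : OneForm M F) {x₀ x : M}
    (hx : x ∈ (extChartAt (𝓡 3) x₀).source) (v : TangentSpace (𝓡 3) x) :
    α.inChart x₀ (extChartAt (𝓡 3) x₀ x) (chartD x₀ x v) = α x v := by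
  obtain ⟨y, hy, rfl⟩ : ∃ y ∈ (extChartAt (𝓡 3) x₀).target, (extChartAt (𝓡 3) x₀).symm y = x :=
    ⟨_, (extChartAt (𝓡 3) x₀).map_source hx, (extChartAt (𝓡 3) x₀).left_inv hx⟩
  rw [(extChartAt (𝓡 3) x₀).right_inv hy, OneForm.inChart_apply', chartDSymm_comp_chartD hy]

lemma OneForm.inChart_chartD' (α : OneForm M F) {x₀ : M} {y : 𝔼}
    (hy : y ∈ (extChartAt (𝓡 3) x₀).target)
    (v : TangentSpace (𝓡 3) ((extChartAt (𝓡 3) x₀).symm y)) :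
    α.inChart x₀ y (chartD x₀ _ v) = α _ v := by
  rw [OneForm.inChart_apply', chartDSymm_comp_chartD hy]

/-! ### Change of charts -/

/-- The change from the chart centred at `x₁` to the chart centred at `x₀`. -/
def chartChange (x₀ x₁ : M) (y : 𝔼) : 𝔼 := extChartAt (𝓡 3) x₀ ((extChartAt (𝓡 3) x₁).symm y)

lemma mdifferentiableAt_chart {x₀ x : M} (hx : x ∈ (extChartAt (𝓡 3) x₀).source) :
    MDifferentiableAt (𝓡 3) 𝓘(ℝ, 𝔼) (extChartAt (𝓡 3) x₀) x := by
  have : IsManifold (𝓡 3) 1 M := isManifold_one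
  exact mdifferentiableAt_extChartAt (by rwa [extChartAt_source] at hx)

lemma mdifferentiableAt_chart_symm {x₀ : M} {y : 𝔼} (hy : y ∈ (extChartAt (𝓡 3) x₀).target) :
    MDifferentiableAt 𝓘(ℝ, 𝔼) (𝓡 3) (extChartAt (𝓡 3) x₀).symm y := by
  have : IsManifold (𝓡 3) 1 M := isManifold_one
  have h := mdifferentiableWithinAt_extChartAt_symm (I := 𝓡 3) hy
  simpa only [modelWithCornersSelf_coe, range_id, mdifferentiableWithinAt_univ] using h

lemma contDiffOn_chartChange (x₀ x₁ : M) :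
    ContDiffOn ℝ ∞ (chartChange x₀ x₁) (chartSet x₁ (extChartAt (𝓡 3) x₀).source) := by
  have h := contDiffOn_ext_coord_change (I := 𝓡 3) (n := ∞) x₀ x₁
  refine h.mono ?_
  rintro y ⟨hy, hy'⟩
  simp only [PartialEquiv.trans_source, PartialEquiv.symm_source]
  exact ⟨hy, hy'⟩

lemma fderiv_chartChange {x₀ x₁ : M} {y : 𝔼}
    (hy : y ∈ chartSet x₁ (extChartAt (𝓡 3) x₀).source) (u : 𝔼) :
    fderiv ℝ (chartChange x₀ x₁) y u = chartD x₀ _ (chartDSymm x₁ y u) := by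
  have h := mfderiv_comp y (mdifferentiableAt_chart hy.2) (mdifferentiableAt_chart_symm hy.1)
  rw [← mfderiv_eq_fderiv]
  exact DFunLike.congr_fun h u

lemma OneForm.inChart_change (α : OneForm M F) {x₀ x₁ : M} {y : 𝔼}
    (hy : y ∈ chartSet x₁ (extChartAt (𝓡 3) x₀).source) :
    α.inChart x₁ y
      = (α.inChart x₀ (chartChange x₀ x₁ y)).comp (fderiv ℝ (chartChange x₀ x₁) y) := by
  ext u
  rw [ContinuousLinearMap.comp_apply, fderiv_chartChange hy]
  exact (α.inChart_chartD hy.2 _).symm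

/-- Smoothness near a point may be checked in any one chart around it. -/
lemma FnSmoothOn.of_chart {f : M → F} {U : Set M}
    (h : ∀ x ∈ U, ∃ x₀ : M, x ∈ (extChartAt (𝓡 3) x₀).source ∧
      ContDiffAt ℝ ∞ (fun y => f ((extChartAt (𝓡 3) x₀).symm y)) (extChartAt (𝓡 3) x₀ x)) :
    FnSmoothOn f U := by
  intro x₁ y hy
  obtain ⟨x₀, hx₀, hc⟩ := h _ hy.2
  have hy' : y ∈ chartSet x₁ (extChartAt (𝓡 3) x₀).source := ⟨hy.1, hx₀⟩
  have ho := isOpen_chartSet x₁ (isOpen_extChartAt_source (I := 𝓡 3) x₀)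
  have hg := (contDiffOn_chartChange x₀ x₁).contDiffAt (ho.mem_nhds hy')
  refine ((hc.comp (f := chartChange x₀ x₁) y hg).congr_of_eventuallyEq ?_).contDiffWithinAt
  filter_upwards [ho.mem_nhds hy'] with z hz
  simp only [Function.comp, chartChange]
  rw [(extChartAt (𝓡 3) x₀).left_inv hz.2]

/-- The exterior derivative may be computed in any chart: the second derivative of the change of
charts is symmetric and cancels. -/
lemma OneForm.d_eq {α : OneForm M F} {U : Set M} (hα : α.SmoothOn U) (hU : IsOpen U)
    {x x₀ : M} (hx : x ∈ U) (hx₀ : x ∈ (extChartAt (𝓡 3) x₀).source)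
    (v w : TangentSpace (𝓡 3) x) :
    α.d x v w = fderiv ℝ (α.inChart x₀) (extChartAt (𝓡 3) x₀ x) (chartD x₀ x v) (chartD x₀ x w)
      - fderiv ℝ (α.inChart x₀) (extChartAt (𝓡 3) x₀ x) (chartD x₀ x w) (chartD x₀ x v) := by
  set y := extChartAt (𝓡 3) x x with hy
  have hxs : x ∈ (extChartAt (𝓡 3) x).source := mem_extChartAt_source x
  have hys : y ∈ chartSet x (extChartAt (𝓡 3) x₀).source := mem_chartSet hx₀ hxs
  have hgy : chartChange x₀ x y = extChartAt (𝓡 3) x₀ x := by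
    simp only [chartChange, hy, (extChartAt (𝓡 3) x).left_inv hxs]
  have ho := isOpen_chartSet x (isOpen_extChartAt_source (I := 𝓡 3) x₀)
  have hg := (contDiffOn_chartChange x₀ x).contDiffAt (ho.mem_nhds hys)
  have hdg : ContDiffAt ℝ ∞ (fderiv ℝ (chartChange x₀ x)) y := hg.fderiv_right (by simp)
  have hc := hα.contDiffAt hU hx hx₀
  rw [← hgy] at hc
  have hfd : ∀ v : TangentSpace (𝓡 3) x,
      fderiv ℝ (chartChange x₀ x) y (chartD x x v) = chartD x₀ x v := by
    intro v
    have h := (dForm (extChartAt (𝓡 3) x₀)).inChart_chartD hxs v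
    rw [OneForm.inChart_apply'] at h
    rw [fderiv_chartChange hys]
    exact h
  have heq : α.inChart x =ᶠ[nhds y] fun z =>
      (α.inChart x₀ (chartChange x₀ x z)).comp (fderiv ℝ (chartChange x₀ x) z) := by
    filter_upwards [ho.mem_nhds hys] with z hz
    exact α.inChart_change hz
  have hD : ∀ u u' : 𝔼, fderiv ℝ (α.inChart x) y u u'
      = fderiv ℝ (α.inChart x₀) (chartChange x₀ x y) (fderiv ℝ (chartChange x₀ x) y u)
          (fderiv ℝ (chartChange x₀ x) y u')
        + α.inChart x₀ (chartChange x₀ x y) (fderiv ℝ (fderiv ℝ (chartChange x₀ x)) y u u') := by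
    intro u u'
    rw [heq.fderiv_eq]
    have h1 : HasFDerivAt (fun z => α.inChart x₀ (chartChange x₀ x z)) _ y :=
      ((hc.differentiableAt (by simp)).hasFDerivAt).comp y
        (hg.differentiableAt (by simp)).hasFDerivAt
    have h2 := (hdg.differentiableAt (by simp)).hasFDerivAt
    rw [(h1.clm_comp h2).fderiv]
    simp [add_comm]
  have hsymm : IsSymmSndFDerivAt ℝ (chartChange x₀ x) y :=
    hg.isSymmSndFDerivAt two_le_smooth
  change fderiv ℝ (α.inChart x) y (chartD x x v) (chartD x x w)
    - fderiv ℝ (α.inChart x) y (chartD x x w) (chartD x x v) = _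
  rw [hD, hD, hsymm (chartD x x w) (chartD x x v), hfd, hfd, hgy]
  abel

end Charts

section Calculus

variable {M : Type*} [TopologicalSpace M] [ChartedSpace (EuclideanSpace ℝ (Fin 3)) M]
  {F G : Type*} [NormedAddCommGroup F] [NormedSpace ℝ F] [NormedAddCommGroup G] [NormedSpace ℝ G]
  {𝕜 : Type*} [NormedField 𝕜] [NormedAlgebra ℝ 𝕜] [NormedSpace 𝕜 F] [IsScalarTower ℝ 𝕜 F]
  {U : Set M}

/-! ### Algebra of smooth functions and forms -/

lemma FnSmoothOn.const (c : F) : FnSmoothOn (fun _ : M => c) U := fun _ => contDiffOn_const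

lemma FnSmoothOn.add {f g : M → F} (hf : FnSmoothOn f U) (hg : FnSmoothOn g U) :
    FnSmoothOn (fun x => f x + g x) U := fun x₀ => (hf x₀).add (hg x₀)

lemma FnSmoothOn.sub {f g : M → F} (hf : FnSmoothOn f U) (hg : FnSmoothOn g U) :
    FnSmoothOn (fun x => f x - g x) U := fun x₀ => (hf x₀).sub (hg x₀)

lemma FnSmoothOn.neg {f : M → F} (hf : FnSmoothOn f U) :
    FnSmoothOn (fun x => -f x) U := fun x₀ => (hf x₀).neg

lemma FnSmoothOn.smul {f : M → 𝕜} {g : M → F} (hf : FnSmoothOn f U) (hg : FnSmoothOn g U) :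
    FnSmoothOn (fun x => f x • g x) U := fun x₀ => (hf x₀).smul (hg x₀)

lemma FnSmoothOn.mul {f g : M → 𝕜} (hf : FnSmoothOn f U) (hg : FnSmoothOn g U) :
    FnSmoothOn (fun x => f x * g x) U := fun x₀ => (hf x₀).mul (hg x₀)

lemma FnSmoothOn.congr {f g : M → F} (hf : FnSmoothOn f U) (h : ∀ x ∈ U, g x = f x) :
    FnSmoothOn g U := fun x₀ => (hf x₀).congr fun _ hy => h _ hy.2

lemma FnSmoothOn.comp {f : M → F} {φ : F → G} (hf : FnSmoothOn f U)
    (hφ : ∀ x ∈ U, ContDiffAt ℝ ∞ φ (f x)) : FnSmoothOn (fun x => φ (f x)) U :=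
  fun x₀ y hy => (hφ _ hy.2).comp_contDiffWithinAt y (hf x₀ y hy)

lemma FnSmoothOn.clm {f : M → F} (hf : FnSmoothOn f U) (L : F →L[ℝ] G) :
    FnSmoothOn (fun x => L (f x)) U := hf.comp fun _ _ => L.contDiff.contDiffAt

lemma FnSmoothOn.ofReal {f : M → ℝ} (hf : FnSmoothOn f U) :
    FnSmoothOn (fun x => (f x : ℂ)) U := hf.clm Complex.ofRealCLM

lemma FnSmoothOn.conj {f : M → ℂ} (hf : FnSmoothOn f U) :
    FnSmoothOn (fun x => (starRingEnd ℂ) (f x)) U := hf.clm (Complex.conjCLE : ℂ →L[ℝ] ℂ)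

lemma OneForm.SmoothOn.add {α β : OneForm M F} (hα : α.SmoothOn U) (hβ : β.SmoothOn U) :
    OneForm.SmoothOn (fun x => α x + β x) U := fun x₀ => (hα x₀).add (hβ x₀)

lemma OneForm.SmoothOn.smul {f : M → 𝕜} {α : OneForm M F} (hf : FnSmoothOn f U)
    (hα : α.SmoothOn U) : OneForm.SmoothOn (fun x => f x • α x) U :=
  fun x₀ => (hf x₀).smul (hα x₀)

lemma OneForm.SmoothOn.clm {α : OneForm M F} (hα : α.SmoothOn U) (L : F →L[ℝ] G) :
    OneForm.SmoothOn (fun x => L.comp (α x)) U := fun x₀ => contDiffOn_const.clm_comp (hα x₀)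

lemma OneForm.SmoothOn.complexForm {α : OneForm M ℝ} (hα : α.SmoothOn U) :
    OneForm.SmoothOn (fun x => complexForm (α x)) U := hα.clm Complex.ofRealCLM

lemma OneForm.SmoothOn.conjForm {α : OneForm M ℂ} (hα : α.SmoothOn U) :
    OneForm.SmoothOn (fun x => conjForm (α x)) U := hα.clm (Complex.conjCLE : ℂ →L[ℝ] ℂ)

lemma OneForm.SmoothOn.congr {α β : OneForm M F} (hα : α.SmoothOn U) (h : ∀ x ∈ U, β x = α x) :
    β.SmoothOn U := fun x₀ => (hα x₀).congr fun y hy => by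
      ext u; rw [OneForm.inChart_apply', OneForm.inChart_apply', h _ hy.2]

lemma VecSmoothOn.sub {X Y : (x : M) → TangentSpace (𝓡 3) x} (hX : VecSmoothOn X U)
    (hY : VecSmoothOn Y U) : VecSmoothOn (fun x => X x - Y x) U :=
  fun x₀ => ((hX x₀).sub (hY x₀)).congr fun _ _ => map_sub _ _ _

lemma VecSmoothOn.smul {f : M → ℝ} {X : (x : M) → TangentSpace (𝓡 3) x} (hf : FnSmoothOn f U)
    (hX : VecSmoothOn X U) : VecSmoothOn (fun x => f x • X x) U :=
  fun x₀ => ((hf x₀).smul (hX x₀)).congr fun _ _ => map_smul _ _ _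

lemma VecSmoothOn.congr {X Y : (x : M) → TangentSpace (𝓡 3) x} (hX : VecSmoothOn X U)
    (h : ∀ x ∈ U, Y x = X x) : VecSmoothOn Y U :=
  fun x₀ => (hX x₀).congr fun y hy => by rw [h _ hy.2]

/-! ### Differentials and exterior derivatives -/

lemma dForm_congr {f g : M → F} (hU : IsOpen U) {x : M} (hx : x ∈ U) (h : ∀ y ∈ U, f y = g y) :
    dForm f x = dForm g x :=
  Filter.EventuallyEq.mfderiv_eq (by filter_upwards [hU.mem_nhds hx] with y hy using h y hy)

lemma OneForm.d_def (α : OneForm M F) {x : M} (v w : TangentSpace (𝓡 3) x) :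
    α.d x v w = fderiv ℝ (α.inChart x) (extChartAt (𝓡 3) x x) (chartD x x v) (chartD x x w)
      - fderiv ℝ (α.inChart x) (extChartAt (𝓡 3) x x) (chartD x x w) (chartD x x v) := rfl

lemma OneForm.d_antisymm (α : OneForm M F) {x : M} (v w : TangentSpace (𝓡 3) x) :
    α.d x v w = -α.d x w v := (neg_sub _ _).symm

lemma OneForm.d_self (α : OneForm M F) {x : M} (v : TangentSpace (𝓡 3) x) :
    α.d x v v = 0 := sub_self _

lemma OneForm.d_add_left (α : OneForm M F) {x : M} (u v w : TangentSpace (𝓡 3) x) :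
    α.d x (u + v) w = α.d x u w + α.d x v w := by
  simp only [OneForm.d_def, map_add, add_apply]; abel

lemma OneForm.d_smul_left (α : OneForm M F) {x : M} (c : ℝ) (v w : TangentSpace (𝓡 3) x) :
    α.d x (c • v) w = c • α.d x v w := by
  simp only [OneForm.d_def, map_smul, smul_apply, smul_sub]

lemma OneForm.d_add_right (α : OneForm M F) {x : M} (u v w : TangentSpace (𝓡 3) x) :
    α.d x w (u + v) = α.d x w u + α.d x w v := by
  simp only [OneForm.d_def, map_add, add_apply]; abel

lemma OneForm.d_smul_right (α : OneForm M F) {x : M} (c : ℝ) (v w : TangentSpace (𝓡 3) x) :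
    α.d x w (c • v) = c • α.d x w v := by
  simp only [OneForm.d_def, map_smul, smul_apply, smul_sub]

lemma OneForm.d_congr {α β : OneForm M F} (hU : IsOpen U) {x : M} (hx : x ∈ U)
    (h : ∀ y ∈ U, α y = β y) (v w : TangentSpace (𝓡 3) x) : α.d x v w = β.d x v w := by
  have heq : α.inChart x =ᶠ[nhds (extChartAt (𝓡 3) x x)] β.inChart x := by
    filter_upwards [(isOpen_chartSet x hU).mem_nhds
      (mem_chartSet hx (mem_extChartAt_source (I := 𝓡 3) x))] with y hy
    ext u
    rw [OneForm.inChart_apply', OneForm.inChart_apply', h _ hy.2]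
  simp only [OneForm.d_def, heq.fderiv_eq]

variable [IsManifold (𝓡 3) ∞ M]

lemma FnSmoothOn.mdifferentiableAt {f : M → F} (hf : FnSmoothOn f U) (hU : IsOpen U) {x : M}
    (hx : x ∈ U) : MDifferentiableAt (𝓡 3) 𝓘(ℝ, F) f x := by
  have hxs := mem_extChartAt_source (I := 𝓡 3) x
  have h1 := (hf.contDiffAt hU hx hxs).differentiableAt (by simp)
  refine (h1.mdifferentiableAt.comp x (mdifferentiableAt_chart hxs)).congr_of_eventuallyEq ?_
  filter_upwards [(isOpen_extChartAt_source (I := 𝓡 3) x).mem_nhds hxs] with z hz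
  simp only [Function.comp]
  rw [(extChartAt (𝓡 3) x).left_inv hz]

lemma dForm_inChart {f : M → F} (hf : FnSmoothOn f U) (hU : IsOpen U) {x₀ : M} {y : 𝔼}
    (hy : y ∈ chartSet x₀ U) :
    (dForm f).inChart x₀ y = fderiv ℝ (fun z => f ((extChartAt (𝓡 3) x₀).symm z)) y := by
  have h := mfderiv_comp y (hf.mdifferentiableAt hU hy.2) (mdifferentiableAt_chart_symm hy.1)
  rw [mfderiv_eq_fderiv] at h
  exact h.symm

lemma FnSmoothOn.dForm {f : M → F} (hf : FnSmoothOn f U) (hU : IsOpen U) :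
    (dForm f).SmoothOn U := fun x₀ =>
  ((hf x₀).fderiv_of_isOpen (isOpen_chartSet x₀ hU) (by simp)).congr
    fun _ hy => dForm_inChart hf hU hy

lemma dForm_eq {f : M → F} (hf : FnSmoothOn f U) (hU : IsOpen U) {x x₀ : M} (hx : x ∈ U)
    (hx₀ : x ∈ (extChartAt (𝓡 3) x₀).source) (v : TangentSpace (𝓡 3) x) :
    dForm f x v = fderiv ℝ (fun z => f ((extChartAt (𝓡 3) x₀).symm z)) (extChartAt (𝓡 3) x₀ x)
      (chartD x₀ x v) := by
  rw [← dForm_inChart hf hU (mem_chartSet hx hx₀), OneForm.inChart_chartD _ hx₀]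

lemma dForm_comp {f : M → F} (hf : FnSmoothOn f U) (hU : IsOpen U) {x : M} (hx : x ∈ U)
    {φ : F → G} (hφ : DifferentiableAt ℝ φ (f x)) (v : TangentSpace (𝓡 3) x) :
    dForm (fun y => φ (f y)) x v = fderiv ℝ φ (f x) (dForm f x v) := by
  have h := mfderiv_comp x hφ.mdifferentiableAt (hf.mdifferentiableAt hU hx)
  rw [mfderiv_eq_fderiv] at h
  exact DFunLike.congr_fun h v

lemma dForm_clm {f : M → F} (hf : FnSmoothOn f U) (hU : IsOpen U) {x : M} (hx : x ∈ U)
    (L : F →L[ℝ] G) (v : TangentSpace (𝓡 3) x) :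
    dForm (fun y => L (f y)) x v = L (dForm f x v) := by
  rw [dForm_comp hf hU hx L.differentiableAt, L.fderiv]

lemma dForm_ofReal {f : M → ℝ} (hf : FnSmoothOn f U) (hU : IsOpen U) {x : M} (hx : x ∈ U)
    (v : TangentSpace (𝓡 3) x) :
    dForm (fun y => (f y : ℂ)) x v = (dForm f x v : ℂ) := dForm_clm hf hU hx Complex.ofRealCLM v

lemma dForm_conj {f : M → ℂ} (hf : FnSmoothOn f U) (hU : IsOpen U) {x : M} (hx : x ∈ U)
    (v : TangentSpace (𝓡 3) x) :
    dForm (fun y => (starRingEnd ℂ) (f y)) x v = (starRingEnd ℂ) (dForm f x v) :=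
  dForm_clm hf hU hx (Complex.conjCLE : ℂ →L[ℝ] ℂ) v

lemma dForm_smul {f : M → 𝕜} {g : M → F} (hf : FnSmoothOn f U) (hg : FnSmoothOn g U)
    (hU : IsOpen U) {x : M} (hx : x ∈ U) (v : TangentSpace (𝓡 3) x) :
    dForm (fun y => f y • g y) x v = dForm f x v • g x + f x • dForm g x v := by
  have hxs := mem_extChartAt_source (I := 𝓡 3) x
  rw [dForm_eq (hf.smul hg) hU hx hxs, dForm_eq hf hU hx hxs, dForm_eq hg hU hx hxs,
    fderiv_fun_smul ((hf.contDiffAt hU hx hxs).differentiableAt (by simp))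
      ((hg.contDiffAt hU hx hxs).differentiableAt (by simp))]
  simp [add_comm]

lemma dForm_add {f g : M → F} (hf : FnSmoothOn f U) (hg : FnSmoothOn g U)
    (hU : IsOpen U) {x : M} (hx : x ∈ U) (v : TangentSpace (𝓡 3) x) :
    dForm (fun y => f y + g y) x v = dForm f x v + dForm g x v := by
  have hxs := mem_extChartAt_source (I := 𝓡 3) x
  rw [dForm_eq (hf.add hg) hU hx hxs, dForm_eq hf hU hx hxs, dForm_eq hg hU hx hxs,
    fderiv_fun_add ((hf.contDiffAt hU hx hxs).differentiableAt (by simp))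
      ((hg.contDiffAt hU hx hxs).differentiableAt (by simp))]
  rfl

lemma OneForm.d_add {α β : OneForm M F} (hα : α.SmoothOn U) (hβ : β.SmoothOn U)
    (hU : IsOpen U) {x : M} (hx : x ∈ U) (v w : TangentSpace (𝓡 3) x) :
    OneForm.d (fun y => α y + β y) x v w = α.d x v w + β.d x v w := by
  have hxs := mem_extChartAt_source (I := 𝓡 3) x
  have h := fderiv_fun_add ((hα.contDiffAt hU hx hxs).differentiableAt (by simp))
    ((hβ.contDiffAt hU hx hxs).differentiableAt (by simp))
  have he : OneForm.inChart (fun y => α y + β y) x = fun y => α.inChart x y + β.inChart x y := rfl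
  simp only [OneForm.d_def]
  rw [he, h]
  simp only [add_apply]
  abel

lemma OneForm.d_clm {α : OneForm M F} (hα : α.SmoothOn U) (hU : IsOpen U) {x : M} (hx : x ∈ U)
    (L : F →L[ℝ] G) (v w : TangentSpace (𝓡 3) x) :
    OneForm.d (fun y => L.comp (α y)) x v w = L (α.d x v w) := by
  have hxs := mem_extChartAt_source (I := 𝓡 3) x
  have h := (hasFDerivAt_const L (extChartAt (𝓡 3) x x)).clm_comp
    ((hα.contDiffAt hU hx hxs).differentiableAt (by simp)).hasFDerivAt
  have he : OneForm.inChart (fun y => L.comp (α y)) x = fun y => L.comp (α.inChart x y) := rfl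
  simp only [OneForm.d_def]
  rw [he, h.fderiv]
  simp

lemma OneForm.d_complexForm {α : OneForm M ℝ} (hα : α.SmoothOn U) (hU : IsOpen U) {x : M}
    (hx : x ∈ U) (v w : TangentSpace (𝓡 3) x) :
    OneForm.d (fun y => complexForm (α y)) x v w = (α.d x v w : ℂ) :=
  OneForm.d_clm hα hU hx Complex.ofRealCLM v w

lemma OneForm.d_conjForm {α : OneForm M ℂ} (hα : α.SmoothOn U) (hU : IsOpen U) {x : M}
    (hx : x ∈ U) (v w : TangentSpace (𝓡 3) x) :
    OneForm.d (fun y => conjForm (α y)) x v w = (starRingEnd ℂ) (α.d x v w) :=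
  OneForm.d_clm hα hU hx (Complex.conjCLE : ℂ →L[ℝ] ℂ) v w

/-- The Leibniz rule `d(fα) = df ∧ α + f dα`. -/
lemma OneForm.d_smul {f : M → 𝕜} {α : OneForm M F} (hf : FnSmoothOn f U) (hα : α.SmoothOn U)
    (hU : IsOpen U) {x : M} (hx : x ∈ U) (v w : TangentSpace (𝓡 3) x) :
    OneForm.d (fun y => f y • α y) x v w
      = dForm f x v • α x w - dForm f x w • α x v + f x • α.d x v w := by
  have hxs := mem_extChartAt_source (I := 𝓡 3) x
  have h := fderiv_fun_smul ((hf.contDiffAt hU hx hxs).differentiableAt (by simp))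
    ((hα.contDiffAt hU hx hxs).differentiableAt (by simp))
  have he : OneForm.inChart (fun y => f y • α y) x
      = fun y => f ((extChartAt (𝓡 3) x).symm y) • α.inChart x y := rfl
  rw [← α.inChart_chartD hxs v, ← α.inChart_chartD hxs w, dForm_eq hf hU hx hxs,
    dForm_eq hf hU hx hxs]
  simp only [OneForm.d_def]
  rw [he, h]
  simp only [add_apply, smul_apply,
    ContinuousLinearMap.smulRight_apply, (extChartAt (𝓡 3) x).left_inv hxs, smul_sub]
  abel

/-- `d(df) = 0`. -/
lemma OneForm.d_dForm {f : M → F} (hf : FnSmoothOn f U) (hU : IsOpen U) {x : M} (hx : x ∈ U)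
    (v w : TangentSpace (𝓡 3) x) : (dForm f).d x v w = 0 := by
  have hxs := mem_extChartAt_source (I := 𝓡 3) x
  have heq : (dForm f).inChart x =ᶠ[nhds (extChartAt (𝓡 3) x x)]
      fderiv ℝ (fun z => f ((extChartAt (𝓡 3) x).symm z)) := by
    filter_upwards [(isOpen_chartSet x hU).mem_nhds (mem_chartSet hx hxs)] with y hy
    exact dForm_inChart hf hU hy
  have hsymm := (hf.contDiffAt hU hx hxs).isSymmSndFDerivAt two_le_smooth
  simp only [OneForm.d_def]
  rw [heq.fderiv_eq, hsymm _ _, sub_self]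

/-! ### Smoothness of contractions -/

lemma OneForm.SmoothOn.apply {α : OneForm M F} (hα : α.SmoothOn U)
    {X : (x : M) → TangentSpace (𝓡 3) x} (hX : VecSmoothOn X U) :
    FnSmoothOn (fun x => α x (X x)) U := fun x₀ =>
  ((hα x₀).clm_apply (hX x₀)).congr fun _ hy => (α.inChart_chartD' hy.1 _).symm

lemma OneForm.SmoothOn.d_apply {α : OneForm M F} (hα : α.SmoothOn U) (hU : IsOpen U)
    {X Y : (x : M) → TangentSpace (𝓡 3) x} (hX : VecSmoothOn X U) (hY : VecSmoothOn Y U) :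
    FnSmoothOn (fun x => α.d x (X x) (Y x)) U := by
  intro x₀
  have hd : ContDiffOn ℝ ∞ (fderiv ℝ (α.inChart x₀)) (chartSet x₀ U) :=
    (hα x₀).fderiv_of_isOpen (isOpen_chartSet x₀ hU) (by simp)
  refine (((hd.clm_apply (hX x₀)).clm_apply (hY x₀)).sub
    ((hd.clm_apply (hY x₀)).clm_apply (hX x₀))).congr ?_
  intro y hy
  have hs := (extChartAt (𝓡 3) x₀).map_target hy.1
  beta_reduce
  rw [OneForm.d_eq hα hU hy.2 hs, (extChartAt (𝓡 3) x₀).right_inv hy.1]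

/-- If a smooth 1-form `P` with values in `F` is an isomorphism at every point, the vector fields
`P⁻¹ p` are smooth. -/
lemma OneForm.SmoothOn.inverse_apply [CompleteSpace F] {P : OneForm M F} (hP : P.SmoothOn U)
    {X : (x : M) → TangentSpace (𝓡 3) x} {p : F} (hX : ∀ x ∈ U, P x (X x) = p)
    (hbij : ∀ x ∈ U, Function.Bijective (P x)) : VecSmoothOn X U := by
  intro x₀
  have hinv : ∀ y ∈ chartSet x₀ U, (P.inChart x₀ y).IsInvertible := by
    intro y hy
    have hinj : Function.Injective (P.inChart x₀ y) := by
      intro u u' huu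
      have h := (hbij _ hy.2).1 (a₁ := chartDSymm x₀ y u) (a₂ := chartDSymm x₀ y u') huu
      rw [← chartD_comp_chartDSymm hy.1 u, h, chartD_comp_chartDSymm hy.1]
    have hsurj : Function.Surjective (P.inChart x₀ y) := by
      intro q
      obtain ⟨v, rfl⟩ := (hbij _ hy.2).2 q
      exact ⟨_, P.inChart_chartD' hy.1 v⟩
    exact ⟨ContinuousLinearEquiv.ofBijective (P.inChart x₀ y)
      (LinearMap.ker_eq_bot.2 hinj) (LinearMap.range_eq_top.2 hsurj), rfl⟩
  have hc : ContDiffOn ℝ ∞ (fun y => (P.inChart x₀ y).inverse p) (chartSet x₀ U) := fun y hy =>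
    ((hinv y hy).contDiffAt_map_inverse.comp_contDiffWithinAt y (hP x₀ y hy)).clm_apply
      contDiffWithinAt_const
  refine hc.congr fun y hy => ?_
  have h := P.inChart_chartD' hy.1 (X _)
  rw [hX _ hy.2] at h
  exact ((hinv y hy).inverse_apply_eq.2 h.symm).symm

/-! ### Comparison with smoothness in Mathlib -/

lemma contMDiffOn_iff_fnSmoothOn {f : M → F} (hU : IsOpen U) :
    ContMDiffOn (𝓡 3) 𝓘(ℝ, F) ∞ f U ↔ FnSmoothOn f U := by
  constructor
  · intro h x₀
    exact (h.comp ((contMDiffOn_extChartAt_symm x₀).mono inter_subset_left)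
      (fun y hy => hy.2)).contDiffOn
  · intro h x hx
    have hxs := mem_extChartAt_source (I := 𝓡 3) x
    have h1 := (h.contDiffAt hU hx hxs).contMDiffAt.comp x
      (contMDiffAt_extChartAt (I := 𝓡 3) (n := ∞) (x := x))
    refine (h1.congr_of_eventuallyEq ?_).contMDiffWithinAt
    filter_upwards [(isOpen_extChartAt_source (I := 𝓡 3) x).mem_nhds hxs] with z hz
    simp only [Function.comp]
    rw [(extChartAt (𝓡 3) x).left_inv hz]

lemma contMDiffOn_iff_vecSmoothOn {X : (x : M) → TangentSpace (𝓡 3) x} (hU : IsOpen U) :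
    ContMDiffOn (𝓡 3) (𝓡 3).tangent ∞ (fun x => (⟨x, X x⟩ : TangentBundle (𝓡 3) M)) U
      ↔ VecSmoothOn X U := by
  have : IsManifold (𝓡 3) 1 M := isManifold_one
  have : IsManifold (𝓡 3) (∞ + 1) M := by simpa
  have key : ∀ x₀ : M,
      ContMDiffOn (𝓡 3) (𝓡 3).tangent ∞ (fun x => (⟨x, X x⟩ : TangentBundle (𝓡 3) M))
        (U ∩ (extChartAt (𝓡 3) x₀).source)
      ↔ FnSmoothOn (fun x => chartD x₀ x (X x)) (U ∩ (extChartAt (𝓡 3) x₀).source) := by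
    intro x₀
    have ho := hU.inter (isOpen_extChartAt_source (I := 𝓡 3) x₀)
    have hb : U ∩ (extChartAt (𝓡 3) x₀).source
        ⊆ (trivializationAt 𝔼 (TangentSpace (𝓡 3)) x₀).baseSet := by
      intro x hx
      simpa using hx.2
    rw [← contMDiffOn_iff_fnSmoothOn ho]
    refine ((trivializationAt 𝔼 (TangentSpace (𝓡 3) : M → Type _)
      x₀).contMDiffOn_section_iff ho hb).trans ?_
    refine contMDiffOn_congr fun x hx => ?_
    have h := TangentBundle.continuousLinearMapAt_trivializationAt (I := 𝓡 3) (x₀ := x₀) (x := x)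
      (by simpa using hx.2)
    rw [chartD, ← h, Bundle.Trivialization.continuousLinearMapAt_apply,
      Bundle.Trivialization.linearMapAt_apply, if_pos (hb hx)]
  constructor
  · intro h x₀ y hy
    have h1 := (key x₀).1 (h.mono inter_subset_left) x₀
    refine h1.mono ?_ y hy
    exact fun z hz => ⟨hz.1, hz.2, (extChartAt (𝓡 3) x₀).map_target hz.1⟩
  · intro h x hx
    have h2 : FnSmoothOn (fun z => chartD x z (X z)) (U ∩ (extChartAt (𝓡 3) x).source) :=
      FnSmoothOn.of_chart fun z hz => ⟨x, hz.2,
        (h x).contDiffAt ((isOpen_chartSet x hU).mem_nhds (mem_chartSet hz.1 hz.2))⟩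
    have ho := hU.inter (isOpen_extChartAt_source (I := 𝓡 3) x)
    have hx' : x ∈ U ∩ (extChartAt (𝓡 3) x).source := ⟨hx, mem_extChartAt_source x⟩
    exact (((key x).2 h2).contMDiffAt (ho.mem_nhds hx')).contMDiffWithinAt

end Calculus

section Coframe

variable {M : Type*} [TopologicalSpace M] [ChartedSpace (EuclideanSpace ℝ (Fin 3)) M]
  {F : LocalFrame M} {θ : OneForm M ℝ} {U : Set M} {x : M}

/-! ### Linear algebra of a dual coframe -/

lemma evalC_Zbar (η : TangentSpace (𝓡 3) x →L[ℝ] ℂ) :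
    evalC η (F.Zbar x) = η (F.Z x).1 - Complex.I * η (F.Z x).2 := by
  change η (F.Z x).1 + Complex.I * η (-(F.Z x).2) = _
  rw [map_neg]; ring

lemma evalC_conjForm_Z (η : TangentSpace (𝓡 3) x →L[ℝ] ℂ) :
    evalC (conjForm η) (F.Z x) = (starRingEnd ℂ) (evalC η (F.Zbar x)) := by
  rw [evalC_Zbar]
  simp [evalC, conjForm]

lemma evalC_conjForm_Zbar (η : TangentSpace (𝓡 3) x →L[ℝ] ℂ) :
    evalC (conjForm η) (F.Zbar x) = (starRingEnd ℂ) (evalC η (F.Z x)) := by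
  rw [evalC_Zbar]
  simp [evalC, conjForm, sub_eq_add_neg]

namespace LocalFrame.IsDualOn

lemma θ_re_im (h : F.IsDualOn θ U) (hx : x ∈ U) :
    θ x (F.Z x).1 = 0 ∧ θ x (F.Z x).2 = 0 := by
  have h1 := h.θ_Z x hx
  simp only [evalC, complexForm, ContinuousLinearMap.comp_apply, Complex.ofRealCLM_apply,
    Complex.ext_iff] at h1
  simpa using h1

lemma θ1_re (h : F.IsDualOn θ U) (hx : x ∈ U) : F.θ1 x (F.Z x).1 = 1 / 2 := by
  have h1 := h.θ1_Z x hx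
  have h2 := h.θ1_Zbar x hx
  rw [evalC_Zbar] at h2
  rw [evalC] at h1
  linear_combination (h1 + h2) / 2

lemma θ1_im (h : F.IsDualOn θ U) (hx : x ∈ U) : F.θ1 x (F.Z x).2 = -Complex.I / 2 := by
  have h1 := h.θ1_Z x hx
  have h2 := h.θ1_Zbar x hx
  rw [evalC_Zbar] at h2
  rw [evalC] at h1
  linear_combination -Complex.I * (h1 - h2) / 2 + F.θ1 x (F.Z x).2 * Complex.I_mul_I

/-- The coframe `(θ, θ¹)` as a 1-form with values in `ℝ × ℂ`. -/
def _root_.CRYamabe.coframe (F : LocalFrame M) (θ : OneForm M ℝ) : OneForm M (ℝ × ℂ) := fun x =>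
  (ContinuousLinearMap.inl ℝ ℝ ℂ).comp (θ x) + (ContinuousLinearMap.inr ℝ ℝ ℂ).comp (F.θ1 x)

lemma _root_.CRYamabe.coframe_apply (v : TangentSpace (𝓡 3) x) :
    coframe F θ x v = (θ x v, F.θ1 x v) := by
  simp [coframe]

/-- The inverse of the coframe. With `Z₁ = X + iY` one has `θ¹(X) = 1/2` and `θ¹(Y) = -i/2`, whence
the coefficients of `X` and `Y`. -/
lemma coframe_combination (h : F.IsDualOn θ U) (hx : x ∈ U) (r : ℝ) (c : ℂ) :
    coframe F θ x (r • F.T x + (2 * c.re) • (F.Z x).1 - (2 * c.im) • (F.Z x).2) = (r, c) := by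
  rw [coframe_apply]
  simp only [map_add, map_sub, map_smul, h.θ_T x hx, (h.θ_re_im hx).1, (h.θ_re_im hx).2,
    h.θ1_T x hx, h.θ1_re hx, h.θ1_im hx]
  refine Prod.ext (by simp) ?_
  apply Complex.ext <;> simp <;> ring

lemma coframe_bijective (h : F.IsDualOn θ U) (hx : x ∈ U) :
    Function.Bijective (coframe F θ x) := by
  have hs : Function.Surjective (coframe F θ x) := fun p => ⟨_, h.coframe_combination hx p.1 p.2⟩
  refine ⟨?_, hs⟩
  have hfin : Module.finrank ℝ (TangentSpace (𝓡 3) x) = Module.finrank ℝ (ℝ × ℂ) := by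
    rw [Module.finrank_prod, Complex.finrank_real_complex, Module.finrank_self]
    exact finrank_euclideanSpace_fin
  have : FiniteDimensional ℝ (TangentSpace (𝓡 3) x) :=
    inferInstanceAs (FiniteDimensional ℝ (EuclideanSpace ℝ (Fin 3)))
  exact (LinearMap.injective_iff_surjective_of_finrank_eq_finrank hfin
    (f := (coframe F θ x : TangentSpace (𝓡 3) x →ₗ[ℝ] ℝ × ℂ))).2 hs

lemma vec_eq (h : F.IsDualOn θ U) (hx : x ∈ U) (v : TangentSpace (𝓡 3) x) :
    v = θ x v • F.T x + (2 * (F.θ1 x v).re) • (F.Z x).1 - (2 * (F.θ1 x v).im) • (F.Z x).2 := by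
  apply (h.coframe_bijective hx).1
  rw [h.coframe_combination hx, coframe_apply]

/-- The expansion of a covector in the coframe. -/
lemma covector_eq (h : F.IsDualOn θ U) (hx : x ∈ U) (η : TangentSpace (𝓡 3) x →L[ℝ] ℂ)
    (v : TangentSpace (𝓡 3) x) :
    η v = η (F.T x) * θ x v + evalC η (F.Z x) * F.θ1 x v
      + evalC η (F.Zbar x) * (starRingEnd ℂ) (F.θ1 x v) := by
  conv_lhs => rw [h.vec_eq hx v]
  rw [evalC_Zbar, evalC]
  simp only [map_add, map_sub, map_smul, Complex.real_smul]
  have h1 : (F.θ1 x v) = (F.θ1 x v).re + (F.θ1 x v).im * Complex.I := (Complex.re_add_im _).symm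
  have h2 : (starRingEnd ℂ) (F.θ1 x v) = (F.θ1 x v).re - (F.θ1 x v).im * Complex.I := by
    apply Complex.ext <;> simp
  rw [h2]
  push_cast
  linear_combination (-(η (F.Z x).1) - Complex.I * η (F.Z x).2) * h1
    - 2 * (F.θ1 x v).im * η (F.Z x).2 * Complex.I_mul_I

end LocalFrame.IsDualOn

/-! ### Components of the exterior derivative of a 1-form in a frame -/

/-- The component `dα(Z₁, Z₁̄)`. -/
def OneForm.dZZbar (α : OneForm M ℂ) (F : LocalFrame M) (x : M) : ℂ :=
  evalC₂ (α.d x) (F.Z x) (F.Zbar x)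

/-- The component `dα(T, Z₁)`. -/
def OneForm.dTZ (α : OneForm M ℂ) (F : LocalFrame M) (x : M) : ℂ :=
  α.d x (F.T x) (F.Z x).1 + Complex.I * α.d x (F.T x) (F.Z x).2

/-- The component `dα(T, Z₁̄)`. -/
def OneForm.dTZbar (α : OneForm M ℂ) (F : LocalFrame M) (x : M) : ℂ :=
  α.d x (F.T x) (F.Z x).1 - Complex.I * α.d x (F.T x) (F.Z x).2

lemma OneForm.d_neg_right (α : OneForm M ℂ) (v w : TangentSpace (𝓡 3) x) :
    α.d x v (-w) = -α.d x v w := by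
  rw [← neg_one_smul ℝ w, α.d_smul_right]; simp

/-- With `Z₁ = X + iY`, `dα(Z₁, Z₁̄) = -2i dα(X, Y)`. -/
lemma OneForm.dZZbar_eq (α : OneForm M ℂ) (F : LocalFrame M) (x : M) :
    α.dZZbar F x = -2 * Complex.I * α.d x (F.Z x).1 (F.Z x).2 := by
  change α.d x (F.Z x).1 (F.Z x).1 - α.d x (F.Z x).2 (-(F.Z x).2)
    + Complex.I * (α.d x (F.Z x).1 (-(F.Z x).2) + α.d x (F.Z x).2 (F.Z x).1) = _
  rw [α.d_neg_right, α.d_neg_right, α.d_self, α.d_self, α.d_antisymm (F.Z x).2 (F.Z x).1]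
  ring

/-- The expansion of the 2-form `dα` in the coframe. -/
lemma LocalFrame.IsDualOn.d_expand (h : F.IsDualOn θ U) (hx : x ∈ U) (α : OneForm M ℂ)
    (v w : TangentSpace (𝓡 3) x) :
    α.d x v w = α.dZZbar F x * wedge (F.θ1 x) (conjForm (F.θ1 x)) v w
      + α.dTZ F x * wedge (complexForm (θ x)) (F.θ1 x) v w
      + α.dTZbar F x * wedge (complexForm (θ x)) (conjForm (F.θ1 x)) v w := by
  have expand : ∀ u : TangentSpace (𝓡 3) x,
      u = θ x u • F.T x + (2 * (F.θ1 x u).re) • (F.Z x).1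
        + (-2 * (F.θ1 x u).im) • (F.Z x).2 := by
    intro u
    conv_lhs => rw [h.vec_eq hx u]
    rw [sub_eq_add_neg, ← neg_smul, neg_mul]
  have h1 : ∀ u, (F.θ1 x u) = (F.θ1 x u).re + (F.θ1 x u).im * Complex.I :=
    fun u => (Complex.re_add_im _).symm
  have h2 : ∀ u, (starRingEnd ℂ) (F.θ1 x u) = (F.θ1 x u).re - (F.θ1 x u).im * Complex.I := by
    intro u; apply Complex.ext <;> simp
  conv_lhs => rw [expand v, expand w]
  simp only [wedge, conjForm, complexForm, ContinuousLinearMap.comp_apply,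
    Complex.ofRealCLM_apply]
  change _ = _ * (F.θ1 x v * (starRingEnd ℂ) (F.θ1 x w) - F.θ1 x w * (starRingEnd ℂ) (F.θ1 x v))
    + _ + _ * (θ x v * (starRingEnd ℂ) (F.θ1 x w) - θ x w * (starRingEnd ℂ) (F.θ1 x v))
  rw [h2 v, h2 w, α.dZZbar_eq, OneForm.dTZ, OneForm.dTZbar]
  have e1 := h1 v
  have e2 := h1 w
  generalize (F.θ1 x v).re = a at *
  generalize (F.θ1 x v).im = b at *
  generalize (F.θ1 x w).re = c at *
  generalize (F.θ1 x w).im = d at *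
  rw [e1, e2]
  simp only [α.d_add_left, α.d_add_right, α.d_smul_left, α.d_smul_right, α.d_self,
    α.d_antisymm (F.Z x).1 (F.T x), α.d_antisymm (F.Z x).2 (F.T x),
    α.d_antisymm (F.Z x).2 (F.Z x).1, Complex.real_smul]
  push_cast
  generalize α.d x (F.Z x).1 (F.Z x).2 = D1
  generalize α.d x (F.T x) (F.Z x).1 = D2
  generalize α.d x (F.T x) (F.Z x).2 = D3
  ring_nf
  simp only [Complex.I_sq]
  ring

end Coframe

section Frame

variable {M : Type*} [TopologicalSpace M] [ChartedSpace (EuclideanSpace ℝ (Fin 3)) M]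
  [IsManifold (𝓡 3) ∞ M]
  {F : LocalFrame M} {θ : OneForm M ℝ} {U : Set M} {x : M}

/-! ### Derivatives along a frame -/

lemma along_eq (Z : (x : M) → ComplexTangent x) (f : M → ℂ) (x : M) :
    along Z f x = evalC (dForm f x) (Z x) := rfl

lemma along_congr {Z : (x : M) → ComplexTangent x} {f g : M → ℂ} (hU : IsOpen U) (hx : x ∈ U)
    (h : ∀ y ∈ U, f y = g y) : along Z f x = along Z g x := by
  rw [along_eq, along_eq, dForm_congr hU hx h]

lemma along_conj_Z {f : M → ℂ} (hf : FnSmoothOn f U) (hU : IsOpen U) (hx : x ∈ U) :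
    along F.Z (fun y => (starRingEnd ℂ) (f y)) x = (starRingEnd ℂ) (along F.Zbar f x) := by
  rw [along_eq, along_eq, ← evalC_conjForm_Z]
  congr 1
  ext v
  exact dForm_conj hf hU hx v

lemma along_conj_Zbar {f : M → ℂ} (hf : FnSmoothOn f U) (hU : IsOpen U) (hx : x ∈ U) :
    along F.Zbar (fun y => (starRingEnd ℂ) (f y)) x = (starRingEnd ℂ) (along F.Z f x) := by
  rw [along_eq, along_eq, ← evalC_conjForm_Zbar]
  congr 1
  ext v
  exact dForm_conj hf hU hx v

/-- For a real function, `f_{,1̄}` is the conjugate of `f_{,1}`. -/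
lemma along_Zbar_real {f : M → ℝ} (hf : FnSmoothOn f U) (hU : IsOpen U) (hx : x ∈ U) :
    along F.Zbar (fun y => (f y : ℂ)) x
      = (starRingEnd ℂ) (along F.Z (fun y => (f y : ℂ)) x) := by
  rw [← along_conj_Zbar hf.ofReal hU hx]
  simp only [Complex.conj_ofReal]

lemma along_mul {Z : (x : M) → ComplexTangent x} {f g : M → ℂ} (hf : FnSmoothOn f U)
    (hg : FnSmoothOn g U) (hU : IsOpen U) (hx : x ∈ U) :
    along Z (fun y => f y * g y) x = along Z f x * g x + f x * along Z g x := by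
  simp only [along_eq, evalC]
  have h := dForm_smul hf hg hU hx
  simp only [smul_eq_mul] at h
  rw [h, h]
  ring

lemma along_const (Z : (x : M) → ComplexTangent x) (c : ℂ) : along Z (fun _ => c) x = 0 := by
  have hd : dForm (fun _ : M => c) x = 0 := mfderiv_const
  rw [along_eq, hd]
  simp [evalC]

lemma along_neg {Z : (x : M) → ComplexTangent x} {f : M → ℂ} (hf : FnSmoothOn f U)
    (hU : IsOpen U) (hx : x ∈ U) : along Z (fun y => -f y) x = -along Z f x := by
  have h := along_mul (Z := Z) (FnSmoothOn.const (-1 : ℂ)) hf hU hx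
  simp only [neg_one_mul, along_const] at h
  rw [h]
  ring

/-! ### Smoothness of a frame dual to a smooth coframe -/

namespace LocalFrame.IsDualOn

lemma coframe_smooth (hθ : θ.SmoothOn U) (h1 : F.θ1.SmoothOn U) :
    (coframe F θ).SmoothOn U := (hθ.clm _).add (h1.clm _)

lemma smooth_T (h : F.IsDualOn θ U) (hθ : θ.SmoothOn U) (h1 : F.θ1.SmoothOn U) :
    VecSmoothOn F.T U :=
  (coframe_smooth hθ h1).inverse_apply (p := (1, 0))
    (fun x hx => by rw [coframe_apply, h.θ_T x hx, h.θ1_T x hx])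
    (fun _ hx => h.coframe_bijective hx)

lemma smooth_re (h : F.IsDualOn θ U) (hθ : θ.SmoothOn U) (h1 : F.θ1.SmoothOn U) :
    VecSmoothOn (fun x => (F.Z x).1) U :=
  (coframe_smooth hθ h1).inverse_apply (p := (0, 1 / 2))
    (fun x hx => by rw [coframe_apply, (h.θ_re_im hx).1, h.θ1_re hx])
    (fun _ hx => h.coframe_bijective hx)

lemma smooth_im (h : F.IsDualOn θ U) (hθ : θ.SmoothOn U) (h1 : F.θ1.SmoothOn U) :
    VecSmoothOn (fun x => (F.Z x).2) U :=
  (coframe_smooth hθ h1).inverse_apply (p := (0, -Complex.I / 2))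
    (fun x hx => by rw [coframe_apply, (h.θ_re_im hx).2, h.θ1_im hx])
    (fun _ hx => h.coframe_bijective hx)

lemma evalC_Z_smooth (h : F.IsDualOn θ U) (hθ : θ.SmoothOn U) (h1 : F.θ1.SmoothOn U)
    {α : OneForm M ℂ} (hα : α.SmoothOn U) : FnSmoothOn (fun x => evalC (α x) (F.Z x)) U :=
  (hα.apply (h.smooth_re hθ h1)).add
    ((FnSmoothOn.const Complex.I).mul (hα.apply (h.smooth_im hθ h1)))

lemma evalC_Zbar_smooth (h : F.IsDualOn θ U) (hθ : θ.SmoothOn U) (h1 : F.θ1.SmoothOn U)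
    {α : OneForm M ℂ} (hα : α.SmoothOn U) : FnSmoothOn (fun x => evalC (α x) (F.Zbar x)) U :=
  ((hα.apply (h.smooth_re hθ h1)).sub
    ((FnSmoothOn.const Complex.I).mul (hα.apply (h.smooth_im hθ h1)))).congr
      fun _ _ => evalC_Zbar _

lemma along_Z_smooth (h : F.IsDualOn θ U) (hθ : θ.SmoothOn U) (h1 : F.θ1.SmoothOn U)
    (hU : IsOpen U) {f : M → ℂ} (hf : FnSmoothOn f U) : FnSmoothOn (along F.Z f) U :=
  h.evalC_Z_smooth hθ h1 (hf.dForm hU)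

lemma along_Zbar_smooth (h : F.IsDualOn θ U) (hθ : θ.SmoothOn U) (h1 : F.θ1.SmoothOn U)
    (hU : IsOpen U) {f : M → ℂ} (hf : FnSmoothOn f U) : FnSmoothOn (along F.Zbar f) U :=
  h.evalC_Zbar_smooth hθ h1 (hf.dForm hU)

/-- `df = f_{,0} θ + f_{,1} θ¹ + f_{,1̄} θ¹̄`. -/
lemma dForm_expand (h : F.IsDualOn θ U) (hx : x ∈ U) (f : M → ℂ) (v : TangentSpace (𝓡 3) x) :
    dForm f x v = dForm f x (F.T x) * θ x v + along F.Z f x * F.θ1 x v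
      + along F.Zbar f x * (starRingEnd ℂ) (F.θ1 x v) := h.covector_eq hx _ v

end LocalFrame.IsDualOn

/-! ### Rules for the component `dα(Z₁, Z₁̄)` -/

lemma OneForm.dZZbar_add {α β : OneForm M ℂ} (hα : α.SmoothOn U) (hβ : β.SmoothOn U)
    (hU : IsOpen U) (hx : x ∈ U) :
    OneForm.dZZbar (fun y => α y + β y) F x = α.dZZbar F x + β.dZZbar F x := by
  simp only [OneForm.dZZbar_eq, OneForm.d_add hα hβ hU hx]
  ring

lemma OneForm.dZZbar_smul {f : M → ℂ} {α : OneForm M ℂ} (hf : FnSmoothOn f U)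
    (hα : α.SmoothOn U) (hU : IsOpen U) (hx : x ∈ U) :
    OneForm.dZZbar (fun y => f y • α y) F x
      = along F.Z f x * evalC (α x) (F.Zbar x) - along F.Zbar f x * evalC (α x) (F.Z x)
        + f x * α.dZZbar F x := by
  simp only [OneForm.dZZbar_eq, OneForm.d_smul hf hα hU hx, along_eq, evalC_Zbar]
  simp only [evalC, smul_eq_mul]
  ring

lemma OneForm.dZZbar_conj {α : OneForm M ℂ} (hα : α.SmoothOn U) (hU : IsOpen U) (hx : x ∈ U) :
    OneForm.dZZbar (fun y => conjForm (α y)) F x = -(starRingEnd ℂ) (α.dZZbar F x) := by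
  simp only [OneForm.dZZbar_eq, OneForm.d_conjForm hα hU hx]
  rw [map_mul, map_mul, map_neg, map_ofNat, Complex.conj_I]
  ring

lemma OneForm.dZZbar_congr {α β : OneForm M ℂ} (hU : IsOpen U) (hx : x ∈ U)
    (h : ∀ y ∈ U, α y = β y) : α.dZZbar F x = β.dZZbar F x := by
  simp only [OneForm.dZZbar_eq, OneForm.d_congr hU hx h]

/-! ### The second exterior derivative -/

/-- If `dα = β ∧ γ`, then `dβ ∧ γ = β ∧ dγ`, because `d² = 0`. -/
lemma OneForm.d_wedge_of_d_eq {α β γ : OneForm M ℂ} (hα : α.SmoothOn U) (hβ : β.SmoothOn U)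
    (hγ : γ.SmoothOn U) (hU : IsOpen U)
    (h : ∀ y ∈ U, ∀ v w : TangentSpace (𝓡 3) y, α.d y v w = wedge (β y) (γ y) v w)
    (hx : x ∈ U) (u v w : TangentSpace (𝓡 3) x) :
    β.d x u v * γ x w + β.d x v w * γ x u + β.d x w u * γ x v
      = β x u * γ.d x v w + β x v * γ.d x w u + β x w * γ.d x u v := by
  have hxs := mem_extChartAt_source (I := 𝓡 3) x
  set y₀ := extChartAt (𝓡 3) x x with hy₀
  have hα' := hα.contDiffAt hU hx hxs
  have hβ' := ((hβ.contDiffAt hU hx hxs).differentiableAt (by simp)).hasFDerivAt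
  have hγ' := ((hγ.contDiffAt hU hx hxs).differentiableAt (by simp)).hasFDerivAt
  have hd : ContDiffAt ℝ ∞ (fderiv ℝ (α.inChart x)) y₀ := hα'.fderiv_right (by simp)
  have hd' := (hd.differentiableAt (by simp)).hasFDerivAt
  have hsymm := hα'.isSymmSndFDerivAt two_le_smooth
  -- The hypothesis, written in the chart and differentiated; the second derivatives of `α` drop
  -- out of the cyclic sum.
  have key : ∀ p q r : 𝔼,
      fderiv ℝ (fderiv ℝ (α.inChart x)) y₀ r p q - fderiv ℝ (fderiv ℝ (α.inChart x)) y₀ r q p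
      = fderiv ℝ (β.inChart x) y₀ r p * γ.inChart x y₀ q
        + β.inChart x y₀ p * fderiv ℝ (γ.inChart x) y₀ r q
        - (fderiv ℝ (β.inChart x) y₀ r q * γ.inChart x y₀ p
        + β.inChart x y₀ q * fderiv ℝ (γ.inChart x) y₀ r p) := by
    intro p q r
    have heq : (fun y => fderiv ℝ (α.inChart x) y p q - fderiv ℝ (α.inChart x) y q p)
        =ᶠ[nhds y₀] fun y => β.inChart x y p * γ.inChart x y q
          - β.inChart x y q * γ.inChart x y p := by
      filter_upwards [(isOpen_chartSet x hU).mem_nhds (mem_chartSet hx hxs)] with y hy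
      have h1 := h _ hy.2 (chartDSymm x y p) (chartDSymm x y q)
      rw [OneForm.d_eq hα hU hy.2 ((extChartAt (𝓡 3) x).map_target hy.1),
        (extChartAt (𝓡 3) x).right_inv hy.1, chartD_comp_chartDSymm hy.1,
        chartD_comp_chartDSymm hy.1] at h1
      exact h1
    have ev : ∀ {A : 𝔼 → 𝔼 →L[ℝ] ℂ} {A' : 𝔼 →L[ℝ] 𝔼 →L[ℝ] ℂ} (hA : HasFDerivAt A A' y₀) (p : 𝔼),
        HasFDerivAt (fun y => A y p) (A'.flip p) y₀ := by
      intro A A' hA p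
      simpa using hA.clm_apply (hasFDerivAt_const p y₀)
    have ev2 : ∀ p q : 𝔼, HasFDerivAt (fun y => fderiv ℝ (α.inChart x) y p q)
        (((fderiv ℝ (fderiv ℝ (α.inChart x)) y₀).flip p).flip q) y₀ := by
      intro p q
      have h1 : HasFDerivAt (fun y => fderiv ℝ (α.inChart x) y p)
          ((fderiv ℝ (fderiv ℝ (α.inChart x)) y₀).flip p) y₀ := by
        simpa using hd'.clm_apply (hasFDerivAt_const p y₀)
      exact ev h1 q
    have hl := (ev2 p q).sub (ev2 q p)
    have hr := ((ev hβ' p).mul (ev hγ' q)).sub ((ev hβ' q).mul (ev hγ' p))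
    have hu := DFunLike.congr_fun (hl.unique (hr.congr_of_eventuallyEq heq)) r
    simp only [sub_apply, add_apply, smul_apply, ContinuousLinearMap.flip_apply,
      smul_eq_mul] at hu
    rw [hu]
    ring
  have k1 := key (chartD x x u) (chartD x x v) (chartD x x w)
  have k2 := key (chartD x x v) (chartD x x w) (chartD x x u)
  have k3 := key (chartD x x w) (chartD x x u) (chartD x x v)
  rw [hsymm.eq (chartD x x w) (chartD x x u), hsymm.eq (chartD x x w) (chartD x x v)] at k1
  rw [hsymm.eq (chartD x x u) (chartD x x v)] at k2
  simp only [← β.inChart_chartD hxs, ← γ.inChart_chartD hxs, OneForm.d_def]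
  rw [← hy₀]
  linear_combination -(k1 + k2 + k3)

end Frame

section Connection

variable {M : Type*} [TopologicalSpace M] [ChartedSpace (EuclideanSpace ℝ (Fin 3)) M]
  [IsManifold (𝓡 3) ∞ M] {C : CRStructure M}
  {F F' : LocalFrame M} {θ : OneForm M ℝ} {U V : Set M} {x : M}

/-! ### Existence and uniqueness of the connection form -/

lemma wedge_apply (α β : TangentSpace (𝓡 3) x →L[ℝ] ℂ) (v w : TangentSpace (𝓡 3) x) :
    wedge α β v w = α v * β w - α w * β v := rfl

lemma conjForm_apply (α : TangentSpace (𝓡 3) x →L[ℝ] ℂ) (v : TangentSpace (𝓡 3) x) :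
    conjForm α v = (starRingEnd ℂ) (α v) := rfl

lemma complexForm_apply (α : TangentSpace (𝓡 3) x →L[ℝ] ℝ) (v : TangentSpace (𝓡 3) x) :
    complexForm α v = (α v : ℂ) := rfl

lemma conj_half : (starRingEnd ℂ) (1 / 2) = 1 / 2 := by
  rw [map_div₀, map_one, map_ofNat]

lemma conj_neg_I_half : (starRingEnd ℂ) (-Complex.I / 2) = Complex.I / 2 := by
  rw [map_div₀, map_neg, Complex.conj_I, map_ofNat, neg_neg]

namespace LocalFrame

/-- A solution of the structure equation is determined by the components of `dθ¹`. -/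
lemma StructureEq.eq_components (h : F.IsDualOn θ U) (hx : x ∈ U)
    {η : TangentSpace (𝓡 3) x →L[ℝ] ℂ} {a : ℂ} (hs : F.StructureEq θ x η a) :
    a = F.θ1.dTZbar F x ∧ evalC η (F.Zbar x) = F.θ1.dZZbar F x ∧
      evalC η (F.Z x) = -(starRingEnd ℂ) (F.θ1.dZZbar F x) ∧ η (F.T x) = -F.θ1.dTZ F x := by
  obtain ⟨h1, h2⟩ := hs
  have e1 := h1 (F.T x) (F.Z x).1
  have e2 := h1 (F.T x) (F.Z x).2
  have e3 := h1 (F.Z x).1 (F.Z x).2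
  simp only [wedge_apply, conjForm_apply, complexForm_apply, h.θ_T x hx, (h.θ_re_im hx).1,
    (h.θ_re_im hx).2, h.θ1_T x hx, h.θ1_re hx, h.θ1_im hx, conj_half, conj_neg_I_half,
    Complex.ofReal_zero, Complex.ofReal_one, map_zero] at e1 e2 e3
  have h4 : evalC η (F.Zbar x) = F.θ1.dZZbar F x := by
    rw [OneForm.dZZbar_eq, e3, evalC_Zbar]
    linear_combination η (F.Z x).1 * Complex.I_mul_I
  have h3 : conjForm η = -η := by rw [eq_neg_iff_add_eq_zero, add_comm, h2]
  refine ⟨?_, h4, ?_, ?_⟩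
  · rw [OneForm.dTZbar, e1, e2]
    linear_combination (a / 2) * Complex.I_mul_I + η (F.T x) / 2 * Complex.I_mul_I
  · rw [← h4, ← evalC_conjForm_Z, h3]
    simp [evalC]
    ring
  · rw [OneForm.dTZ, e1, e2]
    linear_combination (a / 2) * Complex.I_mul_I + η (F.T x) / 2 * Complex.I_mul_I

lemma StructureEq.unique (h : F.IsDualOn θ U) (hx : x ∈ U)
    {η η' : TangentSpace (𝓡 3) x →L[ℝ] ℂ} {a a' : ℂ} (hs : F.StructureEq θ x η a)
    (hs' : F.StructureEq θ x η' a') : η = η' ∧ a = a' := by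
  obtain ⟨h1, h2, h3, h4⟩ := hs.eq_components h hx
  obtain ⟨k1, k2, k3, k4⟩ := hs'.eq_components h hx
  refine ⟨?_, by rw [h1, k1]⟩
  ext v
  rw [h.covector_eq hx η v, h.covector_eq hx η' v, h2, h3, h4, k2, k3, k4]

/-- The component `dθ¹(T, Z₁)` is imaginary: evaluate `d(dθ) = 0`, with `dθ = i θ¹ ∧ θ¹̄`, on
`(T, Z₁, Z₁̄)`. This makes the structure equation solvable by an imaginary connection form. -/
lemma IsAdmissibleOn.dTZ_imaginary (hF : F.IsAdmissibleOn C θ U) (hθ : θ.SmoothOn U)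
    (hU : IsOpen U) (hx : x ∈ U) :
    F.θ1.dTZ F x + (starRingEnd ℂ) (F.θ1.dTZ F x) = 0 := by
  have h := hF.toIsDualOn
  have hi : OneForm.SmoothOn (fun y => (Complex.I : ℂ) • F.θ1 y) U :=
    OneForm.SmoothOn.smul (FnSmoothOn.const Complex.I) hF.θ1_smooth
  have hd : ∀ v w : TangentSpace (𝓡 3) x,
      OneForm.d (fun y => (Complex.I : ℂ) • F.θ1 y) x v w = Complex.I * F.θ1.d x v w := by
    intro v w
    have h1 := OneForm.d_clm hF.θ1_smooth hU hx
      (Complex.I • ContinuousLinearMap.id ℝ ℂ : ℂ →L[ℝ] ℂ) v w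
    exact h1
  have key := OneForm.d_wedge_of_d_eq hθ.complexForm hi hF.θ1_smooth.conjForm hU
    (fun y hy v w => by
      rw [OneForm.d_complexForm hθ hU hy, hF.levi y hy]
      simp only [wedge_apply, smul_apply, smul_eq_mul]
      ring) hx (F.T x) (F.Z x).1 (F.Z x).2
  simp only [OneForm.d_conjForm hF.θ1_smooth hU hx, hd, conjForm_apply, smul_apply, smul_eq_mul,
    h.θ1_T x hx, h.θ1_re hx, h.θ1_im hx, conj_half, conj_neg_I_half, map_zero,
    F.θ1.d_antisymm (F.Z x).2 (F.T x), map_neg] at key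
  simp only [OneForm.dTZ, map_add, map_mul, Complex.conj_I]
  linear_combination -2 * key
    + (F.θ1.d x (F.T x) (F.Z x).1 + (starRingEnd ℂ) (F.θ1.d x (F.T x) (F.Z x).1)) * Complex.I_mul_I

/-- The connection form, expressed through the components of `dθ¹`. -/
def connectionForm (F : LocalFrame M) (θ : OneForm M ℝ) : OneForm M ℂ := fun x =>
  (-(starRingEnd ℂ) (F.θ1.dZZbar F x)) • F.θ1 x + F.θ1.dZZbar F x • conjForm (F.θ1 x)
    + (-F.θ1.dTZ F x) • complexForm (θ x)

lemma IsAdmissibleOn.structureEq_connectionForm (hF : F.IsAdmissibleOn C θ U)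
    (hθ : θ.SmoothOn U) (hU : IsOpen U) (hx : x ∈ U) :
    F.StructureEq θ x (F.connectionForm θ x) (F.θ1.dTZbar F x) := by
  constructor
  · intro v w
    rw [hF.d_expand hx F.θ1 v w]
    simp only [connectionForm, wedge_apply, add_apply, smul_apply, conjForm_apply,
      complexForm_apply, smul_eq_mul]
    ring
  · ext v
    have h := hF.dTZ_imaginary hθ hU hx
    simp only [connectionForm, add_apply, smul_apply, conjForm_apply, complexForm_apply,
      smul_eq_mul, map_add, map_mul, map_neg, Complex.conj_conj, Complex.conj_ofReal,
      zero_apply]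
    linear_combination -(θ x v : ℂ) * h

/-- The connection form and the torsion satisfy the structure equation. -/
lemma IsAdmissibleOn.structureEq (hF : F.IsAdmissibleOn C θ U) (hθ : θ.SmoothOn U)
    (hU : IsOpen U) (hx : x ∈ U) : F.StructureEq θ x (F.ω θ x) (F.Abar θ x) := by
  have h1 : ∃ η a, F.StructureEq θ x η a := ⟨_, _, hF.structureEq_connectionForm hθ hU hx⟩
  have h2 : ∃ a, F.StructureEq θ x (F.ω θ x) a :=
    Classical.epsilon_spec (p := fun η => ∃ a : ℂ, F.StructureEq θ x η a) h1
  exact Classical.epsilon_spec (p := fun a => F.StructureEq θ x (F.ω θ x) a) h2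

lemma IsAdmissibleOn.ω_eq (hF : F.IsAdmissibleOn C θ U) (hθ : θ.SmoothOn U)
    (hU : IsOpen U) (hx : x ∈ U) {η : TangentSpace (𝓡 3) x →L[ℝ] ℂ} {a : ℂ}
    (hs : F.StructureEq θ x η a) : F.ω θ x = η :=
  ((hF.structureEq hθ hU hx).unique hF.toIsDualOn hx hs).1

lemma IsAdmissibleOn.Abar_eq (hF : F.IsAdmissibleOn C θ U) (hθ : θ.SmoothOn U)
    (hU : IsOpen U) (hx : x ∈ U) {η : TangentSpace (𝓡 3) x →L[ℝ] ℂ} {a : ℂ}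
    (hs : F.StructureEq θ x η a) : F.Abar θ x = a :=
  ((hF.structureEq hθ hU hx).unique hF.toIsDualOn hx hs).2

lemma IsAdmissibleOn.ω_smooth (hF : F.IsAdmissibleOn C θ U) (hθ : θ.SmoothOn U)
    (hU : IsOpen U) : (F.ω θ).SmoothOn U := by
  have hT := hF.smooth_T hθ hF.θ1_smooth
  have hX := hF.smooth_re hθ hF.θ1_smooth
  have hY := hF.smooth_im hθ hF.θ1_smooth
  have h1 : FnSmoothOn (F.θ1.dZZbar F) U :=
    ((FnSmoothOn.const (-2 * Complex.I)).mul (hF.θ1_smooth.d_apply hU hX hY)).congr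
      fun y _ => F.θ1.dZZbar_eq F y
  have h2 : FnSmoothOn (F.θ1.dTZ F) U := (hF.θ1_smooth.d_apply hU hT hX).add
    ((FnSmoothOn.const Complex.I).mul (hF.θ1_smooth.d_apply hU hT hY))
  have h3 : (F.connectionForm θ).SmoothOn U :=
    ((OneForm.SmoothOn.smul h1.conj.neg hF.θ1_smooth).add
      (OneForm.SmoothOn.smul h1 hF.θ1_smooth.conjForm)).add
      (OneForm.SmoothOn.smul h2.neg hθ.complexForm)
  exact h3.congr fun y hy => hF.ω_eq hθ hU hy (hF.structureEq_connectionForm hθ hU hy)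

lemma IsAdmissibleOn.conj_ω (hF : F.IsAdmissibleOn C θ U) (hθ : θ.SmoothOn U)
    (hU : IsOpen U) (hx : x ∈ U) : conjForm (F.ω θ x) = -F.ω θ x := by
  rw [eq_neg_iff_add_eq_zero, add_comm]
  exact (hF.structureEq hθ hU hx).2

lemma IsAdmissibleOn.ω_Zbar (hF : F.IsAdmissibleOn C θ U) (hθ : θ.SmoothOn U)
    (hU : IsOpen U) (hx : x ∈ U) : evalC (F.ω θ x) (F.Zbar x) = F.θ1.dZZbar F x :=
  ((hF.structureEq hθ hU hx).eq_components hF.toIsDualOn hx).2.1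

lemma IsDualOn.conjθ1_Z (h : F.IsDualOn θ U) (hx : x ∈ U) :
    evalC (conjForm (F.θ1 x)) (F.Z x) = 0 := by
  rw [evalC_conjForm_Z, h.θ1_Zbar x hx, map_zero]

lemma IsDualOn.conjθ1_Zbar (h : F.IsDualOn θ U) (hx : x ∈ U) :
    evalC (conjForm (F.θ1 x)) (F.Zbar x) = 1 := by
  rw [evalC_conjForm_Zbar, h.θ1_Z x hx, map_one]

/-! ### The sublaplacian as an exterior derivative -/

/-- The form `f_{,1} θ¹ - f_{,1̄} θ¹̄`, which does not depend on the frame. -/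
def gradForm (F : LocalFrame M) (f : M → ℂ) : OneForm M ℂ := fun x =>
  along F.Z f x • F.θ1 x + (-along F.Zbar f x) • conjForm (F.θ1 x)

lemma IsAdmissibleOn.gradForm_smooth (hF : F.IsAdmissibleOn C θ U) (hθ : θ.SmoothOn U)
    (hU : IsOpen U) {f : M → ℂ} (hf : FnSmoothOn f U) : (F.gradForm f).SmoothOn U :=
  (OneForm.SmoothOn.smul (hF.along_Z_smooth hθ hF.θ1_smooth hU hf) hF.θ1_smooth).add
    (OneForm.SmoothOn.smul (hF.along_Zbar_smooth hθ hF.θ1_smooth hU hf).neg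
      hF.θ1_smooth.conjForm)

lemma IsAdmissibleOn.dZZbar_along_Z_smul (hF : F.IsAdmissibleOn C θ U) (hθ : θ.SmoothOn U)
    (hU : IsOpen U) (hx : x ∈ U) {f : M → ℂ} (hf : FnSmoothOn f U) :
    OneForm.dZZbar (fun y => along F.Z f y • F.θ1 y) F x = -F.hess11bar θ f x := by
  rw [OneForm.dZZbar_smul (hF.along_Z_smooth hθ hF.θ1_smooth hU hf) hF.θ1_smooth hU hx,
    hF.θ1_Z x hx, hF.θ1_Zbar x hx, hess11bar, hF.ω_Zbar hθ hU hx]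
  ring

lemma IsAdmissibleOn.dZZbar_along_Zbar_smul (hF : F.IsAdmissibleOn C θ U) (hθ : θ.SmoothOn U)
    (hU : IsOpen U) (hx : x ∈ U) {f : M → ℂ} (hf : FnSmoothOn f U) :
    OneForm.dZZbar (fun y => along F.Zbar f y • conjForm (F.θ1 y)) F x = F.hess1bar1 θ f x := by
  rw [OneForm.dZZbar_smul (hF.along_Zbar_smooth hθ hF.θ1_smooth hU hf) hF.θ1_smooth.conjForm hU hx,
    OneForm.dZZbar_conj hF.θ1_smooth hU hx, hF.conjθ1_Z hx, hF.conjθ1_Zbar hx, hess1bar1,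
    evalC_conjForm_Z, hF.ω_Zbar hθ hU hx]
  ring

/-- The frame-independent form of the sublaplacian: it is minus the `θ¹ ∧ θ¹̄`-component of
`d(f_{,1} θ¹ - f_{,1̄} θ¹̄)`. -/
lemma IsAdmissibleOn.dZZbar_gradForm (hF : F.IsAdmissibleOn C θ U) (hθ : θ.SmoothOn U)
    (hU : IsOpen U) (hx : x ∈ U) {f : M → ℂ} (hf : FnSmoothOn f U) :
    (F.gradForm f).dZZbar F x = -(F.hess11bar θ f x + F.hess1bar1 θ f x) := by
  have h1 := hF.along_Z_smooth hθ hF.θ1_smooth hU hf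
  have h2 := hF.along_Zbar_smooth hθ hF.θ1_smooth hU hf
  have h3 := OneForm.SmoothOn.smul h2 hF.θ1_smooth.conjForm
  have e := OneForm.dZZbar_add (F := F) (OneForm.SmoothOn.smul h1 hF.θ1_smooth)
    (OneForm.SmoothOn.smul (FnSmoothOn.const (-1 : ℂ)) h3) hU hx
  rw [OneForm.dZZbar_congr hU hx (α := F.gradForm f) (β := fun y => along F.Z f y • F.θ1 y
      + (-1 : ℂ) • along F.Zbar f y • conjForm (F.θ1 y)) (fun y _ => by
      ext v
      simp only [gradForm, add_apply, smul_apply, smul_eq_mul]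
      ring), e,
    OneForm.dZZbar_smul (FnSmoothOn.const (-1 : ℂ)) h3 hU hx, along_const, along_const,
    hF.dZZbar_along_Z_smul hθ hU hx hf, hF.dZZbar_along_Zbar_smul hθ hU hx hf]
  ring

lemma IsAdmissibleOn.dZZbar_contactForm (hF : F.IsAdmissibleOn C θ U) (hθ : θ.SmoothOn U)
    (hU : IsOpen U) (hx : x ∈ U) :
    OneForm.dZZbar (fun y => complexForm (θ y)) F x = Complex.I := by
  rw [OneForm.dZZbar_eq, OneForm.d_complexForm hθ hU hx, hF.levi x hx]
  simp only [wedge_apply, conjForm_apply, hF.θ1_re hx, hF.θ1_im hx, conj_half, conj_neg_I_half]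
  linear_combination -Complex.I * Complex.I_mul_I

lemma IsDualOn.contactForm_Zbar (h : F.IsDualOn θ U) (hx : x ∈ U) :
    evalC (complexForm (θ x)) (F.Zbar x) = 0 := by
  rw [evalC_Zbar, complexForm_apply, complexForm_apply, (h.θ_re_im hx).1, (h.θ_re_im hx).2]
  simp

/-- The component of `d(g θ)` along `θ¹ ∧ θ¹̄`. -/
lemma IsAdmissibleOn.dZZbar_smul_contactForm (hF : F.IsAdmissibleOn C θ U) (hθ : θ.SmoothOn U)
    (hU : IsOpen U) (hx : x ∈ U) {g : M → ℂ} (hg : FnSmoothOn g U) :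
    OneForm.dZZbar (fun y => g y • complexForm (θ y)) F x = g x * Complex.I := by
  rw [OneForm.dZZbar_smul hg hθ.complexForm hU hx, hF.θ_Z x hx, hF.contactForm_Zbar hx,
    hF.dZZbar_contactForm hθ hU hx]
  ring

/-- The commutation rule `f_{,11̄} - f_{,1̄1} = i f_{,0}`, a consequence of `d(df) = 0`. -/
lemma IsAdmissibleOn.hess_commute (hF : F.IsAdmissibleOn C θ U) (hθ : θ.SmoothOn U)
    (hU : IsOpen U) (hx : x ∈ U) {f : M → ℂ} (hf : FnSmoothOn f U) :
    F.hess11bar θ f x - F.hess1bar1 θ f x = Complex.I * dForm f x (F.T x) := by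
  have h1 := hF.along_Z_smooth hθ hF.θ1_smooth hU hf
  have h2 := hF.along_Zbar_smooth hθ hF.θ1_smooth hU hf
  have h0 : FnSmoothOn (fun y => dForm f y (F.T y)) U :=
    (hf.dForm hU).apply (hF.smooth_T hθ hF.θ1_smooth)
  have s0 := OneForm.SmoothOn.smul h0 hθ.complexForm
  have s1 := OneForm.SmoothOn.smul h1 hF.θ1_smooth
  have s2 := OneForm.SmoothOn.smul h2 hF.θ1_smooth.conjForm
  have e := OneForm.dZZbar_eq (dForm f) F x
  rw [OneForm.d_dForm hf hU hx, mul_zero, OneForm.dZZbar_congr hU hx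
    (β := fun y => dForm f y (F.T y) • complexForm (θ y) + along F.Z f y • F.θ1 y
      + along F.Zbar f y • conjForm (F.θ1 y)) (fun y hy => by
        ext v
        exact hF.dForm_expand hy f v), OneForm.dZZbar_add (s0.add s1) s2 hU hx,
    OneForm.dZZbar_add s0 s1 hU hx, hF.dZZbar_smul_contactForm hθ hU hx h0,
    hF.dZZbar_along_Z_smul hθ hU hx hf, hF.dZZbar_along_Zbar_smul hθ hU hx hf] at e
  linear_combination -e

lemma IsAdmissibleOn.hess_sum_smooth (hF : F.IsAdmissibleOn C θ U) (hθ : θ.SmoothOn U)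
    (hU : IsOpen U) {f : M → ℂ} (hf : FnSmoothOn f U) :
    FnSmoothOn (fun y => F.hess11bar θ f y + F.hess1bar1 θ f y) U := by
  have h1 := hF.along_Z_smooth hθ hF.θ1_smooth hU hf
  have h2 := hF.along_Zbar_smooth hθ hF.θ1_smooth hU hf
  have hω := hF.ω_smooth hθ hU
  exact ((hF.along_Zbar_smooth hθ hF.θ1_smooth hU h1).sub
    ((hF.evalC_Zbar_smooth hθ hF.θ1_smooth hω).mul h1)).add
    ((hF.along_Z_smooth hθ hF.θ1_smooth hU h2).sub
    ((hF.evalC_Z_smooth hθ hF.θ1_smooth hω.conjForm).mul h2))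

/-- Since `ω₁¹` is imaginary, the curvature is real. -/
lemma IsAdmissibleOn.conj_curv (hF : F.IsAdmissibleOn C θ U) (hθ : θ.SmoothOn U)
    (hU : IsOpen U) (hx : x ∈ U) : (starRingEnd ℂ) (F.curv θ x) = F.curv θ x := by
  have hω := hF.ω_smooth hθ hU
  have h1 := OneForm.dZZbar_conj (F := F) hω hU hx
  have h2 : OneForm.dZZbar (fun y => conjForm (F.ω θ y)) F x
      = OneForm.dZZbar (fun y => (-1 : ℂ) • F.ω θ y) F x :=
    OneForm.dZZbar_congr hU hx fun y hy => by rw [hF.conj_ω hθ hU hy, neg_one_smul]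
  rw [h1, OneForm.dZZbar_smul (FnSmoothOn.const (-1 : ℂ)) hω hU hx] at h2
  rw [along_const, along_const] at h2
  have h3 : F.curv θ x = (F.ω θ).dZZbar F x := rfl
  rw [h3]
  linear_combination -h2

end LocalFrame

end Connection

section Invariance

variable {M : Type*} [TopologicalSpace M] [ChartedSpace (EuclideanSpace ℝ (Fin 3)) M]
  [IsManifold (𝓡 3) ∞ M] {C : CRStructure M}
  {F F' : LocalFrame M} {θ : OneForm M ℝ} {U V : Set M} {x : M}

/-! ### Independence of the frame -/

namespace LocalFrame

/-- The function `u` with `θ'¹ = u θ¹` for two admissible frames of the same contact form. -/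
def transition (F F' : LocalFrame M) (x : M) : ℂ := evalC (F'.θ1 x) (F.Z x)

/-- Two admissible frames of the same contact form differ by a rotation: `θ¹` is determined up to
a factor by `θ¹(T) = θ¹(Z₁̄) = 0`, and the factor has modulus one because of
`dθ = i θ¹ ∧ θ¹̄`. -/
lemma IsAdmissibleOn.θ1_transition (hF : F.IsAdmissibleOn C θ U) (hF' : F'.IsAdmissibleOn C θ U)
    (hx : x ∈ U) :
    F'.θ1 x = F.transition F' x • F.θ1 x ∧
      F.transition F' x * (starRingEnd ℂ) (F.transition F' x) = 1 := by
  have h := hF.toIsDualOn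
  have h' := hF'.toIsDualOn
  have hT : F'.θ1 x (F.T x) = 0 := by
    have e : ∀ v, wedge (F'.θ1 x) (conjForm (F'.θ1 x)) (F.T x) v = 0 := by
      intro v
      have h1 := hF'.levi x hx (F.T x) v
      rw [hF.char x hx v, Complex.ofReal_zero] at h1
      exact (mul_eq_zero.1 h1.symm).resolve_left Complex.I_ne_zero
    have e1 := e (F'.Z x).1
    have e2 := e (F'.Z x).2
    simp only [wedge_apply, conjForm_apply, h'.θ1_re hx, h'.θ1_im hx, conj_half,
      conj_neg_I_half] at e1 e2
    linear_combination e1 - Complex.I * e2 + (F'.θ1 x (F.T x) / 2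
      + (starRingEnd ℂ) (F'.θ1 x (F.T x)) / 2) * Complex.I_mul_I
  have hZbar : evalC (F'.θ1 x) (F.Zbar x) = 0 := by
    obtain ⟨X, Y, hXY, hJX, -⟩ := hF.eigen x hx
    obtain ⟨X', Y', hXY', hJX', hJY'⟩ := hF'.eigen x hx
    have eX : (F.Z x).1 = X := by rw [hXY]
    have eY : (F.Z x).2 = Y := by rw [hXY]
    have eX' : (F'.Z x).1 = X' := by rw [hXY']
    have eY' : (F'.Z x).2 = Y' := by rw [hXY']
    have h1 := h'.vec_eq hx (F.Z x).1
    rw [(h.θ_re_im hx).1, zero_smul, zero_add, eX, eX', eY'] at h1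
    generalize 2 * ((F'.θ1 x) (X : TangentSpace (𝓡 3) x)).re = c at h1
    generalize 2 * ((F'.θ1 x) (X : TangentSpace (𝓡 3) x)).im = d at h1
    have h2 : X = c • X' - d • Y' := Subtype.ext h1
    have h3 : Y = c • Y' + d • X' := by
      have h4 : -Y = -(c • Y' + d • X') := by
        rw [← hJX, h2, map_sub, map_smul, map_smul, hJX', hJY', smul_neg, neg_add]
        abel
      exact neg_injective h4
    have h5 : (Y : TangentSpace (𝓡 3) x) = c • (Y' : TangentSpace (𝓡 3) x)
        + d • (X' : TangentSpace (𝓡 3) x) := congrArg Subtype.val h3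
    have a1 := h'.θ1_re hx
    have a2 := h'.θ1_im hx
    rw [eX'] at a1
    rw [eY'] at a2
    rw [evalC_Zbar, eX, eY, h1, h5]
    simp only [map_add, map_sub, map_smul, a1, a2, Complex.real_smul]
    linear_combination (c / 2 : ℂ) * Complex.I_mul_I
  have h1 : F'.θ1 x = F.transition F' x • F.θ1 x := by
    ext v
    rw [h.covector_eq hx (F'.θ1 x) v, hT, hZbar]
    simp [transition]
  refine ⟨h1, ?_⟩
  have l1 := hF.levi x hx (F.Z x).1 (F.Z x).2
  rw [hF'.levi x hx, h1] at l1
  simp only [wedge_apply, conjForm_apply, smul_apply, smul_eq_mul, map_mul, h.θ1_re hx,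
    h.θ1_im hx, conj_half, conj_neg_I_half] at l1
  linear_combination -2 * l1 + (F.transition F' x * (starRingEnd ℂ) (F.transition F' x) - 1)
    * Complex.I_mul_I

/-- The `θ¹ ∧ θ¹̄`-component of `dα` is the same in two admissible frames. -/
lemma IsAdmissibleOn.dZZbar_eq_dZZbar (hF : F.IsAdmissibleOn C θ U)
    (hF' : F'.IsAdmissibleOn C θ U) (hx : x ∈ U) (α : OneForm M ℂ) :
    α.dZZbar F' x = α.dZZbar F x := by
  have h' := hF'.toIsDualOn
  obtain ⟨h1, h2⟩ := hF.θ1_transition hF' hx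
  set u := F.transition F' x
  have b1 := h'.θ1_re hx
  have b2 := h'.θ1_im hx
  simp only [h1, smul_apply, smul_eq_mul] at b1 b2
  have c1 : F.θ1 x (F'.Z x).1 = (starRingEnd ℂ) u / 2 := by
    linear_combination (starRingEnd ℂ) u * b1 - F.θ1 x (F'.Z x).1 * h2
  have c2 : F.θ1 x (F'.Z x).2 = -Complex.I * (starRingEnd ℂ) u / 2 := by
    linear_combination (starRingEnd ℂ) u * b2 - F.θ1 x (F'.Z x).2 * h2
  rw [α.dZZbar_eq F', hF.d_expand hx α]
  simp only [wedge_apply, conjForm_apply, complexForm_apply, (h'.θ_re_im hx).1,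
    (h'.θ_re_im hx).2, c1, c2, map_div₀, map_mul, map_neg, Complex.conj_I, map_ofNat,
    Complex.conj_conj, Complex.ofReal_zero]
  linear_combination -α.dZZbar F x * u * (starRingEnd ℂ) u * Complex.I_mul_I
    + α.dZZbar F x * h2

/-- The form `f_{,1} θ¹ - f_{,1̄} θ¹̄` is the same in two admissible frames. -/
lemma IsAdmissibleOn.gradForm_eq (hF : F.IsAdmissibleOn C θ U)
    (hF' : F'.IsAdmissibleOn C θ U) (hx : x ∈ U) (f : M → ℂ) :
    F'.gradForm f x = F.gradForm f x := by
  have h := hF.toIsDualOn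
  have h' := hF'.toIsDualOn
  obtain ⟨h1, h2⟩ := hF.θ1_transition hF' hx
  set u := F.transition F' x
  have b1 := h'.θ1_Z x hx
  have b2 := h'.θ1_Zbar x hx
  have k1 : ∀ η : TangentSpace (𝓡 3) x →L[ℝ] ℂ,
      evalC η (F'.Z x) = (starRingEnd ℂ) u * evalC η (F.Z x) ∧
      evalC η (F'.Zbar x) = u * evalC η (F.Zbar x) := by
    intro η
    have c1 := h'.θ1_re hx
    have c2 := h'.θ1_im hx
    simp only [h1, smul_apply, smul_eq_mul] at c1 c2
    have d1 : F.θ1 x (F'.Z x).1 = (starRingEnd ℂ) u / 2 := by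
      linear_combination (starRingEnd ℂ) u * c1 - F.θ1 x (F'.Z x).1 * h2
    have d2 : F.θ1 x (F'.Z x).2 = -Complex.I * (starRingEnd ℂ) u / 2 := by
      linear_combination (starRingEnd ℂ) u * c2 - F.θ1 x (F'.Z x).2 * h2
    have e1 := h.covector_eq hx η (F'.Z x).1
    have e2 := h.covector_eq hx η (F'.Z x).2
    simp only [(h'.θ_re_im hx).1, (h'.θ_re_im hx).2, d1, d2, map_div₀, map_mul, map_neg,
      Complex.conj_I, map_ofNat, Complex.conj_conj, Complex.ofReal_zero] at e1 e2
    rw [evalC_Zbar (F := F'), evalC]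
    constructor
    · rw [e1, e2]
      linear_combination (-(starRingEnd ℂ) u * evalC η (F.Z x) / 2
        + u * evalC η (F.Zbar x) / 2) * Complex.I_mul_I
    · rw [e1, e2]
      linear_combination ((starRingEnd ℂ) u * evalC η (F.Z x) / 2
        - u * evalC η (F.Zbar x) / 2) * Complex.I_mul_I
  ext v
  simp only [gradForm, along_eq, k1, h1, add_apply, smul_apply, conjForm_apply, smul_eq_mul,
    map_mul]
  linear_combination (evalC (dForm f x) (F.Z x) * F.θ1 x v
    - evalC (dForm f x) (F.Zbar x) * (starRingEnd ℂ) (F.θ1 x v)) * h2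

/-- The sublaplacian does not depend on the admissible frame. -/
lemma IsAdmissibleOn.hess_sum_eq (hF : F.IsAdmissibleOn C θ U)
    (hF' : F'.IsAdmissibleOn C θ U) (hθ : θ.SmoothOn U) (hU : IsOpen U) (hx : x ∈ U)
    {f : M → ℂ} (hf : FnSmoothOn f U) :
    F'.hess11bar θ f x + F'.hess1bar1 θ f x = F.hess11bar θ f x + F.hess1bar1 θ f x := by
  have h1 := hF.dZZbar_gradForm hθ hU hx hf
  have h2 := hF'.dZZbar_gradForm hθ hU hx hf
  rw [OneForm.dZZbar_congr hU hx fun y hy => hF.gradForm_eq hF' hy f,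
    hF.dZZbar_eq_dZZbar hF' hx, h1] at h2
  linear_combination h2

lemma IsAdmissibleOn.transition_smooth (hF : F.IsAdmissibleOn C θ U)
    (hF' : F'.IsAdmissibleOn C θ U) (hθ : θ.SmoothOn U) : FnSmoothOn (F.transition F') U :=
  hF.evalC_Z_smooth hθ hF.θ1_smooth hF'.θ1_smooth

/-- If `θ'¹ = u θ¹` with `|u| = 1`, then `ω'₁¹ = ω₁¹ - ū du`. -/
lemma IsAdmissibleOn.ω_transition (hF : F.IsAdmissibleOn C θ U) (hF' : F'.IsAdmissibleOn C θ U)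
    (hθ : θ.SmoothOn U) (hU : IsOpen U) (hx : x ∈ U) :
    F'.ω θ x = F.ω θ x
      + (-(starRingEnd ℂ) (F.transition F' x)) • dForm (F.transition F') x := by
  have hu := hF.transition_smooth hF' hθ
  obtain ⟨s1, s2⟩ := hF.structureEq hθ hU hx
  obtain ⟨h1, h2⟩ := hF.θ1_transition hF' hx
  have hd := fun v w => (OneForm.d_congr (α := F'.θ1) hU hx
    (fun y hy => (hF.θ1_transition hF' hy).1) v w).trans
      (OneForm.d_smul hu hF.θ1_smooth hU hx v w)
  have hn : ∀ v, dForm (F.transition F') x v * (starRingEnd ℂ) (F.transition F' x)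
      + F.transition F' x * (starRingEnd ℂ) (dForm (F.transition F') x v) = 0 := by
    intro v
    have e := dForm_smul hu hu.conj hU hx v
    simp only [smul_eq_mul] at e
    rw [dForm_conj hu hU hx] at e
    rw [← e, dForm_congr hU hx (g := fun _ => (1 : ℂ)) fun y hy => (hF.θ1_transition hF' hy).2]
    have h0 : dForm (fun _ : M => (1 : ℂ)) x = 0 := mfderiv_const
    rw [h0, zero_apply]
  refine hF'.ω_eq hθ hU hx (a := F.transition F' x ^ 2 * F.Abar θ x) ⟨?_, ?_⟩
  · intro v w
    rw [hd, s1, h1]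
    simp only [wedge_apply, conjForm_apply, complexForm_apply, smul_apply, add_apply,
      smul_eq_mul, map_mul]
    linear_combination (dForm (F.transition F') x w * F.θ1 x v
      - dForm (F.transition F') x v * F.θ1 x w
      - F.transition F' x * F.Abar θ x * (θ x v * (starRingEnd ℂ) (F.θ1 x w)
        - θ x w * (starRingEnd ℂ) (F.θ1 x v))) * h2
  · ext v
    have s3 := DFunLike.congr_fun s2 v
    simp only [add_apply, smul_apply, conjForm_apply, zero_apply, smul_eq_mul, map_add, map_mul,
      map_neg, Complex.conj_conj] at s3 ⊢
    linear_combination s3 - hn v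

/-- The curvature does not depend on the admissible frame. -/
lemma IsAdmissibleOn.curv_eq (hF : F.IsAdmissibleOn C θ U) (hF' : F'.IsAdmissibleOn C θ U)
    (hθ : θ.SmoothOn U) (hU : IsOpen U) (hx : x ∈ U) : F'.curv θ x = F.curv θ x := by
  have hu := hF.transition_smooth hF' hθ
  have hω := hF.ω_smooth hθ hU
  obtain ⟨h1, h2⟩ := hF.θ1_transition hF' hx
  have e0 : F'.curv θ x = (F'.ω θ).dZZbar F' x := rfl
  have e1 : F.curv θ x = (F.ω θ).dZZbar F x := rfl
  rw [e0, e1, hF.dZZbar_eq_dZZbar hF' hx,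
    OneForm.dZZbar_congr hU hx fun y hy => hF.ω_transition hF' hθ hU hy,
    OneForm.dZZbar_add hω (OneForm.SmoothOn.smul hu.conj.neg (hu.dForm hU)) hU hx,
    OneForm.dZZbar_smul hu.conj.neg (hu.dForm hU) hU hx, along_neg hu.conj hU hx,
    along_neg hu.conj hU hx, OneForm.dZZbar_eq (dForm (F.transition F')),
    OneForm.d_dForm hu hU hx]
  -- the constraint `u ū = 1` forces `dū ∧ du = 0`
  have hn : ∀ Z : (x : M) → ComplexTangent x,
      along Z (F.transition F') x * (starRingEnd ℂ) (F.transition F' x)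
      + F.transition F' x * along Z (fun y => (starRingEnd ℂ) (F.transition F' y)) x = 0 := by
    intro Z
    rw [← along_mul hu hu.conj hU hx,
      along_congr hU hx (g := fun _ => (1 : ℂ)) fun y hy => (hF.θ1_transition hF' hy).2,
      along_const]
  have n1 := hn F.Z
  have n2 := hn F.Zbar
  rw [← along_eq, ← along_eq]
  linear_combination (starRingEnd ℂ) (F.transition F' x) * (-n1 * along F.Zbar (F.transition F') x
    + n2 * along F.Z (F.transition F') x) + (along F.Zbar (F.transition F') x *
      along F.Z (fun y => (starRingEnd ℂ) (F.transition F' y)) x - along F.Z (F.transition F') x *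
      along F.Zbar (fun y => (starRingEnd ℂ) (F.transition F' y)) x) * h2

lemma IsAdmissibleOn.mono (hF : F.IsAdmissibleOn C θ U) (h : V ⊆ U) :
    F.IsAdmissibleOn C θ V where
  θ_T x hx := hF.θ_T x (h hx)
  θ_Z x hx := hF.θ_Z x (h hx)
  θ1_T x hx := hF.θ1_T x (h hx)
  θ1_Z x hx := hF.θ1_Z x (h hx)
  θ1_Zbar x hx := hF.θ1_Zbar x (h hx)
  θ1_smooth := hF.θ1_smooth.mono h
  char x hx := hF.char x (h hx)
  eigen x hx := hF.eigen x (h hx)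
  levi x hx := hF.levi x (h hx)

/-- The Webster curvature may be computed in any admissible frame. -/
lemma IsAdmissibleOn.websterCurvature_eq (hF : F.IsAdmissibleOn C θ U) (hθ : θ.SmoothOn univ)
    (hU : IsOpen U) (hx : x ∈ U) : (websterCurvature C θ x : ℂ) = F.curv θ x := by
  have hr : (((F.curv θ x).re : ℝ) : ℂ) = F.curv θ x :=
    Complex.conj_eq_iff_re.1 (hF.conj_curv (hθ.mono (subset_univ _)) hU hx)
  obtain ⟨U', F', hU', hx', hF', h⟩ := Classical.epsilon_spec
    (p := fun r : ℝ => ∃ (U : Set M) (F : LocalFrame M),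
      IsOpen U ∧ x ∈ U ∧ F.IsAdmissibleOn C θ U ∧ (r : ℂ) = F.curv θ x)
    ⟨_, U, F, hU, hx, hF, hr⟩
  have h' : (websterCurvature C θ x : ℂ) = F'.curv θ x := h
  rw [h', (hF.mono inter_subset_left).curv_eq (hF'.mono (inter_subset_right (s := U)))
    (hθ.mono (subset_univ _)) (hU.inter hU') ⟨hx, hx'⟩]

/-- For a real function, `f_{,11̄}` and `f_{,1̄1}` are conjugate to each other. -/
lemma IsAdmissibleOn.conj_hess11bar (hF : F.IsAdmissibleOn C θ U) (hθ : θ.SmoothOn U)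
    (hU : IsOpen U) (hx : x ∈ U) {f : M → ℝ} (hf : FnSmoothOn f U) :
    (starRingEnd ℂ) (F.hess11bar θ (fun y => (f y : ℂ)) x)
      = F.hess1bar1 θ (fun y => (f y : ℂ)) x := by
  have h1 := hF.along_Z_smooth hθ hF.θ1_smooth hU hf.ofReal
  rw [hess11bar, hess1bar1, map_sub, map_mul, ← along_conj_Z h1 hU hx, ← evalC_conjForm_Z,
    along_Zbar_real hf hU hx,
    along_congr hU hx (f := along F.Zbar _) fun y hy => along_Zbar_real hf hU hy]

/-- The sublaplacian may be computed in any admissible frame. -/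
lemma IsAdmissibleOn.subLaplacian_eq (hF : F.IsAdmissibleOn C θ U) (hθ : θ.SmoothOn univ)
    (hU : IsOpen U) (hx : x ∈ U) {f : M → ℝ} (hf : FnSmoothOn f U) :
    (subLaplacian C θ f x : ℂ)
      = F.hess11bar θ (fun y => (f y : ℂ)) x + F.hess1bar1 θ (fun y => (f y : ℂ)) x := by
  have hθU := hθ.mono (subset_univ U)
  have hreal := hF.conj_hess11bar hθU hU hx hf
  have hr : (((F.hess11bar θ (fun y => (f y : ℂ)) x
      + F.hess1bar1 θ (fun y => (f y : ℂ)) x).re : ℝ) : ℂ)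
      = F.hess11bar θ (fun y => (f y : ℂ)) x + F.hess1bar1 θ (fun y => (f y : ℂ)) x := by
    rw [← Complex.conj_eq_iff_re, map_add, ← hreal, Complex.conj_conj, add_comm]
  obtain ⟨U', F', hU', hx', hF', h⟩ := Classical.epsilon_spec
    (p := fun r : ℝ => ∃ (U : Set M) (F : LocalFrame M),
      IsOpen U ∧ x ∈ U ∧ F.IsAdmissibleOn C θ U ∧
        (r : ℂ) = F.hess11bar θ (fun y => (f y : ℂ)) x + F.hess1bar1 θ (fun y => (f y : ℂ)) x)
    ⟨_, U, F, hU, hx, hF, hr⟩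
  have h' : (subLaplacian C θ f x : ℂ)
    = F'.hess11bar θ (fun y => (f y : ℂ)) x + F'.hess1bar1 θ (fun y => (f y : ℂ)) x := h
  rw [h', (hF.mono inter_subset_left).hess_sum_eq (hF'.mono (inter_subset_right (s := U)))
    (hθ.mono (subset_univ _)) (hU.inter hU') ⟨hx, hx'⟩ (hf.ofReal.mono inter_subset_left)]

end LocalFrame

end Invariance

section Conformal

variable {M : Type*} [TopologicalSpace M] [ChartedSpace (EuclideanSpace ℝ (Fin 3)) M]
  [IsManifold (𝓡 3) ∞ M] {C : CRStructure M}
  {F F' : LocalFrame M} {θ : OneForm M ℝ} {u : M → ℝ} {U : Set M} {x : M}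

/-! ### Conformal change of the contact form -/

lemma conformal_apply (u : M → ℝ) (θ : OneForm M ℝ) (v : TangentSpace (𝓡 3) x) :
    conformal u θ x v = Real.exp (u x) ^ 2 * θ x v := by
  change Real.exp (2 * u x) * θ x v = _
  rw [two_mul, Real.exp_add, sq]

lemma inducedθ1_apply (u : M → ℝ) (θ : OneForm M ℝ) (F : LocalFrame M)
    (v : TangentSpace (𝓡 3) x) :
    inducedθ1 u θ F x v = Real.exp (u x) * (F.θ1 x v
      + 2 * Complex.I * along F.Zbar (fun y => (u y : ℂ)) x * θ x v) := rfl

lemma FnSmoothOn.exp {f : M → ℝ} (hf : FnSmoothOn f U) :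
    FnSmoothOn (fun y => Real.exp (f y)) U := hf.comp fun _ _ => Real.contDiff_exp.contDiffAt

lemma dForm_exp {f : M → ℝ} (hf : FnSmoothOn f U) (hU : IsOpen U) (hx : x ∈ U)
    (v : TangentSpace (𝓡 3) x) :
    dForm (fun y => Real.exp (f y)) x v = Real.exp (f x) * dForm f x v := by
  rw [dForm_comp hf hU hx Real.differentiableAt_exp]
  simp [mul_comm]

lemma conformal_smooth (hu : FnSmoothOn u U) (hθ : θ.SmoothOn U) :
    (conformal u θ).SmoothOn U :=
  OneForm.SmoothOn.smul (((FnSmoothOn.const (2 : ℝ)).mul hu).exp) hθ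

namespace IsInducedFrame

lemma θ1_smooth (h : IsInducedFrame u θ U F F') (hF : F.IsAdmissibleOn C θ U)
    (hu : FnSmoothOn u U) (hθ : θ.SmoothOn U) (hU : IsOpen U) : F'.θ1.SmoothOn U :=
  (OneForm.SmoothOn.smul hu.exp.ofReal (hF.θ1_smooth.add (OneForm.SmoothOn.smul
    ((FnSmoothOn.const (2 * Complex.I)).mul
      (hF.along_Zbar_smooth hθ hF.θ1_smooth hU hu.ofReal)) hθ.complexForm))).congr h.θ1_eq

/-- The induced vector field is `e^{-u} Z₁`. -/
lemma Z_eq (h : IsInducedFrame u θ U F F') (hF : F.IsDualOn θ U) (hx : x ∈ U) :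
    (F'.Z x).1 = Real.exp (-u x) • (F.Z x).1 ∧ (F'.Z x).2 = Real.exp (-u x) • (F.Z x).2 := by
  have he : Real.exp (u x) ≠ 0 := (Real.exp_pos _).ne'
  have heC : (Real.exp (u x) : ℂ) ≠ 0 := Complex.ofReal_ne_zero.2 he
  have h0 := h.dual.θ_re_im hx
  rw [conformal_apply, conformal_apply] at h0
  have hX := (mul_eq_zero.1 h0.1).resolve_left (pow_ne_zero 2 he)
  have hY := (mul_eq_zero.1 h0.2).resolve_left (pow_ne_zero 2 he)
  have h1 := h.dual.θ1_re hx
  have h2 := h.dual.θ1_im hx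
  rw [h.θ1_eq x hx, inducedθ1_apply, hX, Complex.ofReal_zero, mul_zero, add_zero] at h1
  rw [h.θ1_eq x hx, inducedθ1_apply, hY, Complex.ofReal_zero, mul_zero, add_zero] at h2
  constructor
  · apply (hF.coframe_bijective hx).1
    rw [map_smul, coframe_apply, coframe_apply, hX, (hF.θ_re_im hx).1, hF.θ1_re hx, ← h1,
      Real.exp_neg]
    refine Prod.ext (by simp) ?_
    simp
  · apply (hF.coframe_bijective hx).1
    rw [map_smul, coframe_apply, coframe_apply, hY, (hF.θ_re_im hx).2, hF.θ1_im hx, ← h2,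
      Real.exp_neg]
    refine Prod.ext (by simp) ?_
    simp

lemma evalC_Zbar (h : IsInducedFrame u θ U F F') (hF : F.IsDualOn θ U) (hx : x ∈ U)
    (η : TangentSpace (𝓡 3) x →L[ℝ] ℂ) :
    evalC η (F'.Zbar x) = Real.exp (-u x) * evalC η (F.Zbar x) := by
  rw [CRYamabe.evalC_Zbar, CRYamabe.evalC_Zbar, (h.Z_eq hF hx).1, (h.Z_eq hF hx).2, map_smul,
    map_smul, Complex.real_smul, Complex.real_smul]
  ring

lemma dZZbar (h : IsInducedFrame u θ U F F') (hF : F.IsDualOn θ U) (hx : x ∈ U)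
    (α : OneForm M ℂ) : α.dZZbar F' x = Real.exp (-u x) ^ 2 * α.dZZbar F x := by
  rw [α.dZZbar_eq, α.dZZbar_eq, (h.Z_eq hF hx).1, (h.Z_eq hF hx).2, α.d_smul_left,
    α.d_smul_right, Complex.real_smul, Complex.real_smul]
  ring

/-- The normalization `dθ = i θ¹ ∧ θ¹̄` passes to the induced coframe: the term `2i u_{,1̄} θ` in
the definition of the latter absorbs `2 du ∧ θ`. -/
lemma levi (h : IsInducedFrame u θ U F F') (hF : F.IsAdmissibleOn C θ U)
    (hu : FnSmoothOn u U) (hθ : θ.SmoothOn U) (hU : IsOpen U) (hx : x ∈ U)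
    (v w : TangentSpace (𝓡 3) x) : ((conformal u θ).d x v w : ℂ)
      = Complex.I * wedge (F'.θ1 x) (conjForm (F'.θ1 x)) v w := by
  have e := OneForm.d_smul (((FnSmoothOn.const (2 : ℝ)).mul hu).exp) hθ hU hx v w
  have e0 : (conformal u θ).d x v w = _ := e
  have e1 : ∀ v, dForm (fun y => Real.exp (2 * u y)) x v
      = 2 * Real.exp (u x) ^ 2 * dForm u x v := by
    intro v
    have e2 := dForm_smul (FnSmoothOn.const (2 : ℝ)) hu hU hx v
    have e3 : dForm (fun _ : M => (2 : ℝ)) x = 0 := mfderiv_const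
    rw [e3] at e2
    simp only [smul_eq_mul, zero_apply, zero_mul, zero_add] at e2
    rw [dForm_exp ((FnSmoothOn.const (2 : ℝ)).mul hu) hU hx, e2, two_mul, Real.exp_add]
    ring
  have e4 : ∀ v, (dForm u x v : ℂ) = _ := fun v =>
    (dForm_ofReal hu hU hx v).symm.trans (hF.dForm_expand hx _ v)
  rw [e0, e1, e1, h.θ1_eq x hx]
  simp only [wedge_apply, conjForm_apply, inducedθ1_apply, smul_eq_mul, map_mul, map_add,
    Complex.conj_ofReal, Complex.conj_I, map_ofNat]
  push_cast
  rw [e4 v, e4 w, hF.levi x hx, along_Zbar_real hu hU hx, Complex.conj_conj, wedge_apply,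
    conjForm_apply, conjForm_apply, two_mul (u x : ℂ), Complex.exp_add]
  ring_nf
  simp only [Complex.I_sq]
  ring

/-- The frame induced on `e^{2u} θ` by an admissible frame of `θ` is admissible. -/
lemma isAdmissibleOn (h : IsInducedFrame u θ U F F') (hF : F.IsAdmissibleOn C θ U)
    (hu : FnSmoothOn u U) (hθ : θ.SmoothOn U) (hU : IsOpen U) :
    F'.IsAdmissibleOn C (conformal u θ) U where
  toIsDualOn := h.dual
  θ1_smooth := h.θ1_smooth hF hu hθ hU
  char x hx v := by
    have e := h.levi hF hu hθ hU hx (F'.T x) v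
    rw [wedge_apply, conjForm_apply, conjForm_apply, h.dual.θ1_T x hx] at e
    simpa using e
  eigen x hx := by
    obtain ⟨X, Y, hXY, hX, hY⟩ := hF.eigen x hx
    obtain ⟨h1, h2⟩ := h.Z_eq hF.toIsDualOn hx
    refine ⟨Real.exp (-u x) • X, Real.exp (-u x) • Y, ?_, ?_, ?_⟩
    · rw [hXY] at h1 h2
      exact Prod.ext h1 h2
    · rw [map_smul, hX, smul_neg]
    · rw [map_smul, hY]
  levi x hx v w := h.levi hF hu hθ hU hx v w

/-- The structure equation after a conformal change, with
`ω̃ = ω + 3 (u_{,1} θ¹ - u_{,1̄} θ¹̄) + i (Δ_b u + 8 |u_{,1}|²) θ`. -/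
lemma structureEq (h : IsInducedFrame u θ U F F') (hF : F.IsAdmissibleOn C θ U)
    (hu : FnSmoothOn u U) (hθ : θ.SmoothOn U) (hU : IsOpen U) (hx : x ∈ U) :
    F'.StructureEq (conformal u θ) x
      (F.ω θ x + ((3 : ℂ) • F.gradForm (fun y => (u y : ℂ)) x
        + (Complex.I * (F.hess11bar θ (fun y => (u y : ℂ)) x + F.hess1bar1 θ (fun y => (u y : ℂ)) x
          + 8 * (along F.Z (fun y => (u y : ℂ)) x * along F.Zbar (fun y => (u y : ℂ)) x)))
          • complexForm (θ x)))
      (Real.exp (-u x) ^ 2 * (F.Abar θ x + 4 * Complex.I * along F.Zbar (fun y => (u y : ℂ)) x ^ 2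
        - 2 * Complex.I * (along F.Zbar (along F.Zbar (fun y => (u y : ℂ))) x
          + evalC (F.ω θ x) (F.Zbar x) * along F.Zbar (fun y => (u y : ℂ)) x))) := by
  set f : M → ℂ := fun y => (u y : ℂ) with hf_def
  have hf : FnSmoothOn f U := hu.ofReal
  have h1 := hF.along_Z_smooth hθ hF.θ1_smooth hU hf
  have h2 := hF.along_Zbar_smooth hθ hF.θ1_smooth hU hf
  have hconj : (starRingEnd ℂ) (along F.Zbar f x) = along F.Z f x := by
    rw [along_Zbar_real hu hU hx, Complex.conj_conj]
  have hconj' : (starRingEnd ℂ) (along F.Z f x) = along F.Zbar f x := by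
    rw [← hconj, Complex.conj_conj]
  have hE : (Real.exp (u x) : ℂ) * Real.exp (-u x) = 1 := by
    rw [← Complex.ofReal_mul, ← Real.exp_add, add_neg_cancel, Real.exp_zero, Complex.ofReal_one]
  obtain ⟨s1, s2⟩ := hF.structureEq hθ hU hx
  have hcomm := hF.hess_commute hθ hU hx hf
  have hh : F.hess1bar1 θ f x
      = along F.Z (along F.Zbar f) x + evalC (F.ω θ x) (F.Z x) * along F.Zbar f x := by
    rw [LocalFrame.hess1bar1, hF.conj_ω hθ hU hx]
    simp [evalC]
    ring
  constructor
  · intro v w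
    have hsm := OneForm.SmoothOn.smul ((FnSmoothOn.const (2 * Complex.I)).mul h2) hθ.complexForm
    have d1 := (OneForm.d_congr hU hx h.θ1_eq v w).trans
      (OneForm.d_smul hu.exp.ofReal (hF.θ1_smooth.add hsm) hU hx v w)
    have d2 := OneForm.d_add hF.θ1_smooth hsm hU hx v w
    have d3 := OneForm.d_smul ((FnSmoothOn.const (2 * Complex.I)).mul h2) hθ.complexForm hU hx v w
    have d4 : ∀ v, dForm (fun y => ((Real.exp (u y) : ℝ) : ℂ)) x v
        = Real.exp (u x) * dForm f x v := by
      intro v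
      rw [dForm_ofReal hu.exp hU hx, dForm_exp hu hU hx, dForm_ofReal hu hU hx,
        Complex.ofReal_mul]
    have d5 : ∀ v, dForm (fun y => 2 * Complex.I * along F.Zbar f y) x v
        = 2 * Complex.I * dForm (along F.Zbar f) x v := by
      intro v
      have e := dForm_smul (FnSmoothOn.const (2 * Complex.I)) h2 hU hx v
      have e3 : dForm (fun _ : M => 2 * Complex.I) x = 0 := mfderiv_const
      rw [e3] at e
      simpa only [smul_eq_mul, zero_apply, zero_mul, zero_add] using e
    rw [d1, d2, d3, d4, d4, d5, d5, OneForm.d_complexForm hθ hU hx, hF.levi x hx, s1,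
      hF.dForm_expand hx f v, hF.dForm_expand hx f w, hF.dForm_expand hx (along F.Zbar f) v,
      hF.dForm_expand hx (along F.Zbar f) w, h.θ1_eq x hx]
    simp only [wedge_apply, conjForm_apply, complexForm_apply, inducedθ1_apply, conformal_apply,
      add_apply, smul_apply, smul_eq_mul, map_mul, map_add, Complex.conj_ofReal, Complex.conj_I,
      map_ofNat, LocalFrame.gradForm, Complex.ofReal_mul, Complex.ofReal_pow]
    rw [hF.covector_eq hx (F.ω θ x) v, hF.covector_eq hx (F.ω θ x) w]
    have hm0 : dForm f x (F.T x) = -Complex.I * (F.hess11bar θ f x - F.hess1bar1 θ f x) := by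
      rw [hcomm]
      linear_combination dForm f x (F.T x) * Complex.I_mul_I
    rw [hm0, hh, hconj, ← hf_def]
    generalize (F.ω θ x) (F.T x) = wT
    generalize evalC (F.ω θ x) (F.Z x) = wZ
    generalize evalC (F.ω θ x) (F.Zbar x) = wZb
    generalize F.hess11bar θ f x = h11
    generalize along F.Z (along F.Zbar f) x = nZ
    generalize along F.Zbar (along F.Zbar f) x = nZb
    generalize dForm (along F.Zbar f) x (F.T x) = n0
    generalize along F.Z f x = m1
    generalize along F.Zbar f x = m1b
    generalize F.Abar θ x = A
    generalize (starRingEnd ℂ) (F.θ1 x v) = ac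
    generalize (starRingEnd ℂ) (F.θ1 x w) = bc
    generalize F.θ1 x v = a
    generalize F.θ1 x w = b
    generalize (θ x v : ℂ) = t
    generalize (θ x w : ℂ) = s
    generalize (Real.exp (u x) : ℂ) = E at *
    generalize (Real.exp (-u x) : ℂ) = E' at *
    -- The two sides differ by the torsion term, multiplied by `E ^ 2 * E' ^ 2` on one of them.
    linear_combination (norm := skip) -E * (A + 4 * Complex.I * m1b ^ 2
      - 2 * Complex.I * (nZb + wZb * m1b)) * (t * bc - s * ac) * (E * E' + 1) * hE
    ring_nf
    simp only [Complex.I_sq]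
    ring
  · ext v
    have s3 := DFunLike.congr_fun s2 v
    have hr : (starRingEnd ℂ) (F.hess11bar θ f x) = F.hess1bar1 θ f x :=
      hF.conj_hess11bar hθ hU hx hu
    have hr' : (starRingEnd ℂ) (F.hess1bar1 θ f x) = F.hess11bar θ f x := by
      rw [← hr, Complex.conj_conj]
    simp only [add_apply, smul_apply, conjForm_apply, complexForm_apply, zero_apply, smul_eq_mul,
      map_add, map_mul, map_neg, Complex.conj_conj, LocalFrame.gradForm, hconj, hconj', hr',
      Complex.conj_I, Complex.conj_ofReal, map_ofNat] at s3 ⊢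
    linear_combination s3 - Complex.I * (θ x v : ℂ) * hr

/-- The conformal transformation of the Webster curvature,
`W̃ = e^{-2u} (W - 4 Δ_b u - 8 |u_{,1}|²)`. -/
lemma curv_eq (h : IsInducedFrame u θ U F F') (hF : F.IsAdmissibleOn C θ U)
    (hu : FnSmoothOn u U) (hθ : θ.SmoothOn U) (hU : IsOpen U) (hx : x ∈ U) :
    F'.curv (conformal u θ) x = Real.exp (-u x) ^ 2 * (F.curv θ x
      - 4 * (F.hess11bar θ (fun y => (u y : ℂ)) x + F.hess1bar1 θ (fun y => (u y : ℂ)) x)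
      - 8 * (along F.Z (fun y => (u y : ℂ)) x * along F.Zbar (fun y => (u y : ℂ)) x)) := by
  have hf := hu.ofReal
  have h1 := hF.along_Z_smooth hθ hF.θ1_smooth hU hf
  have h2 := hF.along_Zbar_smooth hθ hF.θ1_smooth hU hf
  have hK := (FnSmoothOn.const Complex.I).mul ((hF.hess_sum_smooth hθ hU hf).add
    ((FnSmoothOn.const (8 : ℂ)).mul (h1.mul h2)))
  have s1 := hF.ω_smooth hθ hU
  have s2 := OneForm.SmoothOn.smul (FnSmoothOn.const (3 : ℂ)) (hF.gradForm_smooth hθ hU hf)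
  have s3 := OneForm.SmoothOn.smul hK hθ.complexForm
  have e0 : F'.curv (conformal u θ) x = (F'.ω (conformal u θ)).dZZbar F' x := rfl
  have e1 : F.curv θ x = (F.ω θ).dZZbar F x := rfl
  rw [e0, e1, h.dZZbar hF.toIsDualOn hx, OneForm.dZZbar_congr hU hx fun y hy =>
    (h.isAdmissibleOn hF hu hθ hU).ω_eq (conformal_smooth hu hθ) hU hy
      (h.structureEq hF hu hθ hU hy),
    OneForm.dZZbar_add s1 (s2.add s3) hU hx, OneForm.dZZbar_add s2 s3 hU hx,
    OneForm.dZZbar_smul (FnSmoothOn.const (3 : ℂ)) (hF.gradForm_smooth hθ hU hf) hU hx,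
    along_const, along_const, hF.dZZbar_gradForm hθ hU hx hf,
    hF.dZZbar_smul_contactForm hθ hU hx hK]
  linear_combination (Real.exp (-u x) : ℂ) ^ 2 * (F.hess11bar θ (fun y => (u y : ℂ)) x
    + F.hess1bar1 θ (fun y => (u y : ℂ)) x + 8 * (along F.Z (fun y => (u y : ℂ)) x
      * along F.Zbar (fun y => (u y : ℂ)) x)) * Complex.I_mul_I

/-- The conformal transformation of the torsion,
`Ã₁₁ = e^{-2u} (A₁₁ + 2i u_{,11} - 4i (u_{,1})²)`. -/
lemma A11_eq (h : IsInducedFrame u θ U F F') (hF : F.IsAdmissibleOn C θ U)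
    (hu : FnSmoothOn u U) (hθ : θ.SmoothOn U) (hU : IsOpen U) (hx : x ∈ U) :
    F'.A11 (conformal u θ) x = Real.exp (-u x) ^ 2 * (F.A11 θ x
      + 2 * Complex.I * F.hess11 θ (fun y => (u y : ℂ)) x
      - 4 * Complex.I * along F.Z (fun y => (u y : ℂ)) x ^ 2) := by
  have hf := hu.ofReal
  have h2 := hF.along_Zbar_smooth hθ hF.θ1_smooth hU hf
  have hc1 : (starRingEnd ℂ) (along F.Zbar (fun y => (u y : ℂ)) x)
      = along F.Z (fun y => (u y : ℂ)) x := by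
    rw [along_Zbar_real hu hU hx, Complex.conj_conj]
  have hc2 : (starRingEnd ℂ) (along F.Zbar (along F.Zbar (fun y => (u y : ℂ))) x)
      = along F.Z (along F.Z (fun y => (u y : ℂ))) x := by
    rw [← along_conj_Z h2 hU hx]
    refine along_congr hU hx fun y hy => ?_
    rw [along_Zbar_real hu hU hy, Complex.conj_conj]
  have hc3 : (starRingEnd ℂ) (evalC (F.ω θ x) (F.Zbar x)) = -evalC (F.ω θ x) (F.Z x) := by
    rw [← evalC_conjForm_Z, hF.conj_ω hθ hU hx]
    simp [evalC]
    ring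
  rw [LocalFrame.A11, (h.isAdmissibleOn hF hu hθ hU).Abar_eq (conformal_smooth hu hθ) hU hx
    (h.structureEq hF hu hθ hU hx)]
  simp only [map_mul, map_add, map_sub, map_pow, Complex.conj_ofReal, Complex.conj_I, map_ofNat,
    hc1, hc2, hc3, LocalFrame.A11, LocalFrame.hess11]
  ring

end IsInducedFrame

/-! ### Composition of conformal changes -/

lemma conformal_conformal (u₀ u₁ : M → ℝ) (θ : OneForm M ℝ) :
    conformal (fun y => u₁ y - u₀ y) (conformal u₀ θ) = conformal u₁ θ := by
  funext x
  ext v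
  rw [conformal_apply, conformal_apply, conformal_apply, ← mul_assoc, ← mul_pow, ← Real.exp_add,
    sub_add_cancel]

/-- If two frames are induced from the same frame, the second is induced from the first. -/
lemma IsInducedFrame.sub {F₀ F₁ : LocalFrame M} {u₀ u₁ : M → ℝ}
    (h₀ : IsInducedFrame u₀ θ U F F₀) (h₁ : IsInducedFrame u₁ θ U F F₁)
    (hF : F.IsDualOn θ U) (hu₀ : FnSmoothOn u₀ U) (hu₁ : FnSmoothOn u₁ U) (hU : IsOpen U) :
    IsInducedFrame (fun y => u₁ y - u₀ y) (conformal u₀ θ) U F₀ F₁ where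
  dual := by
    rw [conformal_conformal]
    exact h₁.dual
  θ1_eq x hx := by
    have hd : along F.Zbar (fun y => ((u₁ y - u₀ y : ℝ) : ℂ)) x
        = along F.Zbar (fun y => (u₁ y : ℂ)) x - along F.Zbar (fun y => (u₀ y : ℂ)) x := by
      have e : ∀ v, dForm (fun y => ((u₁ y - u₀ y : ℝ) : ℂ)) x v
          = dForm (fun y => (u₁ y : ℂ)) x v - dForm (fun y => (u₀ y : ℂ)) x v := by
        intro v
        have e1 := dForm_add (hu₁.sub hu₀).ofReal hu₀.ofReal hU hx v
        have e2 : (fun y => ((u₁ y - u₀ y : ℝ) : ℂ) + (u₀ y : ℂ)) = fun y => (u₁ y : ℂ) := by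
          funext y
          push_cast
          ring
        rw [e2] at e1
        rw [e1]
        ring
      simp only [along_eq, evalC, e]
      ring
    have hE : (Real.exp (u₁ x) : ℂ) = Real.exp (u₁ x - u₀ x) * Real.exp (u₀ x) := by
      rw [← Complex.ofReal_mul, ← Real.exp_add, sub_add_cancel]
    have hE' : (Real.exp (u₀ x) : ℂ) * Real.exp (-u₀ x) = 1 := by
      rw [← Complex.ofReal_mul, ← Real.exp_add, add_neg_cancel, Real.exp_zero, Complex.ofReal_one]
    ext v
    rw [h₁.θ1_eq x hx, inducedθ1_apply, inducedθ1_apply, h₀.θ1_eq x hx, inducedθ1_apply,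
      along_eq F₀.Zbar, h₀.evalC_Zbar hF hx, ← along_eq, hd, conformal_apply, hE]
    push_cast
    push_cast at hE'
    linear_combination -(Complex.exp (u₁ x - u₀ x) * Complex.exp (u₀ x) * 2 * Complex.I
      * (along F.Zbar (fun y => (u₁ y : ℂ)) x - along F.Zbar (fun y => (u₀ y : ℂ)) x)
      * (θ x v : ℂ)) * hE'

end Conformal

section Existence

variable {M : Type*} [TopologicalSpace M] [ChartedSpace (EuclideanSpace ℝ (Fin 3)) M]
  [IsManifold (𝓡 3) ∞ M] {C : CRStructure M} {θ : OneForm M ℝ} {U : Set M} {x : M}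

/-! ### Existence of admissible frames -/

/-- The 1-form `v ↦ dα(v, X)`. -/
def OneForm.contractRight (α : OneForm M ℝ) (X : (x : M) → TangentSpace (𝓡 3) x) :
    OneForm M ℝ := fun x =>
  let D := fderiv ℝ (α.inChart x) (extChartAt (𝓡 3) x x)
  (D.flip (chartD x x (X x)) - D (chartD x x (X x))).comp (chartD x x)

lemma OneForm.contractRight_apply (α : OneForm M ℝ) (X : (x : M) → TangentSpace (𝓡 3) x)
    (v : TangentSpace (𝓡 3) x) : α.contractRight X x v = α.d x v (X x) := rfl

lemma OneForm.SmoothOn.contractRight {α : OneForm M ℝ} (hα : α.SmoothOn U) (hU : IsOpen U)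
    {X : (x : M) → TangentSpace (𝓡 3) x} (hX : VecSmoothOn X U) :
    (α.contractRight X).SmoothOn U := by
  intro x₀
  have hd : ContDiffOn ℝ ∞ (fderiv ℝ (α.inChart x₀)) (chartSet x₀ U) :=
    (hα x₀).fderiv_of_isOpen (isOpen_chartSet x₀ hU) (by simp)
  have hf : ContDiffOn ℝ ∞ (fun y => (fderiv ℝ (α.inChart x₀) y).flip) (chartSet x₀ U) :=
    contDiffOn_clm_apply.2 fun v => contDiffOn_clm_apply.2 fun w =>
      (hd.clm_apply contDiffOn_const).clm_apply contDiffOn_const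
  refine ((hf.clm_apply (hX x₀)).sub (hd.clm_apply (hX x₀))).congr fun y hy => ?_
  ext u
  rw [OneForm.inChart_apply', OneForm.contractRight_apply,
    OneForm.d_eq hα hU hy.2 ((extChartAt (𝓡 3) x₀).map_target hy.1),
    (extChartAt (𝓡 3) x₀).right_inv hy.1, chartD_comp_chartDSymm hy.1]
  rfl

lemma chartD_bijective {x₀ x : M} (hx : x ∈ (extChartAt (𝓡 3) x₀).source) :
    Function.Bijective (chartD x₀ x) := by
  refine ⟨chartD_injective hx, fun u => ?_⟩
  obtain ⟨y, hy, rfl⟩ : ∃ y ∈ (extChartAt (𝓡 3) x₀).target, (extChartAt (𝓡 3) x₀).symm y = x :=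
    ⟨_, (extChartAt (𝓡 3) x₀).map_source hx, (extChartAt (𝓡 3) x₀).left_inv hx⟩
  exact ⟨_, chartD_comp_chartDSymm hy u⟩

/-- Every tangent vector extends to a vector field that is smooth on a chart domain. -/
lemma exists_vecSmoothOn_extension (x : M) (v : TangentSpace (𝓡 3) x) :
    ∃ X : (y : M) → TangentSpace (𝓡 3) y,
      VecSmoothOn X (extChartAt (𝓡 3) x).source ∧ X x = v := by
  have ho := isOpen_extChartAt_source (I := 𝓡 3) x
  have hxs := mem_extChartAt_source (I := 𝓡 3) x
  have hφ : FnSmoothOn (extChartAt (𝓡 3) x) (extChartAt (𝓡 3) x).source := by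
    rw [← contMDiffOn_iff_fnSmoothOn ho, extChartAt_source]
    exact contMDiffOn_extChartAt
  have hX : ∀ y ∈ (extChartAt (𝓡 3) x).source,
      dForm (extChartAt (𝓡 3) x) y (Function.invFun (chartD x y) (chartD x x v))
        = chartD x x v := fun y hy =>
    Function.invFun_eq ((chartD_bijective hy).2 _)
  refine ⟨fun y => Function.invFun (chartD x y) (chartD x x v),
    (hφ.dForm ho).inverse_apply hX fun y hy => chartD_bijective hy, ?_⟩
  exact chartD_injective hxs (hX x hxs)

lemma IsContactForm.exists_apply_ne_zero (hθ : IsContactForm C θ) (x : M) :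
    ∃ u : TangentSpace (𝓡 3) x, θ x u ≠ 0 := by
  obtain ⟨u, v, w, h⟩ := hθ.contact x
  by_contra! h0
  simp [h0] at h

/-- A section of `ξ` that is smooth near `x` and does not vanish at `x`. -/
lemma IsContactForm.exists_section (hθ : IsContactForm C θ) (x : M) :
    ∃ V : (y : M) → C.ξ y, V x ≠ 0 ∧
      VecSmoothOn (fun y => (V y : TangentSpace (𝓡 3) y)) (extChartAt (𝓡 3) x).source := by
  obtain ⟨u, hu⟩ := hθ.exists_apply_ne_zero x
  obtain ⟨w, hw, hw0⟩ : ∃ w : TangentSpace (𝓡 3) x, θ x w = 0 ∧ w ≠ 0 := by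
    by_contra! h0
    have hinj : Function.Injective (θ x : TangentSpace (𝓡 3) x →ₗ[ℝ] ℝ) :=
      (injective_iff_map_eq_zero _).2 h0
    have h1 := LinearMap.finrank_le_finrank_of_injective hinj
    have h2 : Module.finrank ℝ (TangentSpace (𝓡 3) x) = 3 :=
      finrank_euclideanSpace_fin (𝕜 := ℝ) (n := 3)
    rw [h2, Module.finrank_self] at h1
    omega
  -- Extend `u` and `w ∈ ξ` to vector fields `A`, `B`; the field `θ(A) B - θ(B) A` lies in `ξ`.
  obtain ⟨A, hA, hAx⟩ := exists_vecSmoothOn_extension x u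
  obtain ⟨B, hB, hBx⟩ := exists_vecSmoothOn_extension x w
  have hθs := hθ.smooth.mono (subset_univ (extChartAt (𝓡 3) x).source)
  refine ⟨fun y => ⟨θ y (A y) • B y - θ y (B y) • A y, (hθ.mem_ker y _).2 ?_⟩, ?_, ?_⟩
  · rw [map_sub, map_smul, map_smul, smul_eq_mul, smul_eq_mul, mul_comm, sub_self]
  · intro h
    have h1 := congrArg Subtype.val h
    simp only [hAx, hBx, hw, zero_smul, sub_zero] at h1
    exact (smul_ne_zero hu hw0) h1
  · exact (VecSmoothOn.smul (hθs.apply hA) hB).sub (VecSmoothOn.smul (hθs.apply hB) hA)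

/-- Near every point there is an admissible frame: with a nonvanishing section `V` of `ξ`, take
`Z₁ = (V - iJV) / √(2 dθ(V, JV))` and `θ¹ = -i dθ(·, Z₁̄)`. -/
lemma IsPositivePseudohermitian.exists_frame (hθ : IsPositivePseudohermitian C θ) (x : M) :
    ∃ (U : Set M) (F : LocalFrame M), IsOpen U ∧ x ∈ U ∧ F.IsAdmissibleOn C θ U := by
  obtain ⟨V, hVx, hV⟩ := hθ.exists_section x
  set S := (extChartAt (𝓡 3) x).source
  have ho : IsOpen S := isOpen_extChartAt_source x
  have hθS := hθ.smooth.mono (subset_univ S)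
  have hJV : VecSmoothOn (fun y => (C.J y (V y) : TangentSpace (𝓡 3) y)) S :=
    (contMDiffOn_iff_vecSmoothOn ho).1
      (C.J_smooth S V ho ((contMDiffOn_iff_vecSmoothOn ho).2 hV))
  set h : M → ℝ := fun y => θ.d y (V y) (C.J y (V y)) with hh
  have hs : FnSmoothOn h S := hθS.d_apply ho hV hJV
  have hU : IsOpen (S ∩ h ⁻¹' Ioi 0) :=
    ((contMDiffOn_iff_fnSmoothOn ho).2 hs).continuousOn.isOpen_inter_preimage ho isOpen_Ioi
  set U := S ∩ h ⁻¹' Ioi 0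
  have hxU : x ∈ U := ⟨mem_extChartAt_source x, hθ.pos x (V x) hVx⟩
  set c : M → ℝ := fun y => (√(2 * h y))⁻¹ with hc
  have hcs : FnSmoothOn c U := (hs.mono inter_subset_left).comp (φ := fun r => (√(2 * r))⁻¹)
    fun y hy => ((contDiffAt_const.mul contDiffAt_id).sqrt
      (mul_pos two_pos hy.2).ne').inv (Real.sqrt_pos.2 (mul_pos two_pos hy.2)).ne'
  have hc2 : ∀ y ∈ U, c y * c y * h y = 1 / 2 := by
    intro y hy
    have h1 : 0 < 2 * h y := mul_pos two_pos hy.2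
    have h2 := Real.mul_self_sqrt h1.le
    have h3 : √(2 * h y) ≠ 0 := (Real.sqrt_pos.2 h1).ne'
    simp only [hc]
    field_simp
    nlinarith
  let X : (y : M) → C.ξ y := fun y => c y • V y
  let Y : (y : M) → C.ξ y := fun y => -(c y • C.J y (V y))
  have hX : VecSmoothOn (fun y => (X y : TangentSpace (𝓡 3) y)) U :=
    VecSmoothOn.smul hcs (hV.mono inter_subset_left)
  have hY : VecSmoothOn (fun y => (Y y : TangentSpace (𝓡 3) y)) U := by
    have h1 : FnSmoothOn (fun y => -c y) U := hcs.neg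
    refine (VecSmoothOn.smul h1 (hJV.mono inter_subset_left)).congr fun y _ => ?_
    simp [Y]
  have hXY : ∀ y ∈ U, θ.d y (X y) (Y y) = -(1 / 2) := by
    intro y hy
    have e : (Y y : TangentSpace (𝓡 3) y) = (-c y) • (C.J y (V y) : TangentSpace (𝓡 3) y) := by
      simp [Y]
    rw [e]
    change θ.d y (c y • (V y : TangentSpace (𝓡 3) y)) _ = _
    rw [θ.d_smul_left, θ.d_smul_right, smul_eq_mul, smul_eq_mul, ← hc2 y hy]
    ring
  have hθX : ∀ y, θ y (X y) = 0 := fun y => (hθ.mem_ker y _).1 (X y).2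
  have hθY : ∀ y, θ y (Y y) = 0 := fun y => (hθ.mem_ker y _).1 (Y y).2
  -- Correct a vector `v` with `θ(v) = 1` by a section of `ξ` so that `dθ(T, ·)` vanishes on `ξ`.
  have hT : ∀ y, ∃ T : TangentSpace (𝓡 3) y,
      y ∈ U → θ y T = 1 ∧ θ.d y T (X y) = 0 ∧ θ.d y T (Y y) = 0 := by
    intro y
    obtain ⟨u, hu⟩ := hθ.exists_apply_ne_zero y
    obtain ⟨v, hv⟩ : ∃ v : TangentSpace (𝓡 3) y, θ y v = 1 :=
      ⟨(θ y u)⁻¹ • u, by rw [map_smul, smul_eq_mul, inv_mul_cancel₀ hu]⟩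
    refine ⟨v + (2 * θ.d y v (Y y)) • (X y : TangentSpace (𝓡 3) y)
      + (-2 * θ.d y v (X y)) • (Y y : TangentSpace (𝓡 3) y), fun hy => ⟨?_, ?_, ?_⟩⟩
    · rw [map_add, map_add, map_smul, map_smul, hθX, hθY, hv]
      simp
    · rw [θ.d_add_left, θ.d_add_left, θ.d_smul_left, θ.d_smul_left, θ.d_self,
        θ.d_antisymm (Y y : TangentSpace (𝓡 3) y), hXY y hy, smul_eq_mul, smul_eq_mul]
      ring
    · rw [θ.d_add_left, θ.d_add_left, θ.d_smul_left, θ.d_smul_left, θ.d_self,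
        hXY y hy, smul_eq_mul, smul_eq_mul]
      ring
  choose T hT using hT
  let F : LocalFrame M := ⟨T, fun y => (X y, Y y), fun y =>
    (-1 : ℂ) • complexForm (θ.contractRight (fun y => (Y y : TangentSpace (𝓡 3) y)) y)
    + (-Complex.I) • complexForm (θ.contractRight (fun y => (X y : TangentSpace (𝓡 3) y)) y)⟩
  have hθ1 : ∀ y (v : TangentSpace (𝓡 3) y),
      F.θ1 y v = -(θ.d y v (Y y) : ℂ) - Complex.I * (θ.d y v (X y) : ℂ) := by
    intro y v
    change (-1 : ℂ) * (θ.d y v (Y y) : ℂ) + (-Complex.I) * (θ.d y v (X y) : ℂ) = _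
    ring
  have hd : F.IsDualOn θ U :=
    { θ_T := fun y hy => (hT y hy).1
      θ_Z := fun y hy => by
        change ((θ y (X y) : ℝ) : ℂ) + Complex.I * ((θ y (Y y) : ℝ) : ℂ) = 0
        rw [hθX, hθY]
        simp
      θ1_T := fun y hy => by
        rw [hθ1, (hT y hy).2.1, (hT y hy).2.2]
        simp
      θ1_Z := fun y hy => by
        change F.θ1 y (X y) + Complex.I * F.θ1 y (Y y) = 1
        rw [hθ1, hθ1, θ.d_self, θ.d_self, θ.d_antisymm (Y y : TangentSpace (𝓡 3) y), hXY y hy]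
        push_cast
        linear_combination -(1 / 2 : ℂ) * Complex.I_mul_I
      θ1_Zbar := fun y hy => by
        rw [evalC_Zbar]
        change F.θ1 y (X y) - Complex.I * F.θ1 y (Y y) = 0
        rw [hθ1, hθ1, θ.d_self, θ.d_self, θ.d_antisymm (Y y : TangentSpace (𝓡 3) y), hXY y hy]
        push_cast
        linear_combination (1 / 2 : ℂ) * Complex.I_mul_I }
  have hθU := hθ.smooth.mono (subset_univ U)
  have hlevi : ∀ y ∈ U, ∀ v w : TangentSpace (𝓡 3) y,
      (θ.d y v w : ℂ) = Complex.I * wedge (F.θ1 y) (conjForm (F.θ1 y)) v w := by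
    intro y hy v w
    have e := hd.d_expand hy (fun z => complexForm (θ z)) v w
    rw [OneForm.dZZbar_eq, OneForm.dTZ, OneForm.dTZbar] at e
    simp only [OneForm.d_complexForm hθU hU hy] at e
    have e1 : θ.d y (F.Z y).1 (F.Z y).2 = -(1 / 2) := hXY y hy
    have e2 : θ.d y (F.T y) (F.Z y).1 = 0 := (hT y hy).2.1
    have e3 : θ.d y (F.T y) (F.Z y).2 = 0 := (hT y hy).2.2
    rw [e, e1, e2, e3]
    push_cast
    ring
  refine ⟨U, F, hU, hxU, ⟨hd, ?_, ?_, ?_, hlevi⟩⟩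
  · exact (OneForm.SmoothOn.smul (FnSmoothOn.const (-1 : ℂ))
      (hθU.contractRight hU hY).complexForm).add
      (OneForm.SmoothOn.smul (FnSmoothOn.const (-Complex.I))
        (hθU.contractRight hU hX).complexForm)
  · intro y hy v
    have e := hlevi y hy (F.T y) v
    rw [wedge_apply, conjForm_apply, conjForm_apply, hd.θ1_T y hy] at e
    simpa using e
  · intro y _
    refine ⟨X y, Y y, rfl, ?_, ?_⟩
    · simp [X, Y]
    · simp [X, Y, C.J_sq]

/-- Every admissible frame induces a frame of the contact form `e^{2u} θ`. -/
lemma LocalFrame.IsDualOn.exists_induced {F : LocalFrame M} (hF : F.IsDualOn θ U) (u : M → ℝ) :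
    ∃ F' : LocalFrame M, IsInducedFrame u θ U F F' := by
  have key : ∀ x, ∃ (T X Y : TangentSpace (𝓡 3) x), x ∈ U →
      conformal u θ x T = 1 ∧ inducedθ1 u θ F x T = 0 ∧
      conformal u θ x X = 0 ∧ inducedθ1 u θ F x X = 1 / 2 ∧
      conformal u θ x Y = 0 ∧ inducedθ1 u θ F x Y = -Complex.I / 2 := by
    intro x
    by_cases hx : x ∈ U
    swap
    · exact ⟨0, 0, 0, fun h => absurd h hx⟩
    have he : Real.exp (u x) * Real.exp (-u x) = 1 := by
      rw [← Real.exp_add, add_neg_cancel, Real.exp_zero]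
    have heC : (Real.exp (u x) : ℂ) * Real.exp (-u x) = 1 := by
      rw [← Complex.ofReal_mul, he, Complex.ofReal_one]
    obtain ⟨T, hT⟩ := (hF.coframe_bijective hx).2 (Real.exp (-u x) ^ 2,
      -(2 * Complex.I * along F.Zbar (fun y => (u y : ℂ)) x) * Real.exp (-u x) ^ 2)
    rw [coframe_apply, Prod.mk.injEq] at hT
    refine ⟨T, Real.exp (-u x) • (F.Z x).1, Real.exp (-u x) • (F.Z x).2, fun _ =>
      ⟨?_, ?_, ?_, ?_, ?_, ?_⟩⟩
    · rw [conformal_apply, hT.1, ← mul_pow, he, one_pow]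
    · rw [inducedθ1_apply, hT.1, hT.2]
      push_cast
      ring
    · rw [map_smul, conformal_apply, (hF.θ_re_im hx).1, mul_zero, smul_zero]
    · rw [map_smul, inducedθ1_apply, (hF.θ_re_im hx).1, hF.θ1_re hx, Complex.real_smul,
        Complex.ofReal_zero]
      linear_combination (1 / 2 : ℂ) * heC
    · rw [map_smul, conformal_apply, (hF.θ_re_im hx).2, mul_zero, smul_zero]
    · rw [map_smul, inducedθ1_apply, (hF.θ_re_im hx).2, hF.θ1_im hx, Complex.real_smul,
        Complex.ofReal_zero]
      linear_combination (-Complex.I / 2 : ℂ) * heC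
  choose T X Y h using key
  refine ⟨⟨T, fun x => (X x, Y x), inducedθ1 u θ F⟩, ⟨fun x hx => (h x hx).1, fun x hx => ?_,
    fun x hx => (h x hx).2.1, fun x hx => ?_, fun x hx => ?_⟩, fun _ _ => rfl⟩
  · change ((conformal u θ x (X x) : ℝ) : ℂ) + Complex.I * ((conformal u θ x (Y x) : ℝ) : ℂ) = 0
    rw [(h x hx).2.2.1, (h x hx).2.2.2.2.1]
    simp
  · change inducedθ1 u θ F x (X x) + Complex.I * inducedθ1 u θ F x (Y x) = 1
    rw [(h x hx).2.2.2.1, (h x hx).2.2.2.2.2]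
    linear_combination -(1 / 2 : ℂ) * Complex.I_mul_I
  · rw [evalC_Zbar]
    change inducedθ1 u θ F x (X x) - Complex.I * inducedθ1 u θ F x (Y x) = 0
    rw [(h x hx).2.2.2.1, (h x hx).2.2.2.2.2]
    linear_combination (1 / 2 : ℂ) * Complex.I_mul_I

end Existence

/-! ### Time-dependent functions on Euclidean space -/

section Interval

variable {I : Set ℝ}

lemma interior_nonempty_of_ordConnected (hI : I.OrdConnected) (hI' : I.Nontrivial) :
    (interior I).Nonempty := by
  obtain ⟨a, ha, b, hb, hab⟩ := hI'.exists_lt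
  obtain ⟨c, hc⟩ := exists_between hab
  exact ⟨c, interior_maximal (Ioo_subset_Icc_self.trans (hI.out ha hb)) isOpen_Ioo hc⟩

lemma uniqueDiffOn_of_ordConnected (hI : I.OrdConnected) (hI' : I.Nontrivial) :
    UniqueDiffOn ℝ I :=
  uniqueDiffOn_convex hI.convex (interior_nonempty_of_ordConnected hI hI')

lemma subset_closure_interior_of_ordConnected (hI : I.OrdConnected) (hI' : I.Nontrivial) :
    I ⊆ closure (interior I) := by
  have hc : Convex ℝ I := hI.convex
  rw [hc.closure_interior_eq_closure_of_nonempty_interior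
    (interior_nonempty_of_ordConnected hI hI')]
  exact subset_closure

variable {E F : Type*} [NormedAddCommGroup E] [NormedSpace ℝ E] [NormedAddCommGroup F]
  [NormedSpace ℝ F] {Ω : Set E} {f : ℝ × E → F} {t : ℝ} {y : E}

lemma hasDerivWithinAt_slice (hf : DifferentiableOn ℝ f (I ×ˢ Ω)) (ht : t ∈ I) (hy : y ∈ Ω) :
    HasDerivWithinAt (fun s => f (s, y)) (fderivWithin ℝ f (I ×ˢ Ω) (t, y) (1, 0)) I t :=
  (hf (t, y) ⟨ht, hy⟩).hasFDerivWithinAt.comp_hasDerivWithinAt (f := fun s => (s, y)) t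
    ((hasDerivWithinAt_id t I).prodMk (hasDerivWithinAt_const t I y))
    (fun _ hs => mk_mem_prod hs hy)

lemma hasFDerivAt_slice (hΩ : IsOpen Ω) (hf : DifferentiableOn ℝ f (I ×ˢ Ω)) (ht : t ∈ I)
    (hy : y ∈ Ω) : HasFDerivAt (fun z => f (t, z))
      ((fderivWithin ℝ f (I ×ˢ Ω) (t, y)).comp (ContinuousLinearMap.inr ℝ ℝ E)) y :=
  ((hf (t, y) ⟨ht, hy⟩).hasFDerivWithinAt.comp y (hasFDerivAt_prodMk_right t y).hasFDerivWithinAt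
    fun _ hz => ⟨ht, hz⟩).hasFDerivAt (hΩ.mem_nhds hy)

/-- Time and space derivatives commute, also at the end points of the time interval. -/
lemma hasDerivWithinAt_fderiv_slice (hI : I.OrdConnected) (hI' : I.Nontrivial) (hΩ : IsOpen Ω)
    (hf : ContDiffOn ℝ ∞ f (I ×ˢ Ω)) (ht : t ∈ I) (hy : y ∈ Ω) (v : E) :
    HasDerivWithinAt (fun s => fderiv ℝ (fun z => f (s, z)) y v)
      (fderiv ℝ (fun z => derivWithin (fun s => f (s, z)) I t) y v) I t := by
  have hu := uniqueDiffOn_of_ordConnected hI hI'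
  have hS : UniqueDiffOn ℝ (I ×ˢ Ω) := hu.prod hΩ.uniqueDiffOn
  have hd := hf.differentiableOn (by simp)
  have hd' := (hf.fderivWithin hS (m := ∞) (by simp)).differentiableOn (by simp)
  have hsymm : IsSymmSndFDerivWithinAt ℝ f (I ×ˢ Ω) (t, y) :=
    (hf (t, y) ⟨ht, hy⟩).isSymmSndFDerivWithinAt two_le_smooth hS
      (by
        rw [interior_prod_eq, closure_prod_eq, hΩ.interior_eq]
        exact ⟨subset_closure_interior_of_ordConnected hI hI' ht, subset_closure hy⟩) ⟨ht, hy⟩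
  have h1 := (hasDerivWithinAt_slice hd' ht hy).clm_apply
    (hasDerivWithinAt_const t I ((0, v) : ℝ × E))
  have h2 := (hasFDerivAt_slice hΩ hd' ht hy).clm_apply
    (hasFDerivAt_const ((1, 0) : ℝ × E) y)
  have h3 : (fun z => derivWithin (fun s => f (s, z)) I t) =ᶠ[nhds y]
      fun z => fderivWithin ℝ f (I ×ˢ Ω) (t, z) (1, 0) := by
    filter_upwards [hΩ.mem_nhds hy] with z hz
    exact (hasDerivWithinAt_slice hd ht hz).derivWithin (hu t ht)
  rw [h3.fderiv_eq, h2.fderiv]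
  have e : ∀ s ∈ I, fderiv ℝ (fun z => f (s, z)) y v
      = fderivWithin ℝ f (I ×ˢ Ω) (s, y) (0, v) := fun s hs => by
    rw [(hasFDerivAt_slice hΩ hd hs hy).fderiv]
    rfl
  refine (h1.congr e (e t ht)).congr_deriv ?_
  have := hsymm (1, 0) (0, v)
  simpa using this

end Interval

/-! ### Time-dependent functions on the manifold -/

section Family

variable {M : Type*} [TopologicalSpace M] [ChartedSpace (EuclideanSpace ℝ (Fin 3)) M]
  {F : Type*} [NormedAddCommGroup F] [NormedSpace ℝ F]
  {I : Set ℝ} {U : Set M} {g : ℝ → M → F} {t : ℝ} {x : M}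

/-- A time-dependent function is smooth on `I × U` if its expressions in all charts of `M` are;
at an end point of `I` this is smoothness up to the boundary. -/
def FamilySmoothOn (g : ℝ → M → F) (I : Set ℝ) (U : Set M) : Prop :=
  ∀ x₀ : M, ContDiffOn ℝ ∞ (fun p : ℝ × 𝔼 => g p.1 ((extChartAt (𝓡 3) x₀).symm p.2))
    (I ×ˢ chartSet x₀ U)

/-- The time derivative of a time-dependent function on `I`, one-sided at the end points. -/
def timeDeriv (g : ℝ → M → F) (I : Set ℝ) (t : ℝ) (x : M) : F := derivWithin (fun s => g s x) I t

lemma FamilySmoothOn.fnSmoothOn (hg : FamilySmoothOn g I U) (ht : t ∈ I) : FnSmoothOn (g t) U :=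
  fun x₀ => (hg x₀).comp (contDiff_prodMk_right t).contDiffOn fun _ hy => ⟨ht, hy⟩

lemma FamilySmoothOn.mono {V : Set M} (hg : FamilySmoothOn g I V) (h : U ⊆ V) :
    FamilySmoothOn g I U := fun x₀ => (hg x₀).mono (prod_mono_right (chartSet_mono x₀ h))

lemma FamilySmoothOn.timeDeriv (hI : I.OrdConnected) (hI' : I.Nontrivial) (hU : IsOpen U)
    (hg : FamilySmoothOn g I U) : FamilySmoothOn (timeDeriv g I) I U := fun x₀ => by
  have hu := uniqueDiffOn_of_ordConnected hI hI'
  have hS := hu.prod (isOpen_chartSet x₀ hU).uniqueDiffOn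
  refine (((hg x₀).fderivWithin hS (m := ∞) (by simp)).clm_apply
    (contDiffOn_const (c := ((1, 0) : ℝ × 𝔼)))).congr fun p hp => ?_
  exact (hasDerivWithinAt_slice ((hg x₀).differentiableOn (by simp)) hp.1 hp.2).derivWithin
    (hu p.1 hp.1)

variable [IsManifold (𝓡 3) ∞ M]

lemma FamilySmoothOn.dForm_apply (hI : I.OrdConnected) (hI' : I.Nontrivial) (hU : IsOpen U)
    (hg : FamilySmoothOn g I U) {X : (x : M) → TangentSpace (𝓡 3) x} (hX : VecSmoothOn X U) :
    FamilySmoothOn (fun s x => dForm (g s) x (X x)) I U := fun x₀ => by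
  have ho := isOpen_chartSet x₀ hU
  have hS := (uniqueDiffOn_of_ordConnected hI hI').prod ho.uniqueDiffOn
  have hX' : ContDiffOn ℝ ∞ (fun p : ℝ × 𝔼 => ((0, chartD x₀ _
      (X ((extChartAt (𝓡 3) x₀).symm p.2))) : ℝ × 𝔼)) (I ×ˢ chartSet x₀ U) :=
    contDiffOn_const.prodMk ((hX x₀).comp contDiff_snd.contDiffOn fun _ hp => hp.2)
  refine (((hg x₀).fderivWithin hS (m := ∞) (by simp)).clm_apply hX').congr fun p hp => ?_
  have h := hasFDerivAt_slice ho ((hg x₀).differentiableOn (by simp)) hp.1 hp.2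
  have e := dForm_eq (hg.fnSmoothOn hp.1) hU hp.2.2
    ((extChartAt (𝓡 3) x₀).map_target hp.2.1) (X ((extChartAt (𝓡 3) x₀).symm p.2))
  rw [(extChartAt (𝓡 3) x₀).right_inv hp.2.1, h.fderiv] at e
  exact e

/-- The differential in space commutes with the time derivative. -/
lemma FamilySmoothOn.hasDerivWithinAt_dForm (hI : I.OrdConnected) (hI' : I.Nontrivial)
    (hU : IsOpen U) (hg : FamilySmoothOn g I U) (ht : t ∈ I) (hx : x ∈ U)
    (v : TangentSpace (𝓡 3) x) :
    HasDerivWithinAt (fun s => dForm (g s) x v) (dForm (CRYamabe.timeDeriv g I t) x v) I t := by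
  have hxs := mem_extChartAt_source (I := 𝓡 3) x
  have h := hasDerivWithinAt_fderiv_slice hI hI' (isOpen_chartSet x hU) (hg x) ht
    (mem_chartSet hx hxs) (chartD x x v)
  rw [dForm_eq ((hg.timeDeriv hI hI' hU).fnSmoothOn ht) hU hx hxs]
  exact h.congr (fun s hs => dForm_eq (hg.fnSmoothOn hs) hU hx hxs v)
    (dForm_eq (hg.fnSmoothOn ht) hU hx hxs v)

variable {f : ℝ → M → ℂ}

lemma FamilySmoothOn.hasDerivWithinAt_along (hI : I.OrdConnected) (hI' : I.Nontrivial)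
    (hU : IsOpen U) (hf : FamilySmoothOn f I U) (ht : t ∈ I) (hx : x ∈ U)
    (Z : (x : M) → ComplexTangent x) :
    HasDerivWithinAt (fun s => along Z (f s) x) (along Z (CRYamabe.timeDeriv f I t) x) I t :=
  (hf.hasDerivWithinAt_dForm hI hI' hU ht hx _).add
    ((hf.hasDerivWithinAt_dForm hI hI' hU ht hx _).const_mul Complex.I)

lemma FamilySmoothOn.along (hI : I.OrdConnected) (hI' : I.Nontrivial) (hU : IsOpen U)
    (hf : FamilySmoothOn f I U) {Z : (x : M) → ComplexTangent x}
    (hX : VecSmoothOn (fun x => (Z x).1) U) (hY : VecSmoothOn (fun x => (Z x).2) U) :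
    FamilySmoothOn (fun s => along Z (f s)) I U := fun x₀ =>
  (hf.dForm_apply hI hI' hU hX x₀).add
    (contDiffOn_const.mul (hf.dForm_apply hI hI' hU hY x₀))

lemma FamilySmoothOn.hasDerivWithinAt_along_along (hI : I.OrdConnected) (hI' : I.Nontrivial)
    (hU : IsOpen U) (hf : FamilySmoothOn f I U) (ht : t ∈ I) (hx : x ∈ U)
    {Z : (x : M) → ComplexTangent x} (hX : VecSmoothOn (fun x => (Z x).1) U)
    (hY : VecSmoothOn (fun x => (Z x).2) U) (Z' : (x : M) → ComplexTangent x) :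
    HasDerivWithinAt (fun s => CRYamabe.along Z' (CRYamabe.along Z (f s)) x)
      (CRYamabe.along Z' (CRYamabe.along Z (CRYamabe.timeDeriv f I t)) x) I t := by
  have h := (hf.along hI hI' hU hX hY).hasDerivWithinAt_along hI hI' hU ht hx Z'
  have e : ∀ y ∈ U, CRYamabe.timeDeriv (fun s => CRYamabe.along Z (f s)) I t y
      = CRYamabe.along Z (CRYamabe.timeDeriv f I t) y := fun y hy =>
    (hf.hasDerivWithinAt_along hI hI' hU ht hy Z).derivWithin
      (uniqueDiffOn_of_ordConnected hI hI' t ht)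
  rwa [along_congr hU hx e] at h

end Family

/-! ### Evolution of curvature and torsion -/

section Evolution

variable {M : Type*} [TopologicalSpace M] [ChartedSpace (EuclideanSpace ℝ (Fin 3)) M]
  [IsManifold (𝓡 3) ∞ M] {C : CRStructure M} {θ : OneForm M ℝ} {I : Set ℝ} {U : Set M}
  {t : ℝ} {x : M} {u : ℝ → M → ℝ} {w : M → ℝ} {F : LocalFrame M} {F' : ℝ → LocalFrame M}

lemma FamilySmoothOn.of_contMDiffOn {u : ℝ → M → ℝ}
    (hu : ContMDiffOn (𝓘(ℝ, ℝ).prod (𝓡 3)) 𝓘(ℝ, ℝ) ∞ (fun p : ℝ × M => u p.1 p.2)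
      (I ×ˢ univ)) : FamilySmoothOn u I univ := by
  intro x₀
  have h1 : ContMDiffOn (𝓘(ℝ, ℝ).prod 𝓘(ℝ, 𝔼)) (𝓘(ℝ, ℝ).prod (𝓡 3)) ∞
      (fun p : ℝ × 𝔼 => (p.1, (extChartAt (𝓡 3) x₀).symm p.2)) (I ×ˢ chartSet x₀ univ) :=
    contMDiff_fst.contMDiffOn.prodMk (((contMDiffOn_extChartAt_symm x₀).mono inter_subset_left).comp
      contMDiff_snd.contMDiffOn fun p hp => hp.2)
  have h2 := hu.comp h1 fun p hp => ⟨hp.1, mem_univ _⟩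
  rw [← modelWithCornersSelf_prod, chartedSpaceSelf_prod] at h2
  exact h2.contDiffOn

lemma FamilySmoothOn.ofReal (hu : FamilySmoothOn u I U) :
    FamilySmoothOn (fun s y => (u s y : ℂ)) I U := fun x₀ =>
  Complex.ofRealCLM.contDiff.comp_contDiffOn (hu x₀)

lemma FamilySmoothOn.sub_const (hu : FamilySmoothOn u I U) (ht : t ∈ I) :
    FamilySmoothOn (fun s y => u s y - u t y) I U := fun x₀ =>
  (hu x₀).sub ((hu.fnSmoothOn ht x₀).comp contDiff_snd.contDiffOn fun _ hp => hp.2)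

/-- The covariant derivatives are odd: `(-f)_{,11} = -f_{,11}`, and so on. -/
lemma LocalFrame.IsAdmissibleOn.hess_neg (hF : F.IsAdmissibleOn C θ U) (hθ : θ.SmoothOn U)
    (hU : IsOpen U) (hx : x ∈ U) {f : M → ℂ} (hf : FnSmoothOn f U) :
    F.hess11 θ (fun y => -f y) x = -F.hess11 θ f x ∧
      F.hess11bar θ (fun y => -f y) x = -F.hess11bar θ f x ∧
      F.hess1bar1 θ (fun y => -f y) x = -F.hess1bar1 θ f x := by
  have h1 : ∀ Z' : (x : M) → ComplexTangent x,
      along Z' (along F.Z fun y => -f y) x = -along Z' (along F.Z f) x := fun Z' => by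
    rw [along_congr hU hx fun y hy => along_neg hf hU hy,
      along_neg (hF.along_Z_smooth hθ hF.θ1_smooth hU hf) hU hx]
  have h2 : ∀ Z' : (x : M) → ComplexTangent x,
      along Z' (along F.Zbar fun y => -f y) x = -along Z' (along F.Zbar f) x := fun Z' => by
    rw [along_congr hU hx fun y hy => along_neg hf hU hy,
      along_neg (hF.along_Zbar_smooth hθ hF.θ1_smooth hU hf) hU hx]
  simp only [LocalFrame.hess11, LocalFrame.hess11bar, LocalFrame.hess1bar1, h1, h2,
    along_neg hf hU hx]
  refine ⟨?_, ?_, ?_⟩ <;> ring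

/-- The derivative of the factor `e^{-2u}` when `u = 0` and `u̇ = c` at time `t`. -/
lemma hasDerivWithinAt_exp_neg_sq {r : ℝ → ℝ} {c : ℝ} (hr : HasDerivWithinAt r c I t)
    (h0 : r t = 0) : HasDerivWithinAt (fun s => (Real.exp (-r s) : ℂ) ^ 2) (-2 * c) I t := by
  refine (hr.neg.exp.ofReal_comp.pow 2).congr_deriv ?_
  simp [h0]

lemma along_family_eq_zero {Z : (x : M) → ComplexTangent x} (hut : ∀ y, u t y = 0) :
    along Z (fun y => (u t y : ℂ)) = fun _ => 0 := by
  have e : (fun y => (u t y : ℂ)) = fun _ => 0 := by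
    funext y
    rw [hut, Complex.ofReal_zero]
  funext y
  rw [e, along_const]

lemma hasDerivWithinAt_along_family (hI : I.OrdConnected) (hI' : I.Nontrivial)
    (hU : IsOpen U) (hu : FamilySmoothOn u I U) (ht : t ∈ I)
    (hw : ∀ y ∈ U, HasDerivWithinAt (fun s => u s y) (w y) I t) (hx : x ∈ U)
    (Z : (x : M) → ComplexTangent x) :
    HasDerivWithinAt (fun s => along Z (fun y => (u s y : ℂ)) x)
      (along Z (fun y => (w y : ℂ)) x) I t := by
  have h := hu.ofReal.hasDerivWithinAt_along hI hI' hU ht hx Z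
  have e : ∀ y ∈ U, timeDeriv (fun s y => (u s y : ℂ)) I t y = w y := fun y hy =>
    (hw y hy).ofReal_comp.derivWithin (uniqueDiffOn_of_ordConnected hI hI' t ht)
  rwa [along_congr hU hx e] at h

lemma hasDerivWithinAt_along_along_family (hI : I.OrdConnected) (hI' : I.Nontrivial)
    (hU : IsOpen U) (hu : FamilySmoothOn u I U) (ht : t ∈ I)
    (hw : ∀ y ∈ U, HasDerivWithinAt (fun s => u s y) (w y) I t) (hx : x ∈ U)
    {Z : (x : M) → ComplexTangent x}
    (hX : VecSmoothOn (fun x => (Z x).1) U) (hY : VecSmoothOn (fun x => (Z x).2) U)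
    (Z' : (x : M) → ComplexTangent x) :
    HasDerivWithinAt (fun s => along Z' (along Z (fun y => (u s y : ℂ))) x)
      (along Z' (along Z (fun y => (w y : ℂ))) x) I t := by
  have h := hu.ofReal.hasDerivWithinAt_along_along hI hI' hU ht hx hX hY Z'
  have e : ∀ y ∈ U, along Z (timeDeriv (fun s y => (u s y : ℂ)) I t) y
      = along Z (fun y => (w y : ℂ)) y := fun y hy =>
    along_congr hU hy fun z hz => (hw z hz).ofReal_comp.derivWithin
      (uniqueDiffOn_of_ordConnected hI hI' t ht)
  rwa [along_congr hU hx e] at h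

/-- The first variation of the curvature of `e^{2u} θ` when `u = 0` and `u̇ = w` at time `t`. -/
lemma hasDerivWithinAt_curv (hI : I.OrdConnected) (hI' : I.Nontrivial) (hU : IsOpen U)
    (hu : FamilySmoothOn u I U) (hθ : θ.SmoothOn U) (hF : F.IsAdmissibleOn C θ U)
    (hF' : ∀ s ∈ I, IsInducedFrame (u s) θ U F (F' s)) (ht : t ∈ I) (hut : ∀ y, u t y = 0)
    (hw : ∀ y ∈ U, HasDerivWithinAt (fun s => u s y) (w y) I t) (hx : x ∈ U) :
    HasDerivWithinAt (fun s => (F' s).curv (conformal (u s) θ) x)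
      (-2 * w x * F.curv θ x - 4 * (F.hess11bar θ (fun y => (w y : ℂ)) x
        + F.hess1bar1 θ (fun y => (w y : ℂ)) x)) I t := by
  have hX := hF.smooth_re hθ hF.θ1_smooth
  have hY := hF.smooth_im hθ hF.θ1_smooth
  have hE := hasDerivWithinAt_exp_neg_sq (hw x hx) (hut x)
  have hZ := hasDerivWithinAt_along_family hI hI' hU hu ht hw hx F.Z
  have hZb := hasDerivWithinAt_along_family hI hI' hU hu ht hw hx F.Zbar
  have h1 := (hasDerivWithinAt_along_along_family hI hI' hU hu ht hw hx hX hY F.Zbar).sub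
    (hZ.const_mul (evalC (F.ω θ x) (F.Zbar x)))
  have h2 := (hasDerivWithinAt_along_along_family hI hI' hU hu ht hw hx (Z := F.Zbar) hX
    (by simpa [LocalFrame.Zbar, conjVec] using VecSmoothOn.smul (FnSmoothOn.const (-1 : ℝ)) hY)
    F.Z).sub (hZb.const_mul (evalC (conjForm (F.ω θ x)) (F.Z x)))
  have key := hE.mul ((((h1.add h2).const_mul 4).const_sub (F.curv θ x)).sub
    ((hZ.mul hZb).const_mul 8))
  have e : ∀ s ∈ I, _ := fun s hs => (hF' s hs).curv_eq hF (hu.fnSmoothOn hs) hθ hU hx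
  refine (key.congr e (e t ht)).congr_deriv ?_
  have e0 := along_family_eq_zero (Z := F.Z) hut
  have e1 := along_family_eq_zero (Z := F.Zbar) hut
  simp only [LocalFrame.hess11bar, LocalFrame.hess1bar1, Pi.sub_apply, Pi.add_apply, Pi.mul_apply, e0,
    e1, along_const]
  rw [hut, neg_zero, Real.exp_zero, Complex.ofReal_one]
  ring

/-- The first variation of the torsion of `e^{2u} θ` when `u = 0` and `u̇ = w` at time `t`. -/
lemma hasDerivWithinAt_A11 (hI : I.OrdConnected) (hI' : I.Nontrivial) (hU : IsOpen U)
    (hu : FamilySmoothOn u I U) (hθ : θ.SmoothOn U) (hF : F.IsAdmissibleOn C θ U)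
    (hF' : ∀ s ∈ I, IsInducedFrame (u s) θ U F (F' s)) (ht : t ∈ I) (hut : ∀ y, u t y = 0)
    (hw : ∀ y ∈ U, HasDerivWithinAt (fun s => u s y) (w y) I t) (hx : x ∈ U) :
    HasDerivWithinAt (fun s => (F' s).A11 (conformal (u s) θ) x)
      (-2 * w x * F.A11 θ x + 2 * Complex.I * F.hess11 θ (fun y => (w y : ℂ)) x) I t := by
  have hX := hF.smooth_re hθ hF.θ1_smooth
  have hY := hF.smooth_im hθ hF.θ1_smooth
  have hE := hasDerivWithinAt_exp_neg_sq (hw x hx) (hut x)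
  have hZ := hasDerivWithinAt_along_family hI hI' hU hu ht hw hx F.Z
  have h1 := (hasDerivWithinAt_along_along_family hI hI' hU hu ht hw hx hX hY F.Z).sub
    (hZ.const_mul (evalC (F.ω θ x) (F.Z x)))
  have key := hE.mul (((h1.const_mul (2 * Complex.I)).const_add (F.A11 θ x)).sub
    ((hZ.pow 2).const_mul (4 * Complex.I)))
  have e : ∀ s ∈ I, _ := fun s hs => (hF' s hs).A11_eq hF (hu.fnSmoothOn hs) hθ hU hx
  refine (key.congr e (e t ht)).congr_deriv ?_
  have e0 := along_family_eq_zero (Z := F.Z) hut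
  simp only [LocalFrame.hess11, Pi.sub_apply, Pi.pow_apply, e0, along_const]
  rw [hut, neg_zero, Real.exp_zero, Complex.ofReal_one]
  ring

/-! ### The Yamabe flow -/

variable {lam : ℝ → M → ℝ} {θhat : OneForm M ℝ} {θs : ℝ → OneForm M ℝ}

/-- Along the Yamabe flow the conformal factor satisfies `λ̇ = -W`. -/
lemma IsYamabeFlow.hasDerivWithinAt_conformalFactor (hflow : IsYamabeFlow C I θs)
    (hθhat : IsContactForm C θhat) (hθ : ∀ t ∈ I, θs t = conformal (lam t) θhat) (ht : t ∈ I)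
    (x : M) :
    HasDerivWithinAt (fun s => lam s x) (-websterCurvature C (θs t) x) I t := by
  obtain ⟨v, hv⟩ := hθhat.exists_apply_ne_zero x
  have e : ∀ s ∈ I, Real.exp (2 * lam s x) = θs s x v / θhat x v := fun s hs => by
    rw [hθ s hs]
    exact (mul_div_cancel_right₀ _ hv).symm
  have h := ((hflow t ht x v).div_const (θhat x v)).congr e (e t ht)
  -- Taking logarithms makes the differentiability of `λ` in time part of the conclusion.
  have h1 := (h.log (Real.exp_pos _).ne').div_const 2
  simp only [Real.log_exp, mul_div_cancel_left₀ _ (two_ne_zero' ℝ)] at h1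
  refine h1.congr_deriv ?_
  have h2 : θs t x v ≠ 0 := by
    intro h0
    exact (Real.exp_pos (2 * lam t x)).ne' (by rw [e t ht, h0, zero_div])
  rw [e t ht]
  field_simp

/-- Along the flow `W = -λ̇` is smooth, because `λ` is. -/
lemma IsYamabeFlow.websterCurvature_smooth (hflow : IsYamabeFlow C I θs)
    (hI : I.OrdConnected) (hI' : I.Nontrivial)
    (hθhat : IsContactForm C θhat) (hθ : ∀ t ∈ I, θs t = conformal (lam t) θhat)
    (hlam : FamilySmoothOn lam I univ) (ht : t ∈ I) :
    FnSmoothOn (websterCurvature C (θs t)) univ :=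
  ((hlam.timeDeriv hI hI' isOpen_univ).fnSmoothOn ht).neg.congr fun x _ => by
    have h := (hflow.hasDerivWithinAt_conformalFactor hθhat hθ ht x).derivWithin
      (uniqueDiffOn_of_ordConnected hI hI' t ht)
    rw [timeDeriv, h, neg_neg]

lemma IsYamabeFlow.hasDerivWithinAt_conformalFactor_sub (hflow : IsYamabeFlow C I θs)
    (hθhat : IsContactForm C θhat) (hθ : ∀ t ∈ I, θs t = conformal (lam t) θhat) (ht : t ∈ I)
    (x : M) :
    HasDerivWithinAt (fun s => lam s x - lam t x) (-websterCurvature C (θs t) x) I t :=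
  (hflow.hasDerivWithinAt_conformalFactor hθhat hθ ht x).sub_const _

end Evolution
end CRYamabe
end

theorem lemma2p1 {M : Type*} [TopologicalSpace M] [ChartedSpace (EuclideanSpace ℝ (Fin 3)) M]
    [IsManifold (𝓡 3) ∞ M] [T2Space M] [SecondCountableTopology M] [CompactSpace M]
    (C : CRStructure M) (θhat : OneForm M ℝ) (hθhat : IsPositivePseudohermitian C θhat)
    (I : Set ℝ) (hI : I.OrdConnected) (hI' : I.Nontrivial)
    (lam : ℝ → M → ℝ)
    (hlam : ContMDiffOn (𝓘(ℝ, ℝ).prod (𝓡 3)) 𝓘(ℝ, ℝ) ∞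
      (fun p : ℝ × M => lam p.1 p.2) (I ×ˢ univ))
    (θ : ℝ → OneForm M ℝ) (hθ : ∀ t ∈ I, θ t = conformal (lam t) θhat)
    (hflow : IsYamabeFlow C I θ) :
    (∀ t ∈ I, ∀ x : M,
      HasDerivWithinAt (fun s => websterCurvature C (θ s) x)
        (4 * subLaplacian C (θ t) (websterCurvature C (θ t)) x
          + 2 * websterCurvature C (θ t) x ^ 2) I t) ∧
    (∀ (U : Set M) (Fhat : LocalFrame M) (F : ℝ → LocalFrame M), IsOpen U →
      Fhat.IsAdmissibleOn C θhat U →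
      (∀ t ∈ I, IsInducedFrame (lam t) θhat U Fhat (F t)) →
      ∀ t ∈ I, ∀ x ∈ U,
        HasDerivWithinAt (fun s => (F s).A11 (θ s) x)
          (2 * (websterCurvature C (θ t) x : ℂ) * (F t).A11 (θ t) x
            - 2 * Complex.I *
              (F t).hess11 (θ t) (fun y => (websterCurvature C (θ t) y : ℂ)) x) I t) := by
  have hsmooth := FamilySmoothOn.of_contMDiffOn hlam
  have hθs : ∀ t ∈ I, (θ t).SmoothOn univ := fun t ht => by
    rw [hθ t ht]
    exact conformal_smooth (hsmooth.fnSmoothOn ht) hθhat.smooth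
  have hlamU : ∀ (U : Set M), ∀ t ∈ I, FnSmoothOn (lam t) U := fun U t ht =>
    (hsmooth.fnSmoothOn ht).mono (subset_univ U)
  -- The forms and frames at time `s` are those at time `t`, changed by `λ_s - λ_t`.
  have hconf : ∀ t ∈ I, ∀ s ∈ I, conformal (fun y => lam s y - lam t y) (θ t) = θ s :=
    fun t ht s hs => by rw [hθ t ht, hθ s hs, conformal_conformal]
  have hadm : ∀ {U : Set M} {F₀ : LocalFrame M} {F : ℝ → LocalFrame M}, IsOpen U →
      F₀.IsAdmissibleOn C θhat U → (∀ t ∈ I, IsInducedFrame (lam t) θhat U F₀ (F t)) →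
      ∀ t ∈ I, (F t).IsAdmissibleOn C (θ t) U := fun hU hF₀ hF t ht => by
    rw [hθ t ht]
    exact (hF t ht).isAdmissibleOn hF₀ (hlamU _ t ht) (hθhat.smooth.mono (subset_univ _)) hU
  have hind : ∀ {U : Set M} {F₀ : LocalFrame M} {F : ℝ → LocalFrame M}, IsOpen U →
      F₀.IsAdmissibleOn C θhat U → (∀ t ∈ I, IsInducedFrame (lam t) θhat U F₀ (F t)) →
      ∀ t ∈ I, ∀ s ∈ I, IsInducedFrame (fun y => lam s y - lam t y) (θ t) U (F t) (F s) :=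
    fun hU hF₀ hF t ht s hs => by
      rw [hθ t ht]
      exact (hF t ht).sub (hF s hs) hF₀.toIsDualOn (hlamU _ t ht) (hlamU _ s hs) hU
  have hW : ∀ (U : Set M), ∀ t ∈ I, FnSmoothOn (websterCurvature C (θ t)) U := fun U t ht =>
    (hflow.websterCurvature_smooth hI hI' hθhat.toIsContactForm hθ hsmooth ht).mono (subset_univ U)
  have hderiv := fun (t : ℝ) (ht : t ∈ I) (y : M) =>
    hflow.hasDerivWithinAt_conformalFactor_sub hθhat.toIsContactForm hθ ht y
  constructor
  · intro t ht x
    obtain ⟨U, F₀, hU, hx, hF₀⟩ := hθhat.exists_frame x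
    choose F hF using fun s => hF₀.toIsDualOn.exists_induced (lam s)
    have hF' := hadm hU hF₀ fun s _ => hF s
    have h := hasDerivWithinAt_curv hI hI' hU ((hsmooth.sub_const ht).mono (subset_univ U))
      ((hθs t ht).mono (subset_univ U)) (hF' t ht) (hind hU hF₀ (fun s _ => hF s) t ht) ht
      (fun y => sub_self _) (fun y _ => hderiv t ht y) hx
    have e : ∀ s ∈ I, (websterCurvature C (θ s) x : ℂ)
        = (F s).curv (conformal (fun y => lam s y - lam t y) (θ t)) x := fun s hs => by
      rw [hconf t ht s hs, (hF' s hs).websterCurvature_eq (hθs s hs) hU hx]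
    have h' := Complex.reCLM.hasFDerivAt.comp_hasDerivWithinAt t (h.congr e (e t ht))
    refine HasDerivWithinAt.congr_deriv (f := fun s => websterCurvature C (θ s) x) h' ?_
    have hneg := (hF' t ht).hess_neg ((hθs t ht).mono (subset_univ U)) hU hx (hW U t ht).ofReal
    simp only [Complex.ofReal_neg]
    rw [hneg.2.1, hneg.2.2, ← (hF' t ht).websterCurvature_eq (hθs t ht) hU hx, ← neg_add,
      ← (hF' t ht).subLaplacian_eq (hθs t ht) hU hx (hW U t ht), Complex.reCLM_apply,
      ← Complex.ofReal_re (4 * subLaplacian C (θ t) (websterCurvature C (θ t)) x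
        + 2 * websterCurvature C (θ t) x ^ 2)]
    congr 1
    push_cast
    ring
  · intro U F₀ F hU hF₀ hF t ht x hx
    have hF' := hadm hU hF₀ hF t ht
    have h := hasDerivWithinAt_A11 hI hI' hU ((hsmooth.sub_const ht).mono (subset_univ U))
      ((hθs t ht).mono (subset_univ U)) hF' (hind hU hF₀ hF t ht) ht (fun y => sub_self _)
      (fun y _ => hderiv t ht y) hx
    have e : ∀ s ∈ I, (F s).A11 (θ s) x
        = (F s).A11 (conformal (fun y => lam s y - lam t y) (θ t)) x := fun s hs => by
      rw [hconf t ht s hs]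
    refine (h.congr e (e t ht)).congr_deriv ?_
    simp only [Complex.ofReal_neg]
    rw [(hF'.hess_neg ((hθs t ht).mono (subset_univ U)) hU hx (hW U t ht).ofReal).1]
    ring
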